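/- Let $p$ be a prime and let $G=\mathrm{GSp}_4$ be the group of symplectic similitudes of $\mathbb{Z}^4$ for the form with matrix $J=\begin{pmatrix}0&S\\-S&0\end{pmatrix}$, $S=\begin{pmatrix}0&1\\1&0\end{pmatrix}$. Let $T\subset B\subset G$ be the diagonal torus and the upper triangular Borel subgroup, let $\mathfrak g,\mathfrak b$ be the Lie algebras of $G,B$, and let $\mathfrak u^-\subset\mathfrak g$ be the subalgebra of strictly lower triangular matrices. Write $X^*(T)$ for the set of triples $(a,b,c)\in\mathbb{Z}^3$ with $a+b\equiv c \bmod 2$, where $(a,b,c)$ is the character $\mathrm{diag}(t_1,t_2,vt_2^{-1},vt_1^{-1})\mapsto t_1^at_2^bv^{(c-a-b)/2}$. The positive roots are $\Phi^+=\{\alpha,\beta,\alpha+\beta,2\alpha+\beta\}$ with $\alpha=(1,-1,0)$, $\beta=(0,2,0)$. The pairings of $(a,b,c)$ with $\alpha^\vee,\beta^\vee,(\alpha+\beta)^\vee,(2\alpha+\beta)^\vee$ are $a-b,\ b,\ a+b,\ a$ respectively. Put $\rho=(2,1,3)$, and write $\lambda\le\mu$ if $\mu-\lambda$ is a sum of positive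 roots. For a commutative ring $R$ and $\lambda\in X^*(T)$ let $\mathrm{Ver}_B(\lambda)=U\mathfrak g\otimes_{U\mathfrak b}\lambda$ over $R$, where $U$ denotes the universal enveloping algebra; $U\mathfrak g$ acts by left multiplication and $B$ acts by the adjoint action on $U\mathfrak g$ and through $\lambda$ on the second factor. Let $\mathrm{Hom}_{(U\mathfrak g,B)_R}$ denote the $R$-module of $U\mathfrak g$-linear maps that are equivariant for the algebraic group $B_R$. For $\gamma\in\Phi^+$ and $n\in\mathbb{Z}$ let $$s_{\gamma,n}\cdot\lambda=\lambda+(pn-\langle\lambda+\rho,\gamma^\vee\rangle)\gamma .$$ Write $\lambda\uparrow_\gamma\mu$ if $\mu=s_{\gamma,n}\cdot\lambda$, where $n$ is the minimal integer with $\lambda\le s_{\gamma,n}\cdot\lambda$. Write $\lambda\uparrow\mu$ if there is a (possibly empty) chain $\lambda\uparrow_{\gamma_1}\lambda_1\uparrow_{\gamma_2}\cdots\uparrow_{\gamma_k}\mu$ with $\gamma_i\in\Phi^+$. **Proposition.** Let $\lambda,\mu\in X^*(T)$. (1) Suppose $\lambda\uparrow_\gamma\mu$ for some $\gamma\in\Phi^+$,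 and let $n$ be the integer with $\mu=s_{\gamma,n}\cdot\lambda$. Then there is a one-dimensional subspace $$L\subset \mathrm{Hom}_{(U\mathfrak g,B)_{\mathbb F_p}}(\mathrm{Ver}_B(\lambda),\mathrm{Ver}_B(\mu)),$$ so that this Hom space is nonzero, with the following explicit description. For every $\nu\in X^*(T)$ with $\langle\nu,\gamma^\vee\rangle=1$ put $\tilde\lambda=\lambda-pn\nu$. Then there exists $f\in U\mathfrak u^-_{\mathbb Z_p}$, nonzero modulo $p$, such that $1\otimes\tilde\lambda\mapsto f\otimes (s_{\gamma,0}\cdot\tilde\lambda)$ defines a map of $(U\mathfrak g,B)$-modules $\mathrm{Ver}_B(\tilde\lambda)\to\mathrm{Ver}_B(s_{\gamma,0}\cdot\tilde\lambda)$ over $\mathbb Q_p$; and for every such $f$, with reduction $\bar f$ modulo $p$, the assignment $1\otimes\lambda\mapsto\bar f\otimes\mu$ defines a map $\mathrm{Ver}_B(\lambda)\to\mathrm{Ver}_B(\mu)$ over $\mathbb F_p$ that spans $L$. In particular $L$ does not depend on the choice of $\nu$ and $f$. (2) If $\lambda\uparrow\mu$, then $\mathrm{Hom}_{(U\mathfrak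 g,B)_{\mathbb F_p}}(\mathrm{Ver}_B(\lambda),\mathrm{Ver}_B(\mu))\neq0$. -/

import Mathlib

attribute [local instance] LieRing.ofAssociativeRing

noncomputable section

namespace GSp4

/-! ## The group `GSp₄`, its Borel subgroup and their Lie algebras -/

/-- The Gram matrix `J = (0 S; -S 0)` of the symplectic form, with `S = (0 1; 1 0)`. -/
def J (A : Type) [CommRing A] : Matrix (Fin 4) (Fin 4) A :=
  !![0, 0, 0, 1; 0, 0, 1, 0; 0, -1, 0, 0; -1, 0, 0, 0]

/-- The upper triangular Borel subgroup `B` of `GSp₄`, on `A`-points: the invertible upper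
triangular matrices `g` that are symplectic similitudes, `gᵀ J g = v J` with `v ∈ Aˣ`. -/
def Borel (A : Type) [CommRing A] : Subgroup (GL (Fin 4) A) where
  carrier := {g | (g : Matrix (Fin 4) (Fin 4) A).BlockTriangular id ∧
    ∃ v : Aˣ, (g : Matrix (Fin 4) (Fin 4) A).transpose * J A * (g : Matrix (Fin 4) (Fin 4) A)
      = (v : A) • J A}
  one_mem' := ⟨by simpa using Matrix.blockTriangular_one, 1, by simp⟩
  mul_mem' := by
    rintro g h ⟨hg, v, hv⟩ ⟨hh, w, hw⟩
    refine ⟨by simpa using hg.mul hh, v * w, ?_⟩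
    have key : ∀ a b : Matrix (Fin 4) (Fin 4) A, (a * b).transpose * J A * (a * b)
        = b.transpose * (a.transpose * J A * a) * b := by
      intro a b
      simp only [Matrix.transpose_mul, Matrix.mul_assoc]
    rw [Units.val_mul, Units.val_mul, key, hv, Matrix.mul_smul, Matrix.smul_mul, hw, smul_smul]
  inv_mem' := by
    rintro g ⟨hg, v, hv⟩
    refine ⟨?_, v⁻¹, ?_⟩
    · have := Matrix.blockTriangular_inv_of_blockTriangular hg
      simpa using this
    · have h1 : (g : Matrix (Fin 4) (Fin 4) A) * ((g⁻¹ : GL (Fin 4) A) : Matrix (Fin 4) (Fin 4) A)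
        = 1 := by rw [← Units.val_mul]; simp
      have h2 : ((g⁻¹ : GL (Fin 4) A) : Matrix (Fin 4) (Fin 4) A).transpose
        * (g : Matrix (Fin 4) (Fin 4) A).transpose = 1 := by
        rw [← Matrix.transpose_mul, h1, Matrix.transpose_one]
      generalize ((g⁻¹ : GL (Fin 4) A) : Matrix (Fin 4) (Fin 4) A) = k at *
      generalize (g : Matrix (Fin 4) (Fin 4) A) = m at *
      have h3 : k.transpose * (m.transpose * J A * m) * k = J A := by
        calc k.transpose * (m.transpose * J A * m) * k
            = (k.transpose * m.transpose) * J A * (m * k) := by simp only [Matrix.mul_assoc]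
          _ = J A := by rw [h1, h2]; simp
      rw [hv, Matrix.mul_smul, Matrix.smul_mul] at h3
      rw [← h3, smul_smul, Units.inv_mul, one_smul, h3]

/-- The Lie algebra `𝔤 = 𝔤𝔰𝔭₄` over `R`: the matrices `X` with `Xᵀ J + J X = c J`. -/
def lieG (R : Type) [CommRing R] : LieSubalgebra R (Matrix (Fin 4) (Fin 4) R) where
  carrier := {X | ∃ c : R, X.transpose * J R + J R * X = c • J R}
  zero_mem' := ⟨0, by simp⟩
  add_mem' := by
    rintro X Y ⟨c, hc⟩ ⟨d, hd⟩
    refine ⟨c + d, ?_⟩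
    rw [add_smul, ← hc, ← hd, Matrix.transpose_add]
    noncomm_ring
  smul_mem' := by
    rintro r X ⟨c, hc⟩
    refine ⟨r * c, ?_⟩
    rw [mul_smul, ← hc]
    simp [smul_add]
  lie_mem' := by
    rintro X Y ⟨c, hc⟩ ⟨d, hd⟩
    refine ⟨0, ?_⟩
    have hX : X.transpose * J R = c • J R - J R * X := eq_sub_of_add_eq hc
    have hY : Y.transpose * J R = d • J R - J R * Y := eq_sub_of_add_eq hd
    rw [LieRing.of_associative_ring_bracket, Matrix.transpose_sub, Matrix.transpose_mul,
      Matrix.transpose_mul, sub_mul, Matrix.mul_assoc, Matrix.mul_assoc, hX, hY, mul_sub, mul_sub,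
      Matrix.mul_smul, Matrix.mul_smul, hX, hY, ← Matrix.mul_assoc, ← Matrix.mul_assoc, hX, hY]
    simp only [smul_sub, sub_mul, mul_sub, Matrix.smul_mul, smul_comm c d, Matrix.mul_assoc,
      zero_smul]
    abel

/-- `X` lies in the Borel subalgebra `𝔟 = Lie B` of upper triangular matrices in `𝔤`. -/
def MemLieB {R : Type} [CommRing R] (X : lieG R) : Prop :=
  (X : Matrix (Fin 4) (Fin 4) R).BlockTriangular id

/-- `X` lies in the subalgebra `𝔲⁻` of strictly lower triangular matrices in `𝔤`, the nilpotent
radical of the Borel subalgebra opposite to `𝔟`. -/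
def MemLieUMinus {R : Type} [CommRing R] (X : lieG R) : Prop :=
  ∀ i j : Fin 4, i ≤ j → (X : Matrix (Fin 4) (Fin 4) R) i j = 0

/-- The extension of scalars `𝔤(R) → 𝔤(A)` along a ring homomorphism. -/
def lieGMap {R A : Type} [CommRing R] [CommRing A] (φ : R →+* A) (X : lieG R) : lieG A :=
  ⟨(X : Matrix (Fin 4) (Fin 4) R).map φ, by
    obtain ⟨X, c, hc⟩ := X
    refine ⟨φ c, ?_⟩
    have hJ : (J R).map φ = J A := by
      ext i j
      fin_cases i <;> fin_cases j <;> simp [J]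
    have h := congrArg (fun M => M.map φ) hc
    simp only [Matrix.map_add φ (map_add φ), Matrix.map_mul, hJ] at h
    rw [Matrix.transpose_map] at h
    refine h.trans ?_
    rw [← hJ]
    ext i j
    simp⟩

/-- The universal enveloping algebra `U𝔤` over `R`. -/
abbrev Ug (R : Type) [CommRing R] : Type := UniversalEnvelopingAlgebra R (lieG R)

/-- The extension of scalars `U𝔤(R) → U𝔤(A)` along a ring homomorphism. -/
def UgMap {R A : Type} [CommRing R] [CommRing A] (φ : R →+* A) : Ug R →+* Ug A :=
  letI : Algebra R (Ug A) := Algebra.compHom (Ug A) φ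
  (UniversalEnvelopingAlgebra.lift R (A := Ug A)
    { toFun := fun X => UniversalEnvelopingAlgebra.ι A (lieGMap φ X)
      map_add' := fun X Y => by
        rw [← map_add]; congr 1; ext i j; simp [lieGMap]
      map_smul' := fun r X => by
        change _ = φ r • UniversalEnvelopingAlgebra.ι A (lieGMap φ X)
        rw [← map_smul]; congr 1; ext i j; simp [lieGMap]
      map_lie' := fun {X Y} => by
        rw [← LieHom.map_lie]; congr 1
        apply Subtype.ext
        simp [lieGMap, LieRing.of_associative_ring_bracket, Matrix.map_sub φ (map_sub φ),
          Matrix.map_mul] }).toRingHom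

theorem UgMap_ι {R A : Type} [CommRing R] [CommRing A] (φ : R →+* A) (X : lieG R) :
    UgMap φ (UniversalEnvelopingAlgebra.ι R X) = UniversalEnvelopingAlgebra.ι A (lieGMap φ X) := by
  let _ : Algebra R (Ug A) := Algebra.compHom (Ug A) φ
  exact UniversalEnvelopingAlgebra.lift_ι_apply R _ X

theorem UgMap_algebraMap {R A : Type} [CommRing R] [CommRing A] (φ : R →+* A) (r : R) :
    UgMap φ (algebraMap R (Ug R) r) = algebraMap A (Ug A) (φ r) := by
  let _ : Algebra R (Ug A) := Algebra.compHom (Ug A) φ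
  exact AlgHom.commutes (UniversalEnvelopingAlgebra.lift R (A := Ug A) _) r

/-- The subalgebra `U𝔲⁻` of `U𝔤`. -/
def UuMinus (R : Type) [CommRing R] : Subalgebra R (Ug R) :=
  Algebra.adjoin R (UniversalEnvelopingAlgebra.ι R '' {X : lieG R | MemLieUMinus X})

/-! ## Weights and linkage -/

/-- The weight lattice `X^*(T)`: triples `(a, b, c)` of integers with `a + b ≡ c mod 2`. The triple
stands for the character `diag(t₁, t₂, v t₂⁻¹, v t₁⁻¹) ↦ t₁ ^ a t₂ ^ b v ^ ((c - a - b) / 2)` of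
the diagonal torus `T`. -/
def Weight : AddSubgroup (ℤ × ℤ × ℤ) where
  carrier := {x | x.1 + x.2.1 ≡ x.2.2 [ZMOD 2]}
  zero_mem' := by decide
  add_mem' := by
    rintro ⟨a, b, c⟩ ⟨a', b', c'⟩ h h'
    simp only [Set.mem_ofPred_eq, Int.ModEq, Prod.mk_add_mk] at *
    omega
  neg_mem' := by
    rintro ⟨a, b, c⟩ h
    simp only [Set.mem_ofPred_eq, Int.ModEq, Prod.neg_mk] at *
    omega

/-- The positive roots `Φ⁺ = {α, β, α + β, 2α + β}`, with `α` short and `β` long. -/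
inductive PosRoot
  | α
  | β
  | αβ
  | ααβ

/-- A positive root as a weight: `α = (1, -1, 0)`, `β = (0, 2, 0)`. -/
def PosRoot.wt : PosRoot → Weight
  | .α => ⟨(1, -1, 0), (by decide : _ ≡ _ [ZMOD 2])⟩
  | .β => ⟨(0, 2, 0), (by decide : _ ≡ _ [ZMOD 2])⟩
  | .αβ => ⟨(1, 1, 0), (by decide : _ ≡ _ [ZMOD 2])⟩
  | .ααβ => ⟨(2, 0, 0), (by decide : _ ≡ _ [ZMOD 2])⟩

/-- The pairing `⟨x, γ^∨⟩`, with coroots `α^∨ = (1, -1)`, `β^∨ = (0, 1)`, `(α + β)^∨ = (1, 1)` and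
`(2α + β)^∨ = (1, 0)`. -/
def pairing (x : Weight) : PosRoot → ℤ
  | .α => x.1.1 - x.1.2.1
  | .β => x.1.2.1
  | .αβ => x.1.1 + x.1.2.1
  | .ααβ => x.1.1

/-- The half sum of the positive roots, up to a central translation. -/
def ρ : Weight := ⟨(2, 1, 3), (by decide : _ ≡ _ [ZMOD 2])⟩

/-- The affine reflection `s_{γ,n} · x = x + (p n - ⟨x + ρ, γ^∨⟩) γ`. -/
def reflect (p : ℕ) (γ : PosRoot) (n : ℤ) (x : Weight) : Weight :=
  x + (p * n - pairing (x + ρ) γ) • γ.wt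

/-- The order on weights: `x ≤ y` if `y - x` is a sum of positive roots. -/
def WeightLE (x y : Weight) : Prop :=
  y - x ∈ AddSubmonoid.closure (Set.range PosRoot.wt)

/-- `x ↑_γ y` through `n`: `y = s_{γ,n} · x`, where `n` is minimal with `x ≤ s_{γ,n} · x`. -/
def UpAt (p : ℕ) (γ : PosRoot) (n : ℤ) (x y : Weight) : Prop :=
  y = reflect p γ n x ∧ IsLeast {m : ℤ | WeightLE x (reflect p γ m x)} n

/-- The relation `x ↑_γ y`. -/
def UpRoot (p : ℕ) (γ : PosRoot) (x y : Weight) : Prop :=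
  ∃ n : ℤ, UpAt p γ n x y

/-- The linkage relation `x ↑ y`: there is a chain `x ↑_{γ₁} x₁ ↑_{γ₂} ⋯ ↑_{γₖ} y`. -/
def Up (p : ℕ) : Weight → Weight → Prop :=
  Relation.ReflTransGen fun x y => ∃ γ : PosRoot, UpRoot p γ x y

/-! ## Weights as characters of `B` and of `𝔟` -/

theorem diag_mul {A : Type} [CommRing A] {M N : Matrix (Fin 4) (Fin 4) A}
    (hM : M.BlockTriangular id) (hN : N.BlockTriangular id) (i : Fin 4) :
    (M * N) i i = M i i * N i i := by
  rw [Matrix.mul_apply, Finset.sum_eq_single i]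
  · intro j _ hj
    rcases lt_or_gt_of_ne hj with h | h
    · rw [hM h, zero_mul]
    · rw [hN h, mul_zero]
  · simp

/-- The `i`-th diagonal entry of an element of `B`, as a unit. -/
def diagUnit {A : Type} [CommRing A] (i : Fin 4) : Borel A →* Aˣ where
  toFun g :=
    { val := (g : GL (Fin 4) A).1 i i
      inv := ((g⁻¹ : Borel A) : GL (Fin 4) A).1 i i
      val_inv := by
        rw [← diag_mul g.2.1 (g⁻¹).2.1, ← Units.val_mul, ← Subgroup.coe_mul]
        simp
      inv_val := by
        rw [← diag_mul (g⁻¹).2.1 g.2.1, ← Units.val_mul, ← Subgroup.coe_mul]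
        simp }
  map_one' := by ext; simp
  map_mul' g h := by
    ext
    exact diag_mul g.2.1 h.2.1 i

/-- A weight as a character of `B`, trivial on the unipotent radical. For `g ∈ B` one has
`t₁ = g₁₁`, `t₂ = g₂₂`, and the similitude factor is `v = g₁₁ g₄₄`. -/
def borelChar (x : Weight) {A : Type} [CommRing A] (g : Borel A) : Aˣ :=
  diagUnit 0 g ^ x.1.1 * diagUnit 1 g ^ x.1.2.1 *
    (diagUnit 0 g * diagUnit 3 g) ^ ((x.1.2.2 - x.1.1 - x.1.2.1) / 2)

/-- The derivative of `borelChar`; it is used on upper triangular matrices only. -/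
def lieChar (x : Weight) {R : Type} [CommRing R] (Y : lieG R) : R :=
  (x.1.1 : R) * Y.1 0 0 + (x.1.2.1 : R) * Y.1 1 1 +
    (((x.1.2.2 - x.1.1 - x.1.2.1) / 2 : ℤ) : R) * (Y.1 0 0 + Y.1 3 3)

/-! ## Verma modules -/

/-- The left ideal of `U𝔤` generated by the elements `Y - x(Y)` for `Y ∈ 𝔟`. -/
def vermaIdeal (R : Type) [CommRing R] (x : Weight) : Ideal (Ug R) :=
  Ideal.span {u | ∃ Y : lieG R, MemLieB Y ∧
    u = UniversalEnvelopingAlgebra.ι R Y - algebraMap R (Ug R) (lieChar x Y)}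

/-- The Verma module `Ver_B(x) = U𝔤 ⊗_{U𝔟} x` over `R`. Since `x` is the quotient of `U𝔟` by the
left ideal generated by the `Y - x(Y)` for `Y ∈ 𝔟`, the tensor product is the quotient of `U𝔤` by the
left ideal generated by these elements; the class of `u` is `u ⊗ x`. -/
abbrev Verma (R : Type) [CommRing R] (x : Weight) : Type := Ug R ⧸ vermaIdeal R x

/-- The element `u ⊗ x` of `Ver_B(x)`. -/
def Verma.mk {R : Type} [CommRing R] (x : Weight) (u : Ug R) : Verma R x :=
  Submodule.Quotient.mk u

/-- The extension of scalars `Ver_B(x)(R) → Ver_B(x)(A)`, `u ⊗ x ↦ u ⊗ x`. -/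
def vermaMap {R A : Type} [CommRing R] [CommRing A] (φ : R →+* A) (x : Weight) :
    Verma R x →ₛₗ[UgMap φ] Verma A x :=
  Submodule.mapQ (vermaIdeal R x) (vermaIdeal A x) (UgMap φ).toSemilinearMap (by
    refine Submodule.span_le.2 ?_
    rintro _ ⟨Y, hY, rfl⟩
    refine Submodule.subset_span ⟨lieGMap φ Y, ?_, ?_⟩
    · intro i j hij
      simp [lieGMap, hY hij]
    · rw [RingHom.coe_toSemilinearMap, map_sub, UgMap_ι, UgMap_algebraMap]
      simp [lieChar, lieGMap])

/-- The adjoint action of `B` on `𝔤`, by conjugation of matrices. -/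
def adLie {A : Type} [CommRing A] (g : Borel A) : lieG A →ₗ⁅A⁆ lieG A where
  toFun X := ⟨(g : GL (Fin 4) A).1 * X.1 * ((g⁻¹ : Borel A) : GL (Fin 4) A).1, by
    obtain ⟨X, c, hc⟩ := X
    obtain ⟨v, hv⟩ := g.2.2
    refine ⟨c, ?_⟩
    have h1 : (g : GL (Fin 4) A).1 * ((g⁻¹ : Borel A) : GL (Fin 4) A).1 = 1 := by
      rw [← Units.val_mul, ← Subgroup.coe_mul]; simp
    generalize ((g⁻¹ : Borel A) : GL (Fin 4) A).1 = k at *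
    generalize (g : GL (Fin 4) A).1 = m at *
    have h2 : k.transpose * m.transpose = 1 := by
      rw [← Matrix.transpose_mul, h1, Matrix.transpose_one]
    have h3 : m.transpose * J A = (v : A) • (J A * k) := by
      rw [← Matrix.smul_mul, ← hv, Matrix.mul_assoc, h1, Matrix.mul_one]
    have h4 : J A * m = (v : A) • (k.transpose * J A) := by
      rw [← Matrix.mul_smul, ← hv, ← Matrix.mul_assoc, ← Matrix.mul_assoc, h2, Matrix.one_mul]
    have h5 : (v : A) • (k.transpose * J A * k) = J A := by
      rw [← Matrix.smul_mul, ← h4, Matrix.mul_assoc, h1, Matrix.mul_one]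
    calc (m * X * k).transpose * J A + J A * (m * X * k)
        = k.transpose * X.transpose * (m.transpose * J A) + (J A * m) * X * k := by
          simp only [Matrix.transpose_mul, Matrix.mul_assoc]
      _ = (v : A) • (k.transpose * (X.transpose * J A + J A * X) * k) := by
          rw [h3, h4]
          simp only [Matrix.mul_smul, Matrix.smul_mul, mul_add, add_mul, smul_add,
            Matrix.mul_assoc]
      _ = c • J A := by
          rw [hc, Matrix.mul_smul, Matrix.smul_mul, smul_comm, h5]⟩
  map_add' X Y := by
    ext i j
    simp [mul_add, add_mul]
  map_smul' r X := by
    ext i j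
    simp
  map_lie' {X Y} := by
    have h1 : ((g⁻¹ : Borel A) : GL (Fin 4) A).1 * (g : GL (Fin 4) A).1 = 1 := by
      rw [← Units.val_mul, ← Subgroup.coe_mul]; simp
    apply Subtype.ext
    simp only [LieSubalgebra.coe_bracket, LieRing.of_associative_ring_bracket]
    generalize ((g⁻¹ : Borel A) : GL (Fin 4) A).1 = k at *
    generalize (g : GL (Fin 4) A).1 = m at *
    have key : ∀ a b : Matrix (Fin 4) (Fin 4) A, m * (a * b) * k = (m * a * k) * (m * b * k) := by
      intro a b
      calc m * (a * b) * k = m * a * 1 * b * k := by simp only [Matrix.mul_assoc, Matrix.one_mul]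
        _ = _ := by rw [← h1]; simp only [Matrix.mul_assoc]
    rw [mul_sub, sub_mul, key, key]

/-- The adjoint action of `B` on `U𝔤`. -/
def adUg {A : Type} [CommRing A] (g : Borel A) : Ug A →ₐ[A] Ug A :=
  UniversalEnvelopingAlgebra.lift A ((UniversalEnvelopingAlgebra.ι A).comp (adLie g))

theorem adUg_ι {A : Type} [CommRing A] (g : Borel A) (X : lieG A) :
    adUg g (UniversalEnvelopingAlgebra.ι A X) = UniversalEnvelopingAlgebra.ι A (adLie g X) :=
  UniversalEnvelopingAlgebra.lift_ι_apply A _ X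

theorem adLie_diag {A : Type} [CommRing A] (g : Borel A) {Y : lieG A} (hY : MemLieB Y)
    (i : Fin 4) : (adLie g Y).1 i i = Y.1 i i := by
  have h1 : (g : GL (Fin 4) A).1 i i * ((g⁻¹ : Borel A) : GL (Fin 4) A).1 i i = 1 :=
    (diagUnit i g).val_inv
  change ((g : GL (Fin 4) A).1 * Y.1 * ((g⁻¹ : Borel A) : GL (Fin 4) A).1) i i = _
  rw [diag_mul (g.2.1.mul hY) (g⁻¹).2.1, diag_mul g.2.1 hY, mul_right_comm, h1, one_mul]

/-- The map `u ⊗ x ↦ Ad(g)(u) ⊗ x` of `Ver_B(x)`. -/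
def adVerma (x : Weight) {A : Type} [CommRing A] (g : Borel A) :
    Verma A x →ₛₗ[(adUg g : Ug A →+* Ug A)] Verma A x :=
  Submodule.mapQ (vermaIdeal A x) (vermaIdeal A x)
    (adUg g : Ug A →+* Ug A).toSemilinearMap (by
    refine Submodule.span_le.2 ?_
    rintro _ ⟨Y, hY, rfl⟩
    refine Submodule.subset_span ⟨adLie g Y, (g.2.1.mul hY).mul (g⁻¹).2.1, ?_⟩
    rw [RingHom.coe_toSemilinearMap, RingHom.coe_coe, map_sub, adUg_ι, AlgHom.commutes]
    simp [lieChar, adLie_diag g hY])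

/-- The action of `g ∈ B(A)` on `Ver_B(x)` over `A`: the adjoint action on `U𝔤` and the character
`x` on the second factor, `g (u ⊗ x) = x(g) Ad(g)(u) ⊗ x`. -/
def borelAct (x : Weight) {A : Type} [CommRing A] (g : Borel A) : Verma A x →ₗ[A] Verma A x where
  toFun v := (borelChar x g : A) • adVerma x g v
  map_add' v w := by rw [map_add, smul_add]
  map_smul' r v := by
    have h : adVerma x g (r • v) = r • adVerma x g v := by
      rw [← algebraMap_smul (Ug A) r v, LinearMap.map_smulₛₗ]
      simp
    rw [h, smul_comm, RingHom.id_apply]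

/-- The space `Hom_{(U𝔤, B)}(Ver_B(x), Ver_B(y))` over `R`: the `U𝔤`-linear maps `f` that are
equivariant for the algebraic group `B` over `R`, that is, whose base change `fA` to every
commutative `R`-algebra `A` commutes with the action of `B(A)`. (The base change of `Ver_B(x)` to `A`
is `Ver_B(x)` over `A`, and `fA` is determined by `f`, as it is `U𝔤`-linear over `A` and `1 ⊗ x`
generates.) -/
def homUgB (R : Type) [CommRing R] (x y : Weight) :
    Submodule R (Verma R x →ₗ[Ug R] Verma R y) where
  carrier := {f | ∀ (A : Type) [CommRing A] (φ : R →+* A),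
    ∃ fA : Verma A x →ₗ[Ug A] Verma A y,
      (∀ v, fA (vermaMap φ x v) = vermaMap φ y (f v)) ∧
      ∀ (g : Borel A) (v : Verma A x), fA (borelAct x g v) = borelAct y g (fA v)}
  zero_mem' := by
    intro A _ φ
    exact ⟨0, by simp, by simp⟩
  add_mem' := by
    intro f f' hf hf' A _ φ
    obtain ⟨fA, h1, h2⟩ := hf A φ
    obtain ⟨fA', h1', h2'⟩ := hf' A φ
    exact ⟨fA + fA', by simp [h1, h1'], by simp [h2, h2']⟩
  smul_mem' := by
    intro r f hf A _ φ
    obtain ⟨fA, h1, h2⟩ := hf A φ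
    refine ⟨φ r • fA, fun v => ?_, by simp [h2]⟩
    rw [LinearMap.smul_apply, LinearMap.smul_apply, h1, ← algebraMap_smul (Ug R) r (f v),
      LinearMap.map_smulₛₗ, UgMap_algebraMap, algebraMap_smul]

/-! ## The maps in characteristic `p` -/

/-- `f ∈ U𝔲⁻` over `ℤ_p` is nonzero modulo `p`, and over `ℚ_p` it gives a map
`Ver_B(x) → Ver_B(y)`, `1 ⊗ x ↦ f ⊗ y`, of `(U𝔤, B)`-modules. -/
def IsIntegralVermaMap (p : ℕ) [Fact p.Prime] (x y : Weight) (f : Ug ℤ_[p]) : Prop :=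
  f ∈ UuMinus ℤ_[p] ∧ UgMap PadicInt.toZMod f ≠ 0 ∧
    ∃ ψ ∈ homUgB ℚ_[p] x y, ψ (Verma.mk x 1) = Verma.mk y (UgMap PadicInt.Coe.ringHom f)

end GSp4

end

/-!
A map `Ver_B(x) → Ver_B(y)` is the same as a singular vector of weight `x` in `Ver_B(y)`, that is,
a vector on which `B` acts through `x`. The proof writes down such vectors explicitly over `ℤ`.

*The model.* `Ver_B(μ)` has a basis `y_β ^ a y_{α+β} ^ b y_{2α+β} ^ c y_α ^ d ⊗ μ`, over every
ring. Instead of quoting the Poincaré–Birkhoff–Witt theorem, `𝔤` is made to act on polynomials in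
four variables by differential operators (`op`); these respect brackets (`op_lie`), so they define
an action `act` of `U𝔤`, and `u ⊗ μ = 0` exactly if `act μ u 1 = 0` (`mem_vermaIdeal_iff`). Also
`U𝔲⁻` is identified with the polynomials (`UuMinus_eq_pbw`).

*Singular vectors.* If `⟨y + ρ, γ^∨⟩ = N ≥ 0`, then `∑ P (P - 1) ⋯ (P - b - 2 c + 1) · R (R - 1) ⋯
(R - b - c + 1) / (b! c!) · y_β ^ (B - b - c) y_{α+β} ^ b y_{2α+β} ^ c y_α ^ (K - b - 2 c)`, with
`N γ = K α + B β` and suitable integers `P`, `R`, is an integral singular vector of weight `y - N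
γ` with leading coefficient `1` (`isSingular_rootSing`). A vector over `ℤ` killed by a root vector
`Z` is fixed by the root subgroup `exp(t Z)`, because its orbit over `ℤ[t]` has derivative zero
(`act_adUg_rootElt`). As `B` is generated by the torus and root subgroups over every ring, a
singular vector over `ℤ` gives a `(U𝔤, B)`-equivariant map over every ring (`exists_mem_homUgB`).

*Characteristic `p`.* If `x ↑_γ y`, then `y = x + N γ` with `0 ≤ N < p`, and `⟨y + ρ, γ^∨⟩ ≡ N`
modulo `p`. The weight `ỹ = y - p n ν` satisfies `⟨ỹ + ρ, γ^∨⟩ = N`, and it has the same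
differential as `y` modulo `p`, so the reduction of the singular vector for `ỹ` defines a map
`Ver_B(x) → Ver_B(y)` (`exists_hom_rootSing`). The parameters `P`, `R` depend on `ỹ` through
congruence classes modulo `p`, and the only denominators are prime to `p` as `b + c ≤ N < p`, so
this reduction does not depend on `ν` (`map_rootSing_congr`). Over `ℚ_p` a singular vector is
determined by its leading coefficient (`singular_eq_zero`), so every `f` is a multiple of the
explicit vector (`IsIntegralVermaMap.toZMod_eq`). This gives the first part.

For the second part it remains to compose maps. To leading order `U𝔲⁻` acts on the model by
multiplication of polynomials (`degLT_act_pbw_sub`), and `𝔽_p` is a domain, so composites of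
nonzero maps are nonzero (`comp_ne_zero`).
-/

noncomputable section

namespace GSp4

open MvPolynomial

/-! ### Root vectors of `𝔤𝔰𝔭₄` -/

section RootVectors

variable {A : Type} [CommRing A]

/-- The entries of an element of `𝔤𝔰𝔭₄` that are determined by the others. -/
theorem lieG_entries (Z : lieG A) :
    Z.1 3 1 = Z.1 2 0 ∧ Z.1 3 2 = -Z.1 1 0 ∧ Z.1 2 3 = -Z.1 0 1 ∧ Z.1 1 3 = Z.1 0 2 ∧
      Z.1 3 3 = Z.1 1 1 + Z.1 2 2 - Z.1 0 0 := by
  obtain ⟨Z, c, hc⟩ := Z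
  have h : ∀ i j, _ := fun i j => congrFun (congrFun hc i) j
  have h01 := h 0 1
  have h02 := h 0 2
  have h13 := h 1 3
  have h23 := h 2 3
  have h03 := h 0 3
  have h12 := h 1 2
  simp only [Matrix.add_apply, Matrix.smul_apply, Matrix.mul_apply, Fin.sum_univ_four,
    Matrix.transpose_apply] at h01 h02 h13 h23 h03 h12
  simp [J] at h01 h02 h13 h23 h03 h12
  refine ⟨?_, ?_, ?_, ?_, ?_⟩ <;> dsimp only
  · linear_combination h01
  · linear_combination h02
  · linear_combination h13
  · linear_combination -h23
  · linear_combination h03 - h12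

/-- The root vector `E₃₂ - E₁₀` of weight `-α`. -/
def yα : lieG A := ⟨!![0, 0, 0, 0; -1, 0, 0, 0; 0, 0, 0, 0; 0, 0, 1, 0], 0, by
  ext i j; fin_cases i <;> fin_cases j <;> simp [J, Matrix.mul_apply, Fin.sum_univ_four]⟩

/-- The root vector `E₂₁` of weight `-β`. -/
def yβ : lieG A := ⟨!![0, 0, 0, 0; 0, 0, 0, 0; 0, 1, 0, 0; 0, 0, 0, 0], 0, by
  ext i j; fin_cases i <;> fin_cases j <;> simp [J, Matrix.mul_apply, Fin.sum_univ_four]⟩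

/-- The root vector `E₂₀ + E₃₁` of weight `-(α + β)`. -/
def yαβ : lieG A := ⟨!![0, 0, 0, 0; 0, 0, 0, 0; 1, 0, 0, 0; 0, 1, 0, 0], 0, by
  ext i j; fin_cases i <;> fin_cases j <;> simp [J, Matrix.mul_apply, Fin.sum_univ_four]⟩

/-- The root vector `E₃₀` of weight `-(2α + β)`. -/
def yααβ : lieG A := ⟨!![0, 0, 0, 0; 0, 0, 0, 0; 0, 0, 0, 0; 1, 0, 0, 0], 0, by
  ext i j; fin_cases i <;> fin_cases j <;> simp [J, Matrix.mul_apply, Fin.sum_univ_four]⟩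

/-- The root vector `E₂₃ - E₀₁` of weight `α`. -/
def xα : lieG A := ⟨!![0, -1, 0, 0; 0, 0, 0, 0; 0, 0, 0, 1; 0, 0, 0, 0], 0, by
  ext i j; fin_cases i <;> fin_cases j <;> simp [J, Matrix.mul_apply, Fin.sum_univ_four]⟩

/-- The root vector `E₁₂` of weight `β`. -/
def xβ : lieG A := ⟨!![0, 0, 0, 0; 0, 0, 1, 0; 0, 0, 0, 0; 0, 0, 0, 0], 0, by
  ext i j; fin_cases i <;> fin_cases j <;> simp [J, Matrix.mul_apply, Fin.sum_univ_four]⟩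

/-- The root vector `E₀₂ + E₁₃` of weight `α + β`. -/
def xαβ : lieG A := ⟨!![0, 0, 1, 0; 0, 0, 0, 1; 0, 0, 0, 0; 0, 0, 0, 0], 0, by
  ext i j; fin_cases i <;> fin_cases j <;> simp [J, Matrix.mul_apply, Fin.sum_univ_four]⟩

/-- The root vector `E₀₃` of weight `2α + β`. -/
def xααβ : lieG A := ⟨!![0, 0, 0, 1; 0, 0, 0, 0; 0, 0, 0, 0; 0, 0, 0, 0], 0, by
  ext i j; fin_cases i <;> fin_cases j <;> simp [J, Matrix.mul_apply, Fin.sum_univ_four]⟩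

theorem coe_add (Z W : lieG A) : (Z + W).1 = Z.1 + W.1 := rfl

theorem coe_smul (c : A) (Z : lieG A) : (c • Z).1 = c • Z.1 := rfl

theorem coe_lie (Z W : lieG A) : (⁅Z, W⁆ : lieG A).1 = Z.1 * W.1 - W.1 * Z.1 := rfl

end RootVectors

/-! ### The Verma module as a polynomial ring -/

section Model

variable {A : Type} [CommRing A]

/-- The underlying module of the model of a Verma module: the monomial `X₀ ^ a X₁ ^ b X₂ ^ c X₃ ^ d`
stands for `y_β ^ a y_{α+β} ^ b y_{2α+β} ^ c y_α ^ d ⊗ μ`. -/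
abbrev Pol (A : Type) [CommRing A] : Type := MvPolynomial (Fin 4) A

theorem pderiv_comm (i j : Fin 4) (q : Pol A) : pderiv i (pderiv j q) = pderiv j (pderiv i q) := by
  have h : ⁅(pderiv i : Derivation A (Pol A) (Pol A)),
      (pderiv j : Derivation A (Pol A) (Pol A))⁆ = 0 := by
    refine MvPolynomial.derivation_ext fun k => ?_
    rw [Derivation.commutator_apply]
    simp only [pderiv_X, Pi.single_apply]
    split_ifs <;> simp
  have := congrArg (fun D => D q) h
  rw [Derivation.commutator_apply] at this
  exact sub_eq_zero.1 this

/-- The operator `x_α` on the model of `Ver_B(μ)`. This and the operators below are found by moving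
the root vector to the right through `y_β ^ a y_{α+β} ^ b y_{2α+β} ^ c y_α ^ d`. -/
def opα (μ : Weight) (q : Pol A) : Pol A :=
  2 * (X 0 * pderiv 1 q) + X 1 * pderiv 2 q + ((μ.1.1 - μ.1.2.1 : ℤ) : Pol A) * pderiv 3 q
    - X 3 * pderiv 3 (pderiv 3 q)

/-- The operator `x_β`. -/
def opβ (μ : Weight) (q : Pol A) : Pol A :=
  (μ.1.2.1 : Pol A) * pderiv 0 q + X 3 * pderiv 0 (pderiv 3 q) - X 3 * pderiv 1 q
    - X 0 * pderiv 0 (pderiv 0 q) - X 1 * pderiv 0 (pderiv 1 q) - X 2 * pderiv 1 (pderiv 1 q)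

/-- The operator `x_{α+β}`. -/
def opαβ (μ : Weight) (q : Pol A) : Pol A :=
  -(((μ.1.1 - μ.1.2.1 : ℤ) : Pol A) * pderiv 0 (pderiv 3 q))
    + X 3 * pderiv 0 (pderiv 3 (pderiv 3 q))
    + ((μ.1.1 + μ.1.2.1 : ℤ) : Pol A) * pderiv 1 q - X 3 * pderiv 2 q
    - 2 * (X 0 * pderiv 0 (pderiv 1 q)) - X 1 * pderiv 0 (pderiv 2 q)
    - X 1 * pderiv 1 (pderiv 1 q) - 2 * (X 2 * pderiv 1 (pderiv 2 q))

/-- The operator `x_{2α+β}`. -/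
def opααβ (μ : Weight) (q : Pol A) : Pol A :=
  -(((μ.1.1 - μ.1.2.1 : ℤ) : Pol A) * pderiv 1 (pderiv 3 q))
    + X 3 * pderiv 1 (pderiv 3 (pderiv 3 q))
    + (μ.1.1 : Pol A) * pderiv 2 q - X 3 * pderiv 2 (pderiv 3 q)
    - X 0 * pderiv 1 (pderiv 1 q) - X 1 * pderiv 1 (pderiv 2 q)
    - X 2 * pderiv 2 (pderiv 2 q)

/-- The operator of a diagonal matrix `diag(h₀, h₁, h₂, h₃)`, with `χ` its value on the highest
weight. -/
def opDiag (χ h₀ h₁ h₂ h₃ : A) (q : Pol A) : Pol A :=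
  C χ * q + C (h₂ - h₁) * (X 0 * pderiv 0 q) + C (h₂ - h₀) * (X 1 * pderiv 1 q)
    + C (h₃ - h₀) * (X 2 * pderiv 2 q) + C (h₁ - h₀) * (X 3 * pderiv 3 q)

/-- The operator `y_α`. -/
def opY (q : Pol A) : Pol A :=
  X 3 * q + X 1 * pderiv 0 q + 2 * (X 2 * pderiv 1 q)

/-- The action of `𝔤𝔰𝔭₄` on the model, as a linear map. The signs at the entries `(1, 0)` and
`(0, 1)` are those of `y_α = E₃₂ - E₁₀` and `x_α = E₂₃ - E₀₁`. -/
def op (μ : Weight) : lieG A →ₗ[A] Pol A →ₗ[A] Pol A :=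
  LinearMap.mk₂ A
    (fun Z q => opDiag (lieChar μ Z) (Z.1 0 0) (Z.1 1 1) (Z.1 2 2) (Z.1 3 3) q
      - C (Z.1 1 0) * opY q + C (Z.1 2 1) * (X 0 * q) + C (Z.1 2 0) * (X 1 * q)
      + C (Z.1 3 0) * (X 2 * q) - C (Z.1 0 1) * opα μ q + C (Z.1 1 2) * opβ μ q
      + C (Z.1 0 2) * opαβ μ q + C (Z.1 0 3) * opααβ μ q)
    (by
      intro Z W q
      simp only [lieChar, opDiag, coe_add, Matrix.add_apply, map_add, map_mul, map_sub]
      ring)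
    (by
      intro c Z q
      simp only [lieChar, opDiag, coe_smul, Matrix.smul_apply, map_add, map_mul,
        map_sub, smul_eq_C_mul, smul_eq_mul]
      ring)
    (by
      intro Z q r
      simp only [opDiag, opY, opα, opβ, opαβ, opααβ, map_add]
      ring)
    (by
      intro c Z q
      simp only [opDiag, opY, opα, opβ, opαβ, opααβ, smul_eq_C_mul, pderiv_C_mul]
      ring)

theorem op_apply (μ : Weight) (Z : lieG A) (q : Pol A) :
    op μ Z q = opDiag (lieChar μ Z) (Z.1 0 0) (Z.1 1 1) (Z.1 2 2) (Z.1 3 3) q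
      - C (Z.1 1 0) * opY q + C (Z.1 2 1) * (X 0 * q) + C (Z.1 2 0) * (X 1 * q)
      + C (Z.1 3 0) * (X 2 * q) - C (Z.1 0 1) * opα μ q + C (Z.1 1 2) * opβ μ q
      + C (Z.1 0 2) * opαβ μ q + C (Z.1 0 3) * opααβ μ q := rfl

theorem op_yβ (μ : Weight) (q : Pol A) : op μ yβ q = X 0 * q := by
  simp [op_apply, yβ, lieChar, opDiag]

theorem op_yαβ (μ : Weight) (q : Pol A) : op μ yαβ q = X 1 * q := by
  simp [op_apply, yαβ, lieChar, opDiag]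

theorem op_yααβ (μ : Weight) (q : Pol A) : op μ yααβ q = X 2 * q := by
  simp [op_apply, yααβ, lieChar, opDiag]

theorem op_yα (μ : Weight) (q : Pol A) : op μ yα q = opY q := by
  simp [op_apply, yα, lieChar, opDiag]

theorem op_xα (μ : Weight) (q : Pol A) : op μ xα q = opα μ q := by
  simp [op_apply, xα, lieChar, opDiag]

theorem op_xβ (μ : Weight) (q : Pol A) : op μ xβ q = opβ μ q := by
  simp [op_apply, xβ, lieChar, opDiag]

theorem op_xαβ (μ : Weight) (q : Pol A) : op μ xαβ q = opαβ μ q := by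
  simp [op_apply, xαβ, lieChar, opDiag]

theorem op_xααβ (μ : Weight) (q : Pol A) : op μ xααβ q = opααβ μ q := by
  simp [op_apply, xααβ, lieChar, opDiag]

theorem pderiv_two (i : Fin 4) : pderiv i (2 : Pol A) = 0 := by
  have h := (pderiv i : Derivation A (Pol A) (Pol A)).map_natCast 2
  exact_mod_cast h

/-- Compatibility with brackets when one of the elements is `y_β`; the three lemmas that follow
treat the other negative root vectors. They are the input of the induction in `lieDefect_eq_zero`.
-/
theorem op_lie_yβ (μ : Weight) (Z : lieG A) (q : Pol A) :
    op μ ⁅Z, yβ⁆ q = op μ Z (op μ yβ q) - op μ yβ (op μ Z q) := by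
  obtain ⟨e1, e2, e3, e4, e5⟩ := lieG_entries Z
  simp only [op_yβ]
  simp only [op_apply, coe_lie, lieChar, Matrix.sub_apply, Matrix.mul_apply, Fin.sum_univ_four, e1,
    e2, e3, e4, e5]
  simp [yβ, opDiag, opY, opα, opβ, opαβ, opααβ]
  ring

theorem op_lie_yαβ (μ : Weight) (Z : lieG A) (q : Pol A) :
    op μ ⁅Z, yαβ⁆ q = op μ Z (op μ yαβ q) - op μ yαβ (op μ Z q) := by
  obtain ⟨e1, e2, e3, e4, e5⟩ := lieG_entries Z
  simp only [op_yαβ]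
  simp only [op_apply, coe_lie, lieChar, Matrix.sub_apply, Matrix.mul_apply, Fin.sum_univ_four, e1,
    e2, e3, e4, e5]
  simp [yαβ, opDiag, opY, opα, opβ, opαβ, opααβ]
  ring

theorem op_lie_yααβ (μ : Weight) (Z : lieG A) (q : Pol A) :
    op μ ⁅Z, yααβ⁆ q = op μ Z (op μ yααβ q) - op μ yααβ (op μ Z q) := by
  obtain ⟨e1, e2, e3, e4, e5⟩ := lieG_entries Z
  simp only [op_yααβ]
  simp only [op_apply, coe_lie, lieChar, Matrix.sub_apply, Matrix.mul_apply, Fin.sum_univ_four, e1,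
    e2, e3, e4, e5]
  simp [yααβ, opDiag, opY, opα, opβ, opαβ, opααβ]
  ring

theorem op_lie_yα (μ : Weight) (Z : lieG A) (q : Pol A) :
    op μ ⁅Z, yα⁆ q = op μ Z (op μ yα q) - op μ yα (op μ Z q) := by
  obtain ⟨e1, e2, e3, e4, e5⟩ := lieG_entries Z
  simp only [op_yα]
  simp only [op_apply, coe_lie, lieChar, Matrix.sub_apply, Matrix.mul_apply, Fin.sum_univ_four, e1,
    e2, e3, e4, e5]
  simp [yα, opDiag, opY, opα, opβ, opαβ, opααβ, pderiv_two, pderiv_comm 1 0, pderiv_comm 2 0,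
    pderiv_comm 3 0, pderiv_comm 2 1, pderiv_comm 3 1]
  ring

end Model

/-! ### The action of the enveloping algebra on the model -/

section Action

variable {A : Type} [CommRing A]

theorem op_one (μ : Weight) (Z : lieG A) :
    op μ Z 1 = C (lieChar μ Z) - C (Z.1 1 0) * X 3 + C (Z.1 2 1) * X 0 + C (Z.1 2 0) * X 1
      + C (Z.1 3 0) * X 2 := by
  simp [op_apply, opDiag, opY, opα, opβ, opαβ, opααβ]

theorem opY_X_pow (d : ℕ) : opY (X 3 ^ d : Pol A) = X 3 ^ (d + 1) := by
  simp [opY, pow_succ']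

/-- To prove a property of all polynomials it suffices to check the powers of `X₃` and stability
under linear combinations and under multiplication by the other three variables. -/
theorem pol_induction {P : Pol A → Prop} (h3 : ∀ d, P (X 3 ^ d))
    (hadd : ∀ q r, P q → P r → P (q + r)) (hC : ∀ c q, P q → P (C c * q))
    (h0 : ∀ q, P q → P (X 0 * q)) (h1 : ∀ q, P q → P (X 1 * q)) (h2 : ∀ q, P q → P (X 2 * q))
    (q : Pol A) : P q := by
  have hpow : ∀ (i : Fin 4), (∀ q, P q → P (X i * q)) → ∀ n q, P q → P (X i ^ n * q) := by
    intro i hi n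
    induction n with
    | zero => intro q hq; simpa using hq
    | succ n ih => intro q hq; rw [pow_succ, mul_assoc]; exact ih _ (hi _ hq)
  refine MvPolynomial.induction_on' q (fun s c => ?_) hadd
  rw [monomial_eq, Finsupp.prod_fintype _ _ (by simp), Fin.prod_univ_four, mul_assoc, mul_assoc]
  exact hC _ _ (hpow 0 h0 _ _ (hpow 1 h1 _ _ (hpow 2 h2 _ _ (h3 _))))

/-- The failure of `op μ` to respect a bracket. -/
def lieDefect (μ : Weight) (Z W : lieG A) (q : Pol A) : Pol A :=
  op μ ⁅Z, W⁆ q - (op μ Z (op μ W q) - op μ W (op μ Z q))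

/-- By the Jacobi identity the defect behaves like a derivation under an element `V` whose own
brackets are respected. -/
theorem lieDefect_op (μ : Weight) {V : lieG A}
    (hV : ∀ (Z : lieG A) q, op μ ⁅Z, V⁆ q = op μ Z (op μ V q) - op μ V (op μ Z q))
    (Z W : lieG A) (q : Pol A) :
    lieDefect μ Z W (op μ V q) = op μ V (lieDefect μ Z W q) + lieDefect μ ⁅Z, V⁆ W q
      + lieDefect μ Z ⁅W, V⁆ q := by
  have h' : ∀ (Z : lieG A) q, op μ Z (op μ V q) = op μ V (op μ Z q) + op μ ⁅Z, V⁆ q :=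
    fun Z q => by rw [hV]; abel
  have hJ : ⁅⁅Z, W⁆, V⁆ = ⁅⁅Z, V⁆, W⁆ + ⁅Z, ⁅W, V⁆⁆ := by
    rw [lie_lie, ← lie_skew W ⁅Z, V⁆]; abel
  simp only [lieDefect, h', map_sub, map_add, hJ, LinearMap.add_apply]
  abel

/-- The operators `op μ` respect brackets: both sides of `[Z, W] = Z W - W Z` satisfy the same
recursion along words in `𝔲⁻`, and agree on the highest weight vector. -/
theorem lieDefect_eq_zero (μ : Weight) (q : Pol A) : ∀ Z W : lieG A, lieDefect μ Z W q = 0 := by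
  have hstep : ∀ V : lieG A,
      (∀ (Z : lieG A) q, op μ ⁅Z, V⁆ q = op μ Z (op μ V q) - op μ V (op μ Z q)) →
      ∀ q, (∀ Z W : lieG A, lieDefect μ Z W q = 0) → ∀ Z W, lieDefect μ Z W (op μ V q) = 0 := by
    intro V hV q hq Z W
    rw [lieDefect_op μ hV, hq, hq, hq]; simp
  induction q using pol_induction with
  | h3 d =>
    induction d with
    | zero =>
      intro Z W
      obtain ⟨e1, e2, e3, e4, e5⟩ := lieG_entries Z
      obtain ⟨f1, f2, f3, f4, f5⟩ := lieG_entries W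
      simp only [pow_zero, lieDefect, op_one, map_add, map_sub]
      simp only [op_apply, coe_lie, lieChar, Matrix.sub_apply, Matrix.mul_apply, Fin.sum_univ_four,
        e1, e2, e3, e4, e5, f1, f2, f3, f4, f5]
      simp [opDiag, opY, opα, opβ, opαβ, opααβ]
      ring
    | succ d ih =>
      rw [← opY_X_pow, ← op_yα μ]
      exact hstep _ (op_lie_yα μ) _ ih
  | hadd q r hq hr =>
    intro Z W
    have h := congrArg₂ (· + ·) (hq Z W) (hr Z W)
    simp only [lieDefect, map_add] at h ⊢
    rw [← add_zero (0 : Pol A), ← h]; abel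
  | hC c q hq =>
    intro Z W
    have h := congrArg (c • ·) (hq Z W)
    simp only [lieDefect, ← smul_eq_C_mul, map_smul] at h ⊢
    rw [smul_zero] at h
    rw [← h, smul_sub, smul_sub]
  | h0 q hq => rw [← op_yβ μ]; exact hstep _ (op_lie_yβ μ) _ hq
  | h1 q hq => rw [← op_yαβ μ]; exact hstep _ (op_lie_yαβ μ) _ hq
  | h2 q hq => rw [← op_yααβ μ]; exact hstep _ (op_lie_yααβ μ) _ hq

theorem op_lie (μ : Weight) (Z W : lieG A) (q : Pol A) :
    op μ ⁅Z, W⁆ q = op μ Z (op μ W q) - op μ W (op μ Z q) :=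
  sub_eq_zero.1 (lieDefect_eq_zero μ q Z W)

/-- The action of `U𝔤` on the model. -/
def act (μ : Weight) : Ug A →ₐ[A] Module.End A (Pol A) :=
  UniversalEnvelopingAlgebra.lift A
    { op μ with
      map_lie' := fun {Z W} => LinearMap.ext fun q => op_lie μ Z W q }

@[simp]
theorem act_ι (μ : Weight) (Z : lieG A) (q : Pol A) :
    act μ (UniversalEnvelopingAlgebra.ι A Z) q = op μ Z q := by
  rw [act, UniversalEnvelopingAlgebra.lift_ι_apply]; rfl

theorem act_ι_mul (μ : Weight) (Z : lieG A) (u : Ug A) (q : Pol A) :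
    act μ (UniversalEnvelopingAlgebra.ι A Z * u) q = op μ Z (act μ u q) := by
  rw [map_mul, Module.End.mul_apply, act_ι]

/-- `U𝔤` is spanned by words in `𝔤`. -/
theorem Ug_induction {P : Ug A → Prop} (h1 : P 1) (hadd : ∀ u v, P u → P v → P (u + v))
    (hsmul : ∀ (c : A) u, P u → P (c • u))
    (hι : ∀ Z u, P u → P (UniversalEnvelopingAlgebra.ι A Z * u)) (u : Ug A) : P u := by
  let S : Submodule A (Ug A) :=
    { carrier := {u | P u}
      zero_mem' := by simpa using hsmul 0 1 h1
      add_mem' := fun {u v} hu hv => hadd u v hu hv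
      smul_mem' := fun c u hu => hsmul c u hu }
  let T : Subalgebra A (Ug A) :=
    { carrier := {u | ∀ s ∈ S, u * s ∈ S}
      mul_mem' := fun {u v} hu hv s hs => by rw [mul_assoc]; exact hu _ (hv _ hs)
      add_mem' := fun {u v} hu hv s hs => by rw [add_mul]; exact S.add_mem (hu _ hs) (hv _ hs)
      algebraMap_mem' := fun c s hs => by rw [← Algebra.smul_def]; exact S.smul_mem c hs }
  have hT : ∀ Z, UniversalEnvelopingAlgebra.ι A Z ∈ T := fun Z s hs => hι Z s hs
  let g : lieG A →ₗ⁅A⁆ T :=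
    { toFun := fun Z => ⟨UniversalEnvelopingAlgebra.ι A Z, hT Z⟩
      map_add' := fun Z W => Subtype.ext (map_add _ Z W)
      map_smul' := fun c Z => Subtype.ext (map_smul _ c Z)
      map_lie' := fun {Z W} => Subtype.ext (LieHom.map_lie _ Z W) }
  have h : T.val.comp (UniversalEnvelopingAlgebra.lift A g) = AlgHom.id A (Ug A) := by
    apply UniversalEnvelopingAlgebra.hom_ext
    ext Z
    simp [g]
  have hu : (T.val.comp (UniversalEnvelopingAlgebra.lift A g)) u ∈ T :=
    (UniversalEnvelopingAlgebra.lift A g u).2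
  rw [h] at hu
  change u ∈ S
  simpa using hu 1 h1

end Action

/-! ### Ordered monomials in the negative root vectors -/

section PBW

variable {A : Type} [CommRing A]

/-- The ordered monomials in the root vectors of `𝔲⁻`. -/
def pbwMonomial (s : Fin 4 →₀ ℕ) : Ug A :=
  UniversalEnvelopingAlgebra.ι A yβ ^ s 0 * (UniversalEnvelopingAlgebra.ι A yαβ ^ s 1 *
    (UniversalEnvelopingAlgebra.ι A yααβ ^ s 2 * UniversalEnvelopingAlgebra.ι A yα ^ s 3))

/-- The linear map from the model to `U𝔲⁻` that sends monomials to ordered monomials. -/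
def pbw : Pol A →ₗ[A] Ug A := (basisMonomials (Fin 4) A).constr A pbwMonomial

theorem pbw_monomial (s : Fin 4 →₀ ℕ) (c : A) : pbw (monomial s c) = c • pbwMonomial s := by
  have h : (monomial s c : Pol A) = c • (basisMonomials (Fin 4) A s) := by
    simp [coe_basisMonomials, smul_monomial]
  rw [h, map_smul, pbw, Module.Basis.constr_basis]

theorem pbw_one : pbw (1 : Pol A) = 1 := by
  rw [← C_1, ← monomial_zero', pbw_monomial]; simp [pbwMonomial]

theorem commute_y {V W : lieG A} (h : ⁅V, W⁆ = 0) :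
    Commute (UniversalEnvelopingAlgebra.ι A V) (UniversalEnvelopingAlgebra.ι A W) := by
  have := LieHom.map_lie (UniversalEnvelopingAlgebra.ι A) V W
  rw [h, map_zero, LieRing.of_associative_ring_bracket] at this
  exact sub_eq_zero.1 this.symm

theorem lie_yβ_yαβ : ⁅(yβ : lieG A), (yαβ : lieG A)⁆ = 0 := by
  apply Subtype.ext
  rw [coe_lie]
  ext i j; fin_cases i <;> fin_cases j <;> simp [yβ, yαβ]

theorem lie_yβ_yααβ : ⁅(yβ : lieG A), (yααβ : lieG A)⁆ = 0 := by
  apply Subtype.ext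
  rw [coe_lie]
  ext i j; fin_cases i <;> fin_cases j <;> simp [yβ, yααβ]

theorem lie_yαβ_yααβ : ⁅(yαβ : lieG A), (yααβ : lieG A)⁆ = 0 := by
  apply Subtype.ext
  rw [coe_lie]
  ext i j; fin_cases i <;> fin_cases j <;> simp [yαβ, yααβ]

/-- A linear identity on the model may be checked on monomials. -/
theorem pol_hom_ext {f g : Pol A →ₗ[A] Ug A} (h : ∀ s, f (monomial s 1) = g (monomial s 1))
    (q : Pol A) : f q = g q := by
  have : f = g := (basisMonomials (Fin 4) A).ext fun s => by simpa using h s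
  rw [this]

theorem pbw_X_zero_mul (q : Pol A) :
    pbw (X 0 * q) = UniversalEnvelopingAlgebra.ι A yβ * pbw q := by
  refine pol_hom_ext (f := pbw ∘ₗ LinearMap.mulLeft A (X 0))
    (g := LinearMap.mulLeft A (UniversalEnvelopingAlgebra.ι A yβ) ∘ₗ pbw) (fun s => ?_) q
  simp [X, monomial_mul, pbw_monomial, pbwMonomial, pow_add, mul_assoc]

theorem pbw_X_one_mul (q : Pol A) :
    pbw (X 1 * q) = UniversalEnvelopingAlgebra.ι A yαβ * pbw q := by
  refine pol_hom_ext (f := pbw ∘ₗ LinearMap.mulLeft A (X 1))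
    (g := LinearMap.mulLeft A (UniversalEnvelopingAlgebra.ι A yαβ) ∘ₗ pbw) (fun s => ?_) q
  have h := ((commute_y (A := A) lie_yβ_yαβ).pow_left (s 0)).eq
  simp only [LinearMap.comp_apply, LinearMap.mulLeft_apply, X, monomial_mul, pbw_monomial,
    pbwMonomial]
  generalize UniversalEnvelopingAlgebra.ι A (yβ : lieG A) = a at *
  generalize UniversalEnvelopingAlgebra.ι A (yαβ : lieG A) = b at *
  generalize UniversalEnvelopingAlgebra.ι A (yααβ : lieG A) = c at *
  simp only [Finsupp.add_apply, Finsupp.single_apply, pow_add]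
  simp [mul_assoc]
  rw [← mul_assoc, h, mul_assoc]

theorem pbw_X_two_mul (q : Pol A) :
    pbw (X 2 * q) = UniversalEnvelopingAlgebra.ι A yααβ * pbw q := by
  refine pol_hom_ext (f := pbw ∘ₗ LinearMap.mulLeft A (X 2))
    (g := LinearMap.mulLeft A (UniversalEnvelopingAlgebra.ι A yααβ) ∘ₗ pbw) (fun s => ?_) q
  have h := (((commute_y (A := A) lie_yβ_yααβ).pow_left (s 0)).mul_left
    ((commute_y (A := A) lie_yαβ_yααβ).pow_left (s 1))).eq
  simp only [LinearMap.comp_apply, LinearMap.mulLeft_apply, X, monomial_mul, pbw_monomial,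
    pbwMonomial]
  generalize UniversalEnvelopingAlgebra.ι A (yβ : lieG A) = a at *
  generalize UniversalEnvelopingAlgebra.ι A (yαβ : lieG A) = b at *
  generalize UniversalEnvelopingAlgebra.ι A (yααβ : lieG A) = c at *
  simp only [Finsupp.add_apply, Finsupp.single_apply, pow_add]
  simp [mul_assoc]
  rw [← mul_assoc, ← mul_assoc, h, mul_assoc, mul_assoc]

theorem pbw_X_three_pow (d : ℕ) :
    pbw (X 3 ^ d : Pol A) = UniversalEnvelopingAlgebra.ι A yα ^ d := by
  rw [X_pow_eq_monomial, pbw_monomial]; simp [pbwMonomial]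

theorem lieG_decomp_minus {V : lieG A} (hV : MemLieUMinus V) :
    V = (-V.1 1 0) • yα + V.1 2 1 • yβ + V.1 2 0 • yαβ + V.1 3 0 • yααβ := by
  obtain ⟨e1, e2, e3, e4, e5⟩ := lieG_entries V
  apply Subtype.ext
  simp only [coe_add, coe_smul]
  ext i j
  fin_cases i <;> fin_cases j <;>
    simp [yα, yβ, yαβ, yααβ, e1, e2, hV 0 0 le_rfl, hV 1 1 le_rfl, hV 2 2 le_rfl, hV 3 3 le_rfl,
      hV 0 1 (by decide), hV 0 2 (by decide), hV 0 3 (by decide), hV 1 2 (by decide),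
      hV 1 3 (by decide), hV 2 3 (by decide)]

/-- Left multiplication by `y_α` on ordered monomials, already in `U𝔤`: `y_α` is moved to the right
by means of `[y_α, y_β] = y_{α+β}` and `[y_α, y_{α+β}] = 2 y_{2α+β}`. -/
theorem pbw_opY (q : Pol A) :
    pbw (opY q) = UniversalEnvelopingAlgebra.ι A yα * pbw q := by
  have e1 : ⁅(yα : lieG A), (yβ : lieG A)⁆ = yαβ := by
    apply Subtype.ext
    rw [coe_lie]
    ext i j; fin_cases i <;> fin_cases j <;>
      simp [yβ, yα, yαβ]
  have e2 : ⁅(yα : lieG A), (yαβ : lieG A)⁆ = (2 : A) • yααβ := by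
    apply Subtype.ext
    rw [coe_lie, coe_smul]
    ext i j; fin_cases i <;> fin_cases j <;>
      simp [yααβ, yα, yαβ, one_add_one_eq_two]
  have e3 : ⁅(yα : lieG A), (yααβ : lieG A)⁆ = 0 := by
    apply Subtype.ext
    rw [coe_lie]
    ext i j; fin_cases i <;> fin_cases j <;> simp [yα, yααβ]
  have hc : ∀ V W : lieG A, UniversalEnvelopingAlgebra.ι A V * UniversalEnvelopingAlgebra.ι A W
      = UniversalEnvelopingAlgebra.ι A W * UniversalEnvelopingAlgebra.ι A V
        + UniversalEnvelopingAlgebra.ι A ⁅V, W⁆ := by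
    intro V W
    rw [LieHom.map_lie, LieRing.of_associative_ring_bracket]; abel
  induction q using pol_induction with
  | h3 d => rw [opY_X_pow, pbw_X_three_pow, pbw_X_three_pow, pow_succ']
  | hadd q r hq hr => rw [← op_yα 0, map_add, map_add, op_yα, op_yα, hq, hr, map_add, mul_add]
  | hC c q hq =>
    rw [← op_yα 0, ← smul_eq_C_mul, map_smul, map_smul, op_yα, hq, map_smul, mul_smul_comm]
  | h0 q hq =>
    have h : opY (X 0 * q) = X 0 * opY q + X 1 * q := by
      simp [opY]; ring
    rw [h, map_add, pbw_X_zero_mul, pbw_X_one_mul, pbw_X_zero_mul, hq, ← mul_assoc, ← mul_assoc,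
      hc yα, e1, add_mul]
  | h1 q hq =>
    have h : opY (X 1 * q) = X 1 * opY q + (2 : A) • (X 2 * q) := by
      rw [smul_eq_C_mul, map_ofNat]
      simp [opY]; ring
    rw [h, map_add, pbw_X_one_mul, map_smul, pbw_X_two_mul, pbw_X_one_mul, hq, ← mul_assoc,
      ← mul_assoc, hc yα, e2, add_mul, map_smul, smul_mul_assoc]
  | h2 q hq =>
    have h : opY (X 2 * q) = X 2 * opY q := by
      simp [opY]; ring
    rw [h, pbw_X_two_mul, pbw_X_two_mul, hq, ← mul_assoc, ← mul_assoc, hc yα, e3, map_zero,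
      add_zero]

theorem pbw_op_minus (μ : Weight) {V : lieG A} (hV : MemLieUMinus V) (q : Pol A) :
    pbw (op μ V q) = UniversalEnvelopingAlgebra.ι A V * pbw q := by
  rw [lieG_decomp_minus hV]
  simp only [map_add, map_smul, LinearMap.add_apply, LinearMap.smul_apply, op_yα, op_yβ, op_yαβ,
    op_yααβ, pbw_opY, pbw_X_zero_mul, pbw_X_one_mul, pbw_X_two_mul, add_mul, smul_mul_assoc]

theorem act_pbw_one (μ : Weight) (q : Pol A) : act μ (pbw q) 1 = q := by
  induction q using pol_induction with
  | h3 d =>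
    rw [pbw_X_three_pow]
    induction d with
    | zero => simp
    | succ d ih => rw [pow_succ', act_ι_mul, ih, op_yα, opY_X_pow]
  | hadd q r hq hr => rw [map_add, map_add, LinearMap.add_apply, hq, hr]
  | hC c q hq => rw [← smul_eq_C_mul, map_smul, map_smul, LinearMap.smul_apply, hq]
  | h0 q hq => rw [pbw_X_zero_mul, act_ι_mul, hq, op_yβ]
  | h1 q hq => rw [pbw_X_one_mul, act_ι_mul, hq, op_yαβ]
  | h2 q hq => rw [pbw_X_two_mul, act_ι_mul, hq, op_yααβ]

/-- Elements of `U𝔲⁻` are determined by their action on the highest weight vector. -/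
theorem UuMinus_eq_pbw (μ : Weight) {f : Ug A} (hf : f ∈ UuMinus A) : pbw (act μ f 1) = f := by
  have h : ∀ q, pbw (act μ f q) = f * pbw q := by
    induction hf using Algebra.adjoin_induction with
    | mem u hu =>
      obtain ⟨V, hV, rfl⟩ := hu
      intro q
      rw [act_ι, pbw_op_minus μ hV]
    | algebraMap c => intro q; simp [Algebra.algebraMap_eq_smul_one]
    | add u v _ _ hu hv => intro q; rw [map_add, LinearMap.add_apply, map_add, hu, hv, add_mul]
    | mul u v _ _ hu hv => intro q; rw [map_mul, Module.End.mul_apply, hu, hv, mul_assoc]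
  rw [h, pbw_one, mul_one]

theorem memLieUMinus_y : MemLieUMinus (yα : lieG A) ∧ MemLieUMinus (yβ : lieG A) ∧
    MemLieUMinus (yαβ : lieG A) ∧ MemLieUMinus (yααβ : lieG A) := by
  refine ⟨?_, ?_, ?_, ?_⟩ <;>
  · intro i j h
    revert h
    fin_cases i <;> fin_cases j <;> simp [yα, yβ, yαβ, yααβ]

theorem pbw_mem_UuMinus (q : Pol A) : pbw q ∈ UuMinus A := by
  obtain ⟨h3, h0, h1, h2⟩ := memLieUMinus_y (A := A)
  have hm : ∀ {V : lieG A}, MemLieUMinus V → UniversalEnvelopingAlgebra.ι A V ∈ UuMinus A :=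
    fun {V} hV => Algebra.subset_adjoin ⟨V, hV, rfl⟩
  induction q using pol_induction with
  | h3 d => rw [pbw_X_three_pow]; exact pow_mem (hm h3) d
  | hadd q r hq hr => rw [map_add]; exact add_mem hq hr
  | hC c q hq => rw [← smul_eq_C_mul, map_smul]; exact Subalgebra.smul_mem _ hq c
  | h0 q hq => rw [pbw_X_zero_mul]; exact mul_mem (hm h0) hq
  | h1 q hq => rw [pbw_X_one_mul]; exact mul_mem (hm h1) hq
  | h2 q hq => rw [pbw_X_two_mul]; exact mul_mem (hm h2) hq

end PBW

/-! ### The defining ideal of the Verma module -/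

section VermaIdeal

variable {A : Type} [CommRing A]

theorem op_one_of_memLieB (μ : Weight) {Z : lieG A} (hZ : MemLieB Z) :
    op μ Z 1 = C (lieChar μ Z) := by
  have h10 : Z.1 1 0 = 0 := hZ (by decide)
  have h20 : Z.1 2 0 = 0 := hZ (by decide)
  have h21 : Z.1 2 1 = 0 := hZ (by decide)
  have h30 : Z.1 3 0 = 0 := hZ (by decide)
  simp [op_one, h10, h20, h21, h30]

/-- On `𝔟` the action on the model involves only the diagonal and the raising operators. -/
theorem op_of_memLieB (μ : Weight) {Z : lieG A} (hZ : MemLieB Z) (q : Pol A) :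
    op μ Z q = opDiag (lieChar μ Z) (Z.1 0 0) (Z.1 1 1) (Z.1 2 2) (Z.1 3 3) q
      - C (Z.1 0 1) * opα μ q + C (Z.1 1 2) * opβ μ q + C (Z.1 0 2) * opαβ μ q
      + C (Z.1 0 3) * opααβ μ q := by
  have h10 : Z.1 1 0 = 0 := hZ (by decide)
  have h20 : Z.1 2 0 = 0 := hZ (by decide)
  have h21 : Z.1 2 1 = 0 := hZ (by decide)
  have h30 : Z.1 3 0 = 0 := hZ (by decide)
  simp [op_apply, h10, h20, h21, h30]

/-- The lower triangular part of an element of `𝔤`. -/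
def lowerPart (Z : lieG A) : lieG A :=
  (-Z.1 1 0) • yα + Z.1 2 1 • yβ + Z.1 2 0 • yαβ + Z.1 3 0 • yααβ

theorem memLieUMinus_lowerPart (Z : lieG A) : MemLieUMinus (lowerPart Z) := by
  obtain ⟨h3, h0, h1, h2⟩ := memLieUMinus_y (A := A)
  intro i j h
  simp [lowerPart, coe_add, h3 i j h, h0 i j h, h1 i j h, h2 i j h]

theorem memLieB_sub_lowerPart (Z : lieG A) : MemLieB (Z - lowerPart Z) := by
  obtain ⟨e1, e2, e3, e4, e5⟩ := lieG_entries Z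
  intro i j h
  change Z.1 i j - (lowerPart Z).1 i j = 0
  rw [sub_eq_zero, lowerPart]
  simp only [coe_add, coe_smul]
  revert h
  fin_cases i <;> fin_cases j <;> simp [yα, yβ, yαβ, yααβ, e1, e2]

/-- Modulo the ideal that defines the Verma module, left multiplication by `𝔤` on ordered monomials
is given by the operators of the model. -/
theorem ι_mul_pbw_sub_mem (μ : Weight) (q : Pol A) : ∀ Z : lieG A,
    UniversalEnvelopingAlgebra.ι A Z * pbw q - pbw (op μ Z q) ∈ vermaIdeal A μ := by
  have hstep : ∀ V : lieG A, MemLieUMinus V →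
      ∀ q, (∀ Z : lieG A,
        UniversalEnvelopingAlgebra.ι A Z * pbw q - pbw (op μ Z q) ∈ vermaIdeal A μ) →
      ∀ Z : lieG A, UniversalEnvelopingAlgebra.ι A Z * pbw (op μ V q) - pbw (op μ Z (op μ V q))
        ∈ vermaIdeal A μ := by
    intro V hV q hq Z
    have h1 : op μ Z (op μ V q) = op μ V (op μ Z q) + op μ ⁅Z, V⁆ q := by rw [op_lie]; abel
    have h2 : UniversalEnvelopingAlgebra.ι A Z * UniversalEnvelopingAlgebra.ι A V
        = UniversalEnvelopingAlgebra.ι A V * UniversalEnvelopingAlgebra.ι A Z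
          + UniversalEnvelopingAlgebra.ι A ⁅Z, V⁆ := by
      rw [LieHom.map_lie, LieRing.of_associative_ring_bracket]; abel
    have h3 := (vermaIdeal A μ).add_mem
      ((vermaIdeal A μ).mul_mem_left (UniversalEnvelopingAlgebra.ι A V) (hq Z)) (hq ⁅Z, V⁆)
    convert h3 using 1
    rw [h1, map_add, pbw_op_minus μ hV, pbw_op_minus μ hV, ← mul_assoc, h2, mul_sub, add_mul,
      mul_assoc]
    abel
  obtain ⟨h3, h0, h1, h2⟩ := memLieUMinus_y (A := A)
  induction q using pol_induction with
  | h3 d =>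
    induction d with
    | zero =>
      intro Z
      have hZ : Z = (Z - lowerPart Z) + lowerPart Z := by abel
      have hB := memLieB_sub_lowerPart Z
      have hU := memLieUMinus_lowerPart Z
      generalize Z - lowerPart Z = Zb at *
      generalize lowerPart Z = Zu at *
      rw [hZ, pow_zero, map_add, map_add, LinearMap.add_apply, map_add, pbw_op_minus μ hU,
        op_one_of_memLieB μ hB, pbw_one, mul_one, mul_one, add_sub_add_right_eq_sub,
        ← mul_one (C _), ← smul_eq_C_mul, map_smul, pbw_one, ← Algebra.algebraMap_eq_smul_one]
      exact Submodule.subset_span ⟨Zb, hB, rfl⟩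
    | succ d ih =>
      rw [← opY_X_pow, ← op_yα μ]
      exact hstep _ h3 _ ih
  | hadd q r hq hr =>
    intro Z
    have h := (vermaIdeal A μ).add_mem (hq Z) (hr Z)
    rw [map_add, map_add, map_add, mul_add]
    convert h using 1; abel
  | hC c q hq =>
    intro Z
    have h := (vermaIdeal A μ).mul_mem_left (algebraMap A (Ug A) c) (hq Z)
    rw [← smul_eq_C_mul, map_smul, map_smul, map_smul, mul_smul_comm, ← smul_sub, Algebra.smul_def]
    exact h
  | h0 q hq => rw [← op_yβ μ]; exact hstep _ h0 _ hq
  | h1 q hq => rw [← op_yαβ μ]; exact hstep _ h1 _ hq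
  | h2 q hq => rw [← op_yααβ μ]; exact hstep _ h2 _ hq

theorem sub_pbw_act_mem (μ : Weight) (u : Ug A) : u - pbw (act μ u 1) ∈ vermaIdeal A μ := by
  induction u using Ug_induction with
  | h1 => simp [pbw_one]
  | hadd u v hu hv =>
    have h := (vermaIdeal A μ).add_mem hu hv
    rw [map_add, LinearMap.add_apply, map_add]
    convert h using 1; abel
  | hsmul c u hu =>
    have h := (vermaIdeal A μ).mul_mem_left (algebraMap A (Ug A) c) hu
    rw [map_smul, LinearMap.smul_apply, map_smul, ← smul_sub, Algebra.smul_def]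
    exact h
  | hι Z u hu =>
    have h := (vermaIdeal A μ).add_mem
      ((vermaIdeal A μ).mul_mem_left (UniversalEnvelopingAlgebra.ι A Z) hu)
      (ι_mul_pbw_sub_mem μ (act μ u 1) Z)
    rw [act_ι_mul]
    convert h using 1
    rw [mul_sub]; abel

/-- The Poincaré–Birkhoff–Witt theorem for `Ver_B(μ)`: the map `u ⊗ μ ↦ u · 1` to the model is
injective. -/
theorem mem_vermaIdeal_iff (μ : Weight) (u : Ug A) : u ∈ vermaIdeal A μ ↔ act μ u 1 = 0 := by
  constructor
  · intro hu
    induction hu using Submodule.span_induction with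
    | mem u hu =>
      obtain ⟨Z, hZ, rfl⟩ := hu
      rw [map_sub, LinearMap.sub_apply, act_ι, op_one_of_memLieB μ hZ, AlgHom.commutes,
        Module.algebraMap_end_apply, smul_eq_C_mul, mul_one, sub_self]
    | zero => simp
    | add u v _ _ hu hv => rw [map_add, LinearMap.add_apply, hu, hv, add_zero]
    | smul a u _ hu => rw [smul_eq_mul, map_mul, Module.End.mul_apply, hu, map_zero]
  · intro hu
    have h := sub_pbw_act_mem μ u
    rwa [hu, map_zero, sub_zero] at h

end VermaIdeal

/-! ### Base change -/

section BaseChange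

variable {R A B : Type} [CommRing R] [CommRing A] [CommRing B]

theorem op_map (φ : R →+* A) (μ : Weight) (Z : lieG R) (q : Pol R) :
    op μ (lieGMap φ Z) (map φ q) = map φ (op μ Z q) := by
  simp only [op_apply, lieGMap, lieChar, opDiag, opY, opα, opβ, opαβ, opααβ, pderiv_map,
    Matrix.map_apply, map_add, map_sub, map_mul, map_neg, map_C, map_X, map_intCast, map_ofNat]

theorem UgMap_smul (φ : R →+* A) (c : R) (u : Ug R) : UgMap φ (c • u) = φ c • UgMap φ u := by
  rw [Algebra.smul_def, map_mul, UgMap_algebraMap, Algebra.smul_def]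

theorem map_smul_pol (φ : R →+* A) (c : R) (q : Pol R) : map φ (c • q) = φ c • map φ q := by
  rw [smul_eq_C_mul, smul_eq_C_mul, map_mul, map_C]

theorem act_map (φ : R →+* A) (μ : Weight) (u : Ug R) (q : Pol R) :
    act μ (UgMap φ u) (map φ q) = map φ (act μ u q) := by
  induction u using Ug_induction with
  | h1 => simp
  | hadd u v hu hv => rw [map_add, map_add, map_add, LinearMap.add_apply, LinearMap.add_apply, hu,
      hv, map_add]
  | hsmul c u hu => rw [UgMap_smul, map_smul, map_smul, LinearMap.smul_apply, LinearMap.smul_apply,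
      hu, map_smul_pol]
  | hι Z u hu => rw [map_mul, UgMap_ι, act_ι_mul, act_ι_mul, hu, op_map]

theorem UgMap_comp (φ : R →+* A) (ψ : A →+* B) (u : Ug R) :
    UgMap ψ (UgMap φ u) = UgMap (ψ.comp φ) u := by
  induction u using Ug_induction with
  | h1 => simp
  | hadd u v hu hv => rw [map_add, map_add, map_add, hu, hv]
  | hsmul c u hu => rw [UgMap_smul, UgMap_smul, UgMap_smul, hu]; rfl
  | hι Z u hu =>
    rw [map_mul, map_mul, map_mul, hu, UgMap_ι, UgMap_ι, UgMap_ι]; rfl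

theorem lieGMap_yα (φ : R →+* A) : lieGMap φ yα = yα := by
  apply Subtype.ext; ext i j; fin_cases i <;> fin_cases j <;> simp [lieGMap, yα]

theorem lieGMap_yβ (φ : R →+* A) : lieGMap φ yβ = yβ := by
  apply Subtype.ext; ext i j; fin_cases i <;> fin_cases j <;> simp [lieGMap, yβ]

theorem lieGMap_yαβ (φ : R →+* A) : lieGMap φ yαβ = yαβ := by
  apply Subtype.ext; ext i j; fin_cases i <;> fin_cases j <;> simp [lieGMap, yαβ]

theorem lieGMap_yααβ (φ : R →+* A) : lieGMap φ yααβ = yααβ := by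
  apply Subtype.ext; ext i j; fin_cases i <;> fin_cases j <;> simp [lieGMap, yααβ]

theorem UgMap_pbw (φ : R →+* A) (q : Pol R) : UgMap φ (pbw q) = pbw (map φ q) := by
  induction q using pol_induction with
  | h3 d =>
    rw [map_pow (MvPolynomial.map φ), map_X, pbw_X_three_pow, pbw_X_three_pow, map_pow, UgMap_ι,
      lieGMap_yα]
  | hadd q r hq hr => rw [map_add, map_add, map_add, map_add, hq, hr]
  | hC c q hq => rw [← smul_eq_C_mul, map_smul pbw, map_smul_pol, map_smul pbw, UgMap_smul, hq]
  | h0 q hq =>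
    rw [map_mul (MvPolynomial.map φ), map_X, pbw_X_zero_mul, pbw_X_zero_mul, map_mul, UgMap_ι,
      lieGMap_yβ, hq]
  | h1 q hq =>
    rw [map_mul (MvPolynomial.map φ), map_X, pbw_X_one_mul, pbw_X_one_mul, map_mul, UgMap_ι,
      lieGMap_yαβ, hq]
  | h2 q hq =>
    rw [map_mul (MvPolynomial.map φ), map_X, pbw_X_two_mul, pbw_X_two_mul, map_mul, UgMap_ι,
      lieGMap_yααβ, hq]

end BaseChange

/-! ### Coefficients -/

section Coefficients

variable {A : Type} [CommRing A]

/-- The exponent `(a, b, c, d)`. -/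
def expo (a b c d : ℕ) : Fin 4 →₀ ℕ := Finsupp.equivFunOnFinite.symm ![a, b, c, d]

/-- The coefficient of `X₀ ^ a X₁ ^ b X₂ ^ c X₃ ^ d`. -/
def coef (q : Pol A) (a b c d : ℕ) : A := coeff (expo a b c d) q

/-- `q` stands for a vector of weight `μ - K α - B β` in `Ver_B(μ)`: this is the weight of each
monomial that occurs in it. -/
def HasWeight (K B : ℕ) (q : Pol A) : Prop :=
  ∀ a b c d, coef q a b c d ≠ 0 → a + b + c = B ∧ b + 2 * c + d = K

theorem eq_expo (s : Fin 4 →₀ ℕ) : s = expo (s 0) (s 1) (s 2) (s 3) := by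
  ext i; fin_cases i <;> rfl

theorem expo_inj {a b c d a' b' c' d' : ℕ} :
    expo a b c d = expo a' b' c' d' ↔ a = a' ∧ b = b' ∧ c = c' ∧ d = d' := by
  constructor
  · intro h
    exact ⟨DFunLike.congr_fun h 0, DFunLike.congr_fun h 1, DFunLike.congr_fun h 2,
      DFunLike.congr_fun h 3⟩
  · rintro ⟨rfl, rfl, rfl, rfl⟩; rfl

theorem pol_ext {q r : Pol A} (h : ∀ a b c d, coef q a b c d = coef r a b c d) : q = r := by
  ext s; rw [eq_expo s]; exact h _ _ _ _

theorem expo_zero_succ (a b c d : ℕ) : expo (a + 1) b c d = Finsupp.single 0 1 + expo a b c d := by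
  ext i; fin_cases i <;> simp [expo, add_comm]

theorem expo_one_succ (a b c d : ℕ) : expo a (b + 1) c d = Finsupp.single 1 1 + expo a b c d := by
  ext i; fin_cases i <;> simp [expo, add_comm]

theorem expo_two_succ (a b c d : ℕ) : expo a b (c + 1) d = Finsupp.single 2 1 + expo a b c d := by
  ext i; fin_cases i <;> simp [expo, add_comm]

theorem expo_three_succ (a b c d : ℕ) :
    expo a b c (d + 1) = Finsupp.single 3 1 + expo a b c d := by
  ext i; fin_cases i <;> simp [expo, add_comm]

section

variable (q r : Pol A) (a b c d : ℕ)

theorem coef_zero : coef (0 : Pol A) a b c d = 0 := rfl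
theorem coef_add : coef (q + r) a b c d = coef q a b c d + coef r a b c d := coeff_add _ _ _
theorem coef_sub : coef (q - r) a b c d = coef q a b c d - coef r a b c d := coeff_sub _ _ _ _
theorem coef_neg : coef (-q) a b c d = -coef q a b c d := coeff_neg _ _ _
theorem coef_C_mul (k : A) : coef (C k * q) a b c d = k * coef q a b c d := coeff_C_mul _ _ _
theorem coef_int_mul (k : ℤ) : coef ((k : Pol A) * q) a b c d = k * coef q a b c d := by
  rw [← coef_C_mul, map_intCast]
theorem coef_two_mul : coef (2 * q) a b c d = 2 * coef q a b c d := by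
  rw [← coef_C_mul, map_ofNat]

theorem coef_X0_zero : coef (X 0 * q) 0 b c d = 0 := by
  rw [coef, coeff_X_mul']; simp [expo]
theorem coef_X0_succ : coef (X 0 * q) (a + 1) b c d = coef q a b c d := by
  rw [coef, expo_zero_succ, coeff_X_mul]; rfl
theorem coef_X1_zero : coef (X 1 * q) a 0 c d = 0 := by
  rw [coef, coeff_X_mul']; simp [expo]
theorem coef_X1_succ : coef (X 1 * q) a (b + 1) c d = coef q a b c d := by
  rw [coef, expo_one_succ, coeff_X_mul]; rfl
theorem coef_X2_zero : coef (X 2 * q) a b 0 d = 0 := by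
  rw [coef, coeff_X_mul']; simp [expo]
theorem coef_X2_succ : coef (X 2 * q) a b (c + 1) d = coef q a b c d := by
  rw [coef, expo_two_succ, coeff_X_mul]; rfl
theorem coef_X3_zero : coef (X 3 * q) a b c 0 = 0 := by
  rw [coef, coeff_X_mul']; simp [expo]
theorem coef_X3_succ : coef (X 3 * q) a b c (d + 1) = coef q a b c d := by
  rw [coef, expo_three_succ, coeff_X_mul]; rfl

theorem coef_pderiv0 : coef (pderiv 0 q) a b c d = (a + 1) * coef q (a + 1) b c d := by
  rw [coef, coeff_pderiv, coef, expo_zero_succ, add_comm (Finsupp.single _ _), mul_comm]; rfl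
theorem coef_pderiv1 : coef (pderiv 1 q) a b c d = (b + 1) * coef q a (b + 1) c d := by
  rw [coef, coeff_pderiv, coef, expo_one_succ, add_comm (Finsupp.single _ _), mul_comm]; rfl
theorem coef_pderiv2 : coef (pderiv 2 q) a b c d = (c + 1) * coef q a b (c + 1) d := by
  rw [coef, coeff_pderiv, coef, expo_two_succ, add_comm (Finsupp.single _ _), mul_comm]; rfl
theorem coef_pderiv3 : coef (pderiv 3 q) a b c d = (d + 1) * coef q a b c (d + 1) := by
  rw [coef, coeff_pderiv, coef, expo_three_succ, add_comm (Finsupp.single _ _), mul_comm]; rfl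

end

theorem coef_opDiag (χ h₀ h₁ h₂ h₃ : A) (q : Pol A) (a b c d : ℕ) :
    coef (opDiag χ h₀ h₁ h₂ h₃ q) a b c d
      = (χ + (h₂ - h₁) * a + (h₂ - h₀) * b + (h₃ - h₀) * c + (h₁ - h₀) * d) * coef q a b c d := by
  have e0 : coef (X 0 * pderiv 0 q) a b c d = a * coef q a b c d := by
    cases a <;> simp [coef_X0_zero, coef_X0_succ, coef_pderiv0]
  have e1 : coef (X 1 * pderiv 1 q) a b c d = b * coef q a b c d := by
    cases b <;> simp [coef_X1_zero, coef_X1_succ, coef_pderiv1]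
  have e2 : coef (X 2 * pderiv 2 q) a b c d = c * coef q a b c d := by
    cases c <;> simp [coef_X2_zero, coef_X2_succ, coef_pderiv2]
  have e3 : coef (X 3 * pderiv 3 q) a b c d = d * coef q a b c d := by
    cases d <;> simp [coef_X3_zero, coef_X3_succ, coef_pderiv3]
  rw [opDiag]
  simp only [coef_add, coef_C_mul, e0, e1, e2, e3]
  ring

end Coefficients

/-! ### Singular vectors -/

section Singular

/-- The integer `P (P - 1) ⋯ (P - b - 2 c + 1) · R (R - 1) ⋯ (R - b - c + 1) / (b! c!)`. -/
def singCoeff (P R : ℤ) (b c : ℕ) : ℤ :=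
  (descPochhammer ℤ (b + 2 * c)).eval P * (Ring.choose R (b + c) * ((b + c).choose b : ℤ))

theorem succ_mul_ringChoose (R : ℤ) (r : ℕ) :
    ((r : ℤ) + 1) * Ring.choose R (r + 1) = (R - r) * Ring.choose R r := by
  have h1 := Ring.descPochhammer_eq_factorial_smul_choose R (r + 1)
  have h2 := Ring.descPochhammer_eq_factorial_smul_choose R r
  rw [← Polynomial.eval_eq_smeval, descPochhammer_succ_eval, Polynomial.eval_eq_smeval, h2,
    Nat.factorial_succ] at h1
  simp only [nsmul_eq_mul] at h1
  push_cast at h1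
  have h3 : (r.factorial : ℤ) ≠ 0 := by exact_mod_cast r.factorial_ne_zero
  apply mul_left_cancel₀ h3
  linear_combination -h1

theorem singCoeff_zero_zero (P R : ℤ) : singCoeff P R 0 0 = 1 := by simp [singCoeff]

theorem singCoeff_succ_left (P R : ℤ) (b c : ℕ) :
    ((b : ℤ) + 1) * singCoeff P R (b + 1) c
      = (P - (b + 2 * c)) * (R - (b + c)) * singCoeff P R b c := by
  have h1 := succ_mul_ringChoose R (b + c)
  have h2 : ((b + c + 1 : ℕ) : ℤ) * ((b + c).choose b : ℤ)
      = ((b + c + 1).choose (b + 1) : ℤ) * ((b + 1 : ℕ) : ℤ) := by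
    exact_mod_cast Nat.add_one_mul_choose_eq (b + c) b
  have e1 : b + 1 + 2 * c = (b + 2 * c) + 1 := by ring
  have e2 : b + 1 + c = (b + c) + 1 := by ring
  rw [singCoeff, singCoeff, e1, e2, descPochhammer_succ_eval]
  push_cast at h1 h2 ⊢
  generalize ((b + c + 1).choose (b + 1) : ℤ) = x at *
  generalize ((b + c).choose b : ℤ) = y at *
  generalize Ring.choose R (b + c + 1) = z at *
  generalize Ring.choose R (b + c) = w at *
  generalize (descPochhammer ℤ (b + 2 * c)).eval P = v at *
  linear_combination (-v * (P - (b + 2 * c)) * z) * h2 + v * (P - (b + 2 * c)) * y * h1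

theorem singCoeff_shift (P R : ℤ) (b c : ℕ) :
    ((c : ℤ) + 1) * singCoeff P R b (c + 1)
      = (b + 1) * (P - (b + 1 + 2 * c)) * singCoeff P R (b + 1) c := by
  have h2 : ((b + 1 + c).choose (b + 1) : ℤ) * ((b + 1 : ℕ) : ℤ)
      = ((b + 1 + c).choose b : ℤ) * ((c + 1 : ℕ) : ℤ) := by
    have := Nat.choose_succ_right_eq (b + 1 + c) b
    rw [show b + 1 + c - b = c + 1 by omega] at this
    exact_mod_cast this
  have e1 : b + 2 * (c + 1) = (b + 1 + 2 * c) + 1 := by ring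
  have e2 : b + (c + 1) = b + 1 + c := by ring
  rw [singCoeff, singCoeff, e1, e2, descPochhammer_succ_eval]
  push_cast at h2 ⊢
  linear_combination (-(descPochhammer ℤ (b + 1 + 2 * c)).eval P * (P - (b + 1 + 2 * c)) *
    Ring.choose R (b + 1 + c)) * h2

theorem singCoeff_add_two (P R : ℤ) (b c : ℕ) :
    ((b : ℤ) + 2) * (b + 1) * singCoeff P R (b + 2) c
      = (R - (b + 1 + c)) * (c + 1) * singCoeff P R b (c + 1) := by
  have h1 := singCoeff_succ_left P R (b + 1) c
  have h2 := singCoeff_shift P R b c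
  push_cast at h1
  linear_combination (b + 1 : ℤ) * h1 - (R - (b + 1 + c)) * h2

/-- The polynomial of weight `-(K α + B β)` with coefficients `singCoeff P R`. For suitable `P` and
`R` it is a singular vector of the Verma module. -/
def singVec (K B : ℕ) (P R : ℤ) : Pol ℤ :=
  ∑ b ∈ Finset.range (B + 1), ∑ c ∈ Finset.range (B + 1),
    if b + c ≤ B ∧ b + 2 * c ≤ K then
      monomial (expo (B - b - c) b c (K - b - 2 * c)) (singCoeff P R b c) else 0

theorem coef_singVec (K B : ℕ) (P R : ℤ) (a b c d : ℕ) :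
    coef (singVec K B P R) a b c d
      = if a + b + c = B ∧ b + 2 * c + d = K then singCoeff P R b c else 0 := by
  rw [coef, singVec, coeff_sum]
  simp only [coeff_sum]
  by_cases hB : b + c ≤ B
  · rw [Finset.sum_eq_single b, Finset.sum_eq_single c]
    · split_ifs with h1 h2 h2
      · rw [coeff_monomial, if_pos]
        rw [expo_inj]; omega
      · rw [coeff_monomial, if_neg]
        rw [expo_inj]; omega
      · omega
      · rfl
    · intro c' _ hc'
      split_ifs
      · rw [coeff_monomial, if_neg]
        rw [expo_inj]; omega
      · rfl
    · intro h; simp at h; omega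
    · intro b' _ hb'
      apply Finset.sum_eq_zero
      intro c' _
      split_ifs
      · rw [coeff_monomial, if_neg]
        rw [expo_inj]; omega
      · rfl
    · intro h; simp at h; omega
  · rw [if_neg (by omega)]
    apply Finset.sum_eq_zero
    intro b' _
    apply Finset.sum_eq_zero
    intro c' _
    split_ifs
    · rw [coeff_monomial, if_neg]
      rw [expo_inj]; omega
    · rfl

variable {K B : ℕ} {P R : ℤ} {μ : Weight}

/-- The hypothesis `hB` says that no monomial of the vector has to be dropped because its exponent
of `y_β` would be negative; `hα` is the equation `x_α = 0`, once the coefficients at neighbouring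
monomials are expressed through one of them. -/
theorem opα_singVec
    (hB : ∀ b c : ℕ, B < b + c → singCoeff P R b c = 0)
    (hα : ∀ b c : ℕ, singCoeff P R b c * ((P - (b + 2 * c)) * (2 * R - (b + 2 * c))
      + (K - (b + 2 * c)) * ((μ.1.1 - μ.1.2.1 : ℤ) - K + (b + 2 * c) + 1)) = 0) :
    opα μ (singVec K B P R) = 0 := by
  apply pol_ext
  intro a b c d
  have e := hα b c
  have i1 := singCoeff_succ_left P R b c
  have hz : a = 0 → a + b + c = B → singCoeff P R (b + 1) c = 0 := fun _ _ => hB _ _ (by omega)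
  simp only [opα, coef_add, coef_sub, coef_int_mul, coef_two_mul, coef_zero]
  have t0 : coef (X 0 * pderiv 1 (singVec K B P R)) a b c d
      = if a + b + c = B ∧ b + 2 * c + d + 1 = K then (b + 1) * singCoeff P R (b + 1) c else 0 := by
    cases a with
    | zero =>
      rw [coef_X0_zero]
      split_ifs with h
      · rw [hz rfl h.1, mul_zero]
      · rfl
    | succ a =>
      rw [coef_X0_succ, coef_pderiv1, coef_singVec]
      split_ifs <;> omega
  have t1 : coef (X 1 * pderiv 2 (singVec K B P R)) a b c d
      = if a + b + c = B ∧ b + 2 * c + d + 1 = K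
        then b * (P - (b + 2 * c)) * singCoeff P R b c else 0 := by
    cases b with
    | zero => rw [coef_X1_zero]; simp
    | succ b =>
      rw [coef_X1_succ, coef_pderiv2, coef_singVec]
      split_ifs <;> first | omega | (rw [singCoeff_shift]; push_cast; ring)
  have t2 : coef (pderiv 3 (singVec K B P R)) a b c d
      = if a + b + c = B ∧ b + 2 * c + d + 1 = K then (d + 1) * singCoeff P R b c else 0 := by
    rw [coef_pderiv3, coef_singVec]
    split_ifs <;> omega
  have t3 : coef (X 3 * pderiv 3 (pderiv 3 (singVec K B P R))) a b c d
      = if a + b + c = B ∧ b + 2 * c + d + 1 = K then d * (d + 1) * singCoeff P R b c else 0 := by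
    cases d with
    | zero => rw [coef_X3_zero]; simp
    | succ d =>
      rw [coef_X3_succ, coef_pderiv3, coef_pderiv3, coef_singVec]
      split_ifs <;> first | omega | (push_cast; ring)
  rw [t0, t1, t2, t3]
  split_ifs with h
  · have hK : (K : ℤ) = b + 2 * c + d + 1 := by exact_mod_cast h.2.symm
    rw [hK] at e
    push_cast at e ⊢
    linear_combination 2 * i1 + e
  · simp

/-- The hypothesis `hK` says that no monomial of the vector has to be dropped because its exponent
of `y_α` would be negative; `hβ` is the equation `x_β = 0`, once the coefficients at neighbouring
monomials are expressed through one of them. -/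
theorem opβ_singVec
    (hK : ∀ b c : ℕ, K < b + 2 * c → singCoeff P R b c = 0)
    (hβ : ∀ b c : ℕ, singCoeff P R b c * ((B - (b + c)) * (μ.1.2.1 + K - B + 1 - (b + c))
      - (R - (b + c)) * (P - (b + c))) = 0) :
    opβ μ (singVec K B P R) = 0 := by
  apply pol_ext
  intro a b c d
  have e := hβ b c
  have i1 := singCoeff_succ_left P R b c
  have hz : d = 0 → b + 2 * c + d = K → singCoeff P R (b + 1) c = 0 := fun _ _ => hK _ _ (by omega)
  simp only [opβ, coef_add, coef_sub, coef_int_mul, coef_zero]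
  have t0 : coef (pderiv 0 (singVec K B P R)) a b c d
      = if a + 1 + b + c = B ∧ b + 2 * c + d = K then (a + 1) * singCoeff P R b c else 0 := by
    rw [coef_pderiv0, coef_singVec]
    split_ifs <;> omega
  have t1 : coef (X 3 * pderiv 0 (pderiv 3 (singVec K B P R))) a b c d
      = if a + 1 + b + c = B ∧ b + 2 * c + d = K then d * (a + 1) * singCoeff P R b c else 0 := by
    cases d with
    | zero => rw [coef_X3_zero]; simp
    | succ d =>
      rw [coef_X3_succ, coef_pderiv0, coef_pderiv3, coef_singVec]
      split_ifs <;> first | omega | (push_cast; ring)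
  have t2 : coef (X 3 * pderiv 1 (singVec K B P R)) a b c d
      = if a + 1 + b + c = B ∧ b + 2 * c + d = K then (b + 1) * singCoeff P R (b + 1) c else 0 := by
    cases d with
    | zero =>
      rw [coef_X3_zero]
      split_ifs with h
      · rw [hz rfl h.2, mul_zero]
      · rfl
    | succ d =>
      rw [coef_X3_succ, coef_pderiv1, coef_singVec]
      split_ifs <;> omega
  have t3 : coef (X 0 * pderiv 0 (pderiv 0 (singVec K B P R))) a b c d
      = if a + 1 + b + c = B ∧ b + 2 * c + d = K then a * (a + 1) * singCoeff P R b c else 0 := by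
    cases a with
    | zero => rw [coef_X0_zero]; simp
    | succ a =>
      rw [coef_X0_succ, coef_pderiv0, coef_pderiv0, coef_singVec]
      split_ifs <;> first | omega | (push_cast; ring)
  have t4 : coef (X 1 * pderiv 0 (pderiv 1 (singVec K B P R))) a b c d
      = if a + 1 + b + c = B ∧ b + 2 * c + d = K then b * (a + 1) * singCoeff P R b c else 0 := by
    cases b with
    | zero => rw [coef_X1_zero]; simp
    | succ b =>
      rw [coef_X1_succ, coef_pderiv0, coef_pderiv1, coef_singVec]
      split_ifs <;> first | omega | (push_cast; ring)
  have t5 : coef (X 2 * pderiv 1 (pderiv 1 (singVec K B P R))) a b c d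
      = if a + 1 + b + c = B ∧ b + 2 * c + d = K
        then (R - (b + c)) * c * singCoeff P R b c else 0 := by
    cases c with
    | zero => rw [coef_X2_zero]; simp
    | succ c =>
      rw [coef_X2_succ, coef_pderiv1, coef_pderiv1, coef_singVec]
      have := singCoeff_add_two P R b c
      split_ifs <;> first | omega | (push_cast; linear_combination this)
  rw [t0, t1, t2, t3, t4, t5]
  split_ifs with h
  · have hK : (K : ℤ) = b + 2 * c + d := by exact_mod_cast h.2.symm
    have hB : (B : ℤ) = a + 1 + b + c := by exact_mod_cast h.1.symm
    rw [hK, hB] at e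
    linear_combination -i1 + e
  · simp

theorem lie_xα_xβ : ⁅(xα : lieG ℤ), (xβ : lieG ℤ)⁆ = -xαβ := by
  apply Subtype.ext
  rw [coe_lie]
  ext i j; fin_cases i <;> fin_cases j <;>
    simp [xα, xβ, xαβ]

theorem lie_xα_xαβ : ⁅(xα : lieG ℤ), (xαβ : lieG ℤ)⁆ = (-2 : ℤ) • xααβ := by
  apply Subtype.ext
  rw [coe_lie, coe_smul]
  ext i j; fin_cases i <;> fin_cases j <;>
    simp [xα, xαβ, xααβ]

theorem opαβ_eq_zero {q : Pol ℤ} (hα : opα μ q = 0) (hβ : opβ μ q = 0) : opαβ μ q = 0 := by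
  have h := op_lie μ xα xβ q
  rw [op_xα, op_xα, op_xβ, hα, hβ, ← op_xα, map_zero, map_zero, lie_xα_xβ, map_neg,
    LinearMap.neg_apply, op_xαβ] at h
  simpa using h

theorem opααβ_eq_zero {q : Pol ℤ} (hα : opα μ q = 0) (hβ : opβ μ q = 0) : opααβ μ q = 0 := by
  have h := op_lie μ xα xαβ q
  rw [op_xα, op_xα, op_xαβ, hα, opαβ_eq_zero hα hβ, ← op_xα, map_zero, map_zero, lie_xα_xαβ,
    map_smul, LinearMap.smul_apply, op_xααβ] at h
  simpa using h

end Singular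

section Uniqueness

variable {A : Type} [CommRing A] [IsDomain A] [CharZero A]

/-- A singular vector of weight `-(K α + B β)` vanishes if its coefficient at `y_β ^ B y_α ^ K`
does. The part of highest degree of a singular vector is killed by the symbols of `x_α` and `x_β`,
hence does not involve the nonsimple root vectors. -/
theorem singular_eq_zero {K B : ℕ} {μ : Weight} {q : Pol A} (hα : opα μ q = 0) (hβ : opβ μ q = 0)
    (hwt : HasWeight K B q)
    (hlead : coef q B 0 0 K = 0) : q = 0 := by
  -- Descending induction on the degree `a + b + c + d`, which is at most `B + K`.
  have key : ∀ m a b c d, B + K + 1 ≤ a + b + c + d + m → coef q a b c d = 0 := by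
    intro m
    induction m with
    | zero =>
      intro a b c d h
      by_contra hne
      have := hwt _ _ _ _ hne
      omega
    | succ m ih =>
      -- The symbol of `x_β` removes the monomials with `y_{α+β}`.
      have hb : ∀ a b c d, B + K + 1 ≤ a + (b + 1) + c + d + (m + 1) →
          coef q a (b + 1) c d = 0 := by
        intro a b c d h
        have e := congrArg (fun r => coef r a b c (d + 1)) hβ
        have z := ih (a + 1) b c (d + 1) (by omega)
        simp only [opβ, coef_add, coef_sub, coef_int_mul, coef_zero, coef_X3_succ,
          coef_pderiv0, coef_pderiv1, coef_pderiv3, z] at e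
        have t3 : coef (X 0 * pderiv 0 (pderiv 0 q)) a b c (d + 1) = 0 := by
          cases a with
          | zero => rw [coef_X0_zero]
          | succ a => rw [coef_X0_succ, coef_pderiv0, coef_pderiv0, z]; simp
        have t4 : coef (X 1 * pderiv 0 (pderiv 1 q)) a b c (d + 1) = 0 := by
          cases b with
          | zero => rw [coef_X1_zero]
          | succ b => rw [coef_X1_succ, coef_pderiv0, coef_pderiv1, z]; simp
        have t5 : coef (X 2 * pderiv 1 (pderiv 1 q)) a b c (d + 1) = 0 := by
          cases c with
          | zero => rw [coef_X2_zero]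
          | succ c =>
            rw [coef_X2_succ, coef_pderiv1, coef_pderiv1, ih _ _ _ _ (by omega)]; simp
        rw [t3, t4, t5] at e
        have hne : ((b : A) + 1) ≠ 0 := by exact_mod_cast Nat.succ_ne_zero b
        simpa [hne] using e
      intro a b c d h
      rcases b with _ | b
      · rcases c with _ | c
        · by_contra hne
          obtain ⟨h1, h2⟩ := hwt _ _ _ _ hne
          obtain rfl : a = B := by omega
          obtain rfl : d = K := by omega
          exact hne hlead
        · -- The symbol of `x_α` removes the monomials with `y_{2α+β}` and without `y_{α+β}`.
          have e := congrArg (fun r => coef r a 1 c d) hα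
          have z := ih a 1 c (d + 1) (by omega)
          simp only [opα, coef_add, coef_sub, coef_int_mul, coef_two_mul, coef_zero,
            coef_pderiv3, z] at e
          have t1 : coef (X 1 * pderiv 2 q) a 1 c d = (c + 1) * coef q a 0 (c + 1) d := by
            rw [← coef_pderiv2]; exact coef_X1_succ _ a 0 c d
          rw [t1] at e
          have t0 : coef (X 0 * pderiv 1 q) a 1 c d = 0 := by
            cases a with
            | zero => rw [coef_X0_zero]
            | succ a => rw [coef_X0_succ, coef_pderiv1, hb _ _ _ _ (by omega)]; simp
          have t3 : coef (X 3 * pderiv 3 (pderiv 3 q)) a 1 c d = 0 := by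
            cases d with
            | zero => rw [coef_X3_zero]
            | succ d => rw [coef_X3_succ, coef_pderiv3, coef_pderiv3, z]; simp
          rw [t0, t3] at e
          have hne : ((c : A) + 1) ≠ 0 := by exact_mod_cast Nat.succ_ne_zero c
          simpa [hne] using e
      · exact hb a b c d h
  exact pol_ext fun a b c d => key (B + K + 1) a b c d (by omega)

end Uniqueness

/-! ### Singular vectors over a general ring -/

section BaseChangeSingular

/-- `q` is a singular vector of weight `μ - K α - B β` in the model of `Ver_B(μ)` over `ℤ`. -/
structure IsSingular (μ : Weight) (K B : ℕ) (q : Pol ℤ) : Prop where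
  opα_eq : opα μ q = 0
  opβ_eq : opβ μ q = 0
  weight : HasWeight K B q

variable {A : Type} [CommRing A]

theorem coef_map {R : Type} [CommRing R] (φ : R →+* A) (q : Pol R) (a b c d : ℕ) :
    coef (map φ q) a b c d = φ (coef q a b c d) := coeff_map _ _ _

theorem lieChar_sub (μ : Weight) (K B : ℤ) (Z : lieG A) :
    lieChar (μ - K • PosRoot.α.wt - B • PosRoot.β.wt) Z
      = lieChar μ Z + (Z.1 2 2 - Z.1 1 1) * B + (Z.1 1 1 - Z.1 0 0) * K := by
  obtain ⟨⟨a, b, c⟩, h⟩ := μ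
  obtain ⟨-, -, -, -, e5⟩ := lieG_entries Z
  have h2 : (c - (a - K) - (b + K - 2 * B)) / 2 = (c - a - b) / 2 + B := by omega
  simp only [lieChar, PosRoot.wt, e5]
  simp only [AddSubgroup.coe_sub, AddSubgroup.coe_zsmul, Prod.fst_sub, Prod.snd_sub, Prod.smul_fst,
    Prod.smul_snd, smul_eq_mul]
  rw [show c - K * 0 - B * 0 - (a - K * 1 - B * 0) - (b - K * -1 - B * 2)
    = c - (a - K) - (b + K - 2 * B) by ring, h2]
  push_cast
  ring

theorem opDiag_of_hasWeight {μ : Weight} {K B : ℕ} {q : Pol A}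
    (hq : HasWeight K B q) (Z : lieG A) :
    opDiag (lieChar μ Z) (Z.1 0 0) (Z.1 1 1) (Z.1 2 2) (Z.1 3 3) q
      = C (lieChar (μ - (K : ℤ) • PosRoot.α.wt - (B : ℤ) • PosRoot.β.wt) Z) * q := by
  obtain ⟨-, -, -, -, e5⟩ := lieG_entries Z
  apply pol_ext
  intro a b c d
  rw [coef_opDiag, coef_C_mul, lieChar_sub]
  by_cases h : coef q a b c d = 0
  · rw [h]; simp
  · obtain ⟨h1, h2⟩ := hq _ _ _ _ h
    rw [← h1, ← h2, e5]
    push_cast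
    ring

theorem IsSingular.map_weight {μ : Weight} {K B : ℕ} {q : Pol ℤ} (h : IsSingular μ K B q) :
    HasWeight K B (map (Int.castRingHom A) q) := by
  intro a b c d hne
  apply h.weight
  intro h0
  rw [coef_map, h0, map_zero] at hne
  exact hne rfl

/-- Over every ring, `𝔟` acts on the image of a singular vector through a character. -/
theorem IsSingular.op_map {μ : Weight} {K B : ℕ} {q : Pol ℤ} (h : IsSingular μ K B q)
    {Z : lieG A} (hZ : MemLieB Z) :
    op μ Z (map (Int.castRingHom A) q)
      = C (lieChar (μ - (K : ℤ) • PosRoot.α.wt - (B : ℤ) • PosRoot.β.wt) Z)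
        * map (Int.castRingHom A) q := by
  have e : ∀ {f : Weight → Pol ℤ → Pol ℤ} {g : Weight → Pol A → Pol A},
      (g μ (map (Int.castRingHom A) q) = map (Int.castRingHom A) (f μ q)) → f μ q = 0 →
      g μ (map (Int.castRingHom A) q) = 0 := fun h1 h2 => by rw [h1, h2, map_zero]
  have z1 : opα μ (map (Int.castRingHom A) q) = 0 :=
    e (f := opα) (by simp [opα, pderiv_map]) h.opα_eq
  have z2 : opβ μ (map (Int.castRingHom A) q) = 0 :=
    e (f := opβ) (by simp [opβ, pderiv_map]) h.opβ_eq
  have z3 : opαβ μ (map (Int.castRingHom A) q) = 0 :=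
    e (f := opαβ) (by simp [opαβ, pderiv_map]) (opαβ_eq_zero h.opα_eq h.opβ_eq)
  have z4 : opααβ μ (map (Int.castRingHom A) q) = 0 :=
    e (f := opααβ) (by simp [opααβ, pderiv_map]) (opααβ_eq_zero h.opα_eq h.opβ_eq)
  rw [op_of_memLieB μ hZ, z1, z2, z3, z4, opDiag_of_hasWeight h.map_weight]
  simp

end BaseChangeSingular

/-! ### The action of the Borel subgroup -/

section Borel

variable {A : Type} [CommRing A]

theorem Verma.mk_eq_mk_iff (μ : Weight) (u v : Ug A) :
    Verma.mk μ u = Verma.mk μ v ↔ act μ u 1 = act μ v 1 := by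
  rw [Verma.mk, Verma.mk, Submodule.Quotient.eq, mem_vermaIdeal_iff, map_sub, LinearMap.sub_apply,
    sub_eq_zero]

theorem Verma.mk_smul (μ : Weight) (c : A) (u : Ug A) :
    Verma.mk μ (c • u) = c • Verma.mk μ u := rfl

theorem borelAct_mk (μ : Weight) (g : Borel A) (u : Ug A) :
    borelAct μ g (Verma.mk μ u) = (borelChar μ g : A) • Verma.mk μ (adUg g u) := rfl

theorem adUg_ι_mul (g : Borel A) (Z : lieG A) (u : Ug A) :
    adUg g (UniversalEnvelopingAlgebra.ι A Z * u)
      = UniversalEnvelopingAlgebra.ι A (adLie g Z) * adUg g u := by rw [map_mul, adUg_ι]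

theorem adUg_mul (g h : Borel A) (u : Ug A) : adUg (g * h) u = adUg g (adUg h u) := by
  induction u using Ug_induction with
  | h1 => simp
  | hadd u v hu hv => rw [map_add, map_add, map_add, hu, hv]
  | hsmul c u hu => rw [map_smul, map_smul, map_smul, hu]
  | hι Z u hu =>
    rw [adUg_ι_mul, adUg_ι_mul, adUg_ι_mul, hu]
    congr 2
    apply Subtype.ext
    change (g * h : GL (Fin 4) A).1 * Z.1 * ((g * h : Borel A)⁻¹ : Borel A).1.1
      = g.1.1 * (h.1.1 * Z.1 * (h⁻¹ : Borel A).1.1) * (g⁻¹ : Borel A).1.1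
    rw [mul_inv_rev]
    simp only [Subgroup.coe_mul, Units.val_mul, Matrix.mul_assoc]

theorem adUg_one (u : Ug A) : adUg (1 : Borel A) u = u := by
  induction u using Ug_induction with
  | h1 => simp
  | hadd u v hu hv => rw [map_add, hu, hv]
  | hsmul c u hu => rw [map_smul, hu]
  | hι Z u hu =>
    rw [adUg_ι_mul, hu]
    congr 2
    apply Subtype.ext
    change (1 : Matrix (Fin 4) (Fin 4) A) * Z.1 * ((1 : Borel A)⁻¹ : Borel A).1.1 = Z.1
    rw [inv_one]
    change (1 : Matrix (Fin 4) (Fin 4) A) * Z.1 * 1 = Z.1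
    rw [mul_one, one_mul]

theorem borelChar_mul (μ : Weight) (g h : Borel A) :
    borelChar μ (g * h) = borelChar μ g * borelChar μ h := by
  simp only [borelChar, map_mul, mul_zpow]
  apply Units.ext
  simp only [Units.val_mul]
  ring

theorem memLieB_adLie (g : Borel A) {Z : lieG A} (hZ : MemLieB Z) : MemLieB (adLie g Z) :=
  (g.2.1.mul hZ).mul (g⁻¹).2.1

theorem adUg_mem_vermaIdeal (μ : Weight) (g : Borel A) {u : Ug A} (hu : u ∈ vermaIdeal A μ) :
    adUg g u ∈ vermaIdeal A μ := by
  have h : adVerma μ g (Verma.mk μ u) = Verma.mk μ (adUg g u) := rfl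
  rw [Verma.mk, (Submodule.Quotient.mk_eq_zero _).2 hu, map_zero] at h
  exact (Submodule.Quotient.mk_eq_zero _).1 h.symm

/-- `g ∈ B` acts on `u ⊗ μ` by the scalar `wt(g)`. -/
def IsEigen (μ wt : Weight) (u : Ug A) (g : Borel A) : Prop :=
  borelAct μ g (Verma.mk μ u) = (borelChar wt g : A) • Verma.mk μ u

theorem IsEigen.mul {μ wt : Weight} {u : Ug A} {g h : Borel A} (hg : IsEigen μ wt u g)
    (hh : IsEigen μ wt u h) : IsEigen μ wt u (g * h) := by
  have e : borelAct μ (g * h) (Verma.mk μ u) = borelAct μ g (borelAct μ h (Verma.mk μ u)) := by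
    rw [borelAct_mk, borelAct_mk, map_smul, borelAct_mk, adUg_mul, borelChar_mul, smul_smul,
      Units.val_mul, mul_comm (borelChar μ g : A)]
  rw [IsEigen, e, hh, map_smul, hg, smul_smul, borelChar_mul, Units.val_mul, mul_comm]

/-- `Z` is a strictly upper triangular element of `𝔰𝔭₄` whose square, as a matrix, is zero. -/
structure IsRootVector (Z : lieG A) : Prop where
  sq : Z.1 * Z.1 = 0
  symp : Z.1.transpose * J A + J A * Z.1 = 0
  upper : ∀ i j, j ≤ i → Z.1 i j = 0

/-- The element `1 + a Z = exp(a Z)` of `B`, for a root vector `Z`. -/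
def rootElt {Z : lieG A} (hZ : IsRootVector Z) (a : A) : Borel A :=
  ⟨⟨1 + a • Z.1, 1 - a • Z.1,
    by simp [mul_sub, add_mul, hZ.sq], by simp [mul_add, sub_mul, hZ.sq]⟩, by
    constructor
    · intro i j hij
      have hij' : j < i := hij
      simp [hZ.upper i j hij'.le, Matrix.one_apply_ne hij'.ne']
    · refine ⟨1, ?_⟩
      have h1 : Z.1.transpose * J A = -(J A * Z.1) := eq_neg_of_add_eq_zero_left hZ.symp
      simp only [Matrix.transpose_add, Matrix.transpose_one, Matrix.transpose_smul, add_mul,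
        mul_add, one_mul, mul_one, Matrix.smul_mul, Matrix.mul_smul, h1, neg_mul,
        Matrix.mul_assoc, hZ.sq, Units.val_one, one_smul]
      simp⟩

theorem IsRootVector.map {R : Type} [CommRing R] (φ : R →+* A) {Z : lieG R}
    (hZ : IsRootVector Z) : IsRootVector (lieGMap φ Z) where
  sq := by
    change Z.1.map φ * Z.1.map φ = 0
    rw [← Matrix.map_mul, hZ.sq, Matrix.map_zero _ (map_zero φ)]
  symp := by
    have h := congrArg (fun M => M.map φ) hZ.symp
    have hJ : (J R).map φ = J A := by
      ext i j
      fin_cases i <;> fin_cases j <;> simp [J]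
    simp only [Matrix.map_add φ (map_add φ), Matrix.map_mul, hJ, Matrix.transpose_map,
      Matrix.map_zero _ (map_zero φ)] at h
    exact h
  upper i j h := by
    change φ (Z.1 i j) = 0
    rw [hZ.upper i j h, map_zero]

theorem isRootVector_xα : IsRootVector (xα : lieG A) where
  sq := by
    ext i j
    fin_cases i <;> fin_cases j <;> simp [xα, Matrix.mul_apply, Fin.sum_univ_four]
  symp := by
    ext i j
    fin_cases i <;> fin_cases j <;> simp [xα, J, Matrix.mul_apply, Fin.sum_univ_four]
  upper i j h := by revert h; fin_cases i <;> fin_cases j <;> simp [xα]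

theorem isRootVector_xβ : IsRootVector (xβ : lieG A) where
  sq := by
    ext i j
    fin_cases i <;> fin_cases j <;> simp [xβ, Matrix.mul_apply, Fin.sum_univ_four]
  symp := by
    ext i j
    fin_cases i <;> fin_cases j <;> simp [xβ, J, Matrix.mul_apply, Fin.sum_univ_four]
  upper i j h := by revert h; fin_cases i <;> fin_cases j <;> simp [xβ]

theorem isRootVector_xαβ : IsRootVector (xαβ : lieG A) where
  sq := by
    ext i j
    fin_cases i <;> fin_cases j <;> simp [xαβ, Matrix.mul_apply, Fin.sum_univ_four]
  symp := by
    ext i j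
    fin_cases i <;> fin_cases j <;> simp [xαβ, J, Matrix.mul_apply, Fin.sum_univ_four]
  upper i j h := by revert h; fin_cases i <;> fin_cases j <;> simp [xαβ]

theorem isRootVector_xααβ : IsRootVector (xααβ : lieG A) where
  sq := by
    ext i j
    fin_cases i <;> fin_cases j <;> simp [xααβ, Matrix.mul_apply, Fin.sum_univ_four]
  symp := by
    ext i j
    fin_cases i <;> fin_cases j <;> simp [xααβ, J, Matrix.mul_apply, Fin.sum_univ_four]
  upper i j h := by revert h; fin_cases i <;> fin_cases j <;> simp [xααβ]

theorem UgMap_adUg {R : Type} [CommRing R] (φ : R →+* A) {Z : lieG R} (hZ : IsRootVector Z)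
    (a : R) (u : Ug R) :
    UgMap φ (adUg (rootElt hZ a) u) = adUg (rootElt (hZ.map φ) (φ a)) (UgMap φ u) := by
  induction u using Ug_induction with
  | h1 => simp
  | hadd u v hu hv => rw [map_add, map_add, map_add, map_add, hu, hv]
  | hsmul c u hu => rw [map_smul, UgMap_smul, UgMap_smul, map_smul, hu]
  | hι W u hu =>
    rw [adUg_ι_mul, map_mul, map_mul, UgMap_ι, UgMap_ι, adUg_ι_mul, hu]
    congr 2
    apply Subtype.ext
    change ((1 + a • Z.1) * W.1 * (1 - a • Z.1)).map φ
      = (1 + φ a • Z.1.map φ) * W.1.map φ * (1 - φ a • Z.1.map φ)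
    have h1 : (1 + a • Z.1).map φ = 1 + φ a • Z.1.map φ := by
      ext i j; simp [Matrix.one_apply, apply_ite φ]
    have h2 : (1 - a • Z.1).map φ = 1 - φ a • Z.1.map φ := by
      ext i j; simp [Matrix.one_apply, apply_ite φ]
    rw [Matrix.map_mul, Matrix.map_mul, h1, h2]

end Borel

/-! ### Root subgroups -/

section Derivative

/-- Differentiation with respect to `t` of the coefficients, which lie in `ℤ[t]`. -/
def coeffDeriv (q : Pol (Polynomial ℤ)) : Pol (Polynomial ℤ) :=
  ∑ s ∈ q.support, monomial s (Polynomial.derivative (coeff s q))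

theorem coeff_coeffDeriv (q : Pol (Polynomial ℤ)) (s : Fin 4 →₀ ℕ) :
    coeff s (coeffDeriv q) = Polynomial.derivative (coeff s q) := by
  classical
  rw [coeffDeriv, coeff_sum]
  simp only [coeff_monomial]
  rw [Finset.sum_ite_eq']
  split_ifs with h
  · rfl
  · rw [notMem_support_iff.1 h]; simp

variable (q r : Pol (Polynomial ℤ))

theorem coeffDeriv_add : coeffDeriv (q + r) = coeffDeriv q + coeffDeriv r := by
  ext1 s; simp [coeff_coeffDeriv]

theorem coeffDeriv_sub : coeffDeriv (q - r) = coeffDeriv q - coeffDeriv r := by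
  ext1 s; simp [coeff_coeffDeriv]

theorem coeffDeriv_neg : coeffDeriv (-q) = -coeffDeriv q := by
  ext1 s; simp [coeff_coeffDeriv]

theorem coeffDeriv_C_mul (k : Polynomial ℤ) :
    coeffDeriv (C k * q) = C (Polynomial.derivative k) * q + C k * coeffDeriv q := by
  ext1 s; simp [coeff_coeffDeriv, coeff_C_mul, Polynomial.derivative_mul]

theorem coeffDeriv_X_mul (i : Fin 4) : coeffDeriv (X i * q) = X i * coeffDeriv q := by
  classical
  ext1 s
  rw [coeff_coeffDeriv, coeff_X_mul', coeff_X_mul']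
  split_ifs <;> simp [coeff_coeffDeriv]

theorem coeffDeriv_pderiv (i : Fin 4) : coeffDeriv (pderiv i q) = pderiv i (coeffDeriv q) := by
  ext1 s
  rw [coeff_coeffDeriv, coeff_pderiv, coeff_pderiv, coeff_coeffDeriv]
  simp [Polynomial.derivative_mul]

theorem coeffDeriv_int_mul (k : ℤ) :
    coeffDeriv ((k : Pol (Polynomial ℤ)) * q) = k * coeffDeriv q := by
  have h := coeffDeriv_C_mul q (k : Polynomial ℤ)
  simpa using h

theorem coeffDeriv_two_mul : coeffDeriv (2 * q) = 2 * coeffDeriv q :=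
  coeffDeriv_int_mul q 2

theorem coeffDeriv_op (μ : Weight) {V W : lieG (Polynomial ℤ)}
    (h : ∀ i j, V.1 i j = Polynomial.derivative (W.1 i j)) :
    coeffDeriv (op μ W q) = op μ V q + op μ W (coeffDeriv q) := by
  have hχ : lieChar μ V = Polynomial.derivative (lieChar μ W) := by
    simp [lieChar, h, Polynomial.derivative_mul]
  simp only [op_apply, opDiag, opY, opα, opβ, opαβ, opααβ, coeffDeriv_add, coeffDeriv_sub,
    coeffDeriv_neg, coeffDeriv_C_mul, coeffDeriv_X_mul, coeffDeriv_pderiv, coeffDeriv_int_mul,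
    coeffDeriv_two_mul, h, hχ]
  simp only [map_sub]
  ring

end Derivative

/-- The derivative of conjugation by `1 + t Z = exp(t Z)`. -/
theorem derivative_conj {Z W : Matrix (Fin 4) (Fin 4) ℤ} (hZ : Z * Z = 0) (i j : Fin 4) :
    Polynomial.derivative (((1 + (Polynomial.X : Polynomial ℤ) • Z.map Polynomial.C)
        * W.map Polynomial.C * (1 - (Polynomial.X : Polynomial ℤ) • Z.map Polynomial.C)) i j)
      = ((1 + (Polynomial.X : Polynomial ℤ) • Z.map Polynomial.C)
        * (Z.map Polynomial.C * W.map Polynomial.C - W.map Polynomial.C * Z.map Polynomial.C)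
        * (1 - (Polynomial.X : Polynomial ℤ) • Z.map Polynomial.C)) i j := by
  have c2 : ∀ i j, Polynomial.derivative ((Z.map Polynomial.C * W.map Polynomial.C
      - W.map Polynomial.C * Z.map Polynomial.C) i j) = 0 := fun i j => by
    rw [← Matrix.map_mul, ← Matrix.map_mul, ← Matrix.map_sub _ (map_sub _)]
    exact Polynomial.derivative_C
  have c3 : ∀ i j, Polynomial.derivative
      ((Z.map Polynomial.C * W.map Polynomial.C * Z.map Polynomial.C) i j) = 0 := fun i j => by
    rw [← Matrix.map_mul, ← Matrix.map_mul]
    exact Polynomial.derivative_C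
  have c1 : ∀ i j, Polynomial.derivative ((W.map Polynomial.C) i j) = 0 :=
    fun i j => Polynomial.derivative_C
  have hzz : Z.map Polynomial.C * Z.map Polynomial.C = 0 := by
    rw [← Matrix.map_mul, hZ, Matrix.map_zero _ (map_zero _)]
  generalize Z.map Polynomial.C = z at *
  generalize W.map Polynomial.C = w at *
  have t1 : z * (z * w) = 0 := by rw [← mul_assoc, hzz, zero_mul]
  have e1 : (1 + (Polynomial.X : Polynomial ℤ) • z) * (z * w - w * z)
      * (1 - (Polynomial.X : Polynomial ℤ) • z)
      = (z * w - w * z) - (2 * Polynomial.X : Polynomial ℤ) • (z * w * z) := by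
    simp only [add_mul, mul_sub, one_mul, mul_one, Matrix.smul_mul, Matrix.mul_smul, sub_mul,
      t1, mul_assoc, hzz, mul_zero, zero_mul, smul_zero, two_mul, add_smul]
    abel
  have e2 : (1 + (Polynomial.X : Polynomial ℤ) • z) * w * (1 - (Polynomial.X : Polynomial ℤ) • z)
      = w + (Polynomial.X : Polynomial ℤ) • (z * w - w * z)
        - (Polynomial.X ^ 2 : Polynomial ℤ) • (z * w * z) := by
    simp only [add_mul, mul_sub, one_mul, mul_one, Matrix.smul_mul, Matrix.mul_smul, smul_sub,
      smul_smul, pow_two, mul_assoc]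
    abel
  rw [e1, e2, Matrix.sub_apply, Matrix.add_apply, Matrix.smul_apply, Matrix.smul_apply,
    Matrix.sub_apply (z * w - w * z), Matrix.smul_apply, smul_eq_mul, smul_eq_mul, smul_eq_mul,
    Polynomial.derivative_sub, Polynomial.derivative_add, Polynomial.derivative_mul,
    Polynomial.derivative_mul, c1, c2, c3, Polynomial.derivative_X_sq, Polynomial.derivative_X,
    map_ofNat]
  ring

section RootSubgroups

variable {Z : lieG ℤ} (hZ : IsRootVector Z)

/-- The orbit map of the universal point of the root subgroup of `Z`, in coordinates:
`u ↦ Ad(1 + t Z)(u) ⊗ μ` over `ℤ[t]`. -/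
def rootOrbit (μ : Weight) (u : Ug ℤ) : Pol (Polynomial ℤ) :=
  act μ (adUg (rootElt (hZ.map Polynomial.C) Polynomial.X) (UgMap Polynomial.C u)) 1

/-- The differential equation `d/dt (exp(t Z) u ⊗ μ) = exp(t Z) Z u ⊗ μ`. -/
theorem coeffDeriv_rootOrbit (μ : Weight) (u : Ug ℤ) :
    coeffDeriv (rootOrbit hZ μ u)
      = rootOrbit hZ μ (UniversalEnvelopingAlgebra.ι ℤ Z * u) := by
  have hι : ∀ W u, rootOrbit hZ μ (UniversalEnvelopingAlgebra.ι ℤ W * u)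
      = op μ (adLie (rootElt (hZ.map Polynomial.C) Polynomial.X) (lieGMap Polynomial.C W))
        (rootOrbit hZ μ u) := by
    intro W u
    rw [rootOrbit, map_mul, UgMap_ι, adUg_ι_mul, act_ι_mul, rootOrbit]
  have hadd : ∀ u v, rootOrbit hZ μ (u + v) = rootOrbit hZ μ u + rootOrbit hZ μ v := by
    intro u v
    simp only [rootOrbit, map_add, LinearMap.add_apply]
  have hsmul : ∀ (c : ℤ) u, rootOrbit hZ μ (algebraMap ℤ (Ug ℤ) c * u)
      = C (Polynomial.C c) * rootOrbit hZ μ u := by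
    intro c u
    rw [rootOrbit, map_mul, UgMap_algebraMap, ← Algebra.smul_def, map_smul, map_smul,
      LinearMap.smul_apply, smul_eq_C_mul, rootOrbit]
  have h1 : rootOrbit hZ μ 1 = 1 := by simp [rootOrbit]
  induction u using Ug_induction with
  | h1 =>
    have hB : MemLieB (lieGMap Polynomial.C Z) := fun i j hij =>
      (hZ.map Polynomial.C).upper i j hij.le
    rw [hι, h1, op_one_of_memLieB μ (memLieB_adLie _ hB)]
    have h0 : coeffDeriv 1 = 0 := by
      ext1 s
      rw [coeff_coeffDeriv, coeff_one]
      split_ifs <;> simp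
    have hd : ∀ i, (lieGMap Polynomial.C Z).1 i i = 0 := fun i =>
      (hZ.map Polynomial.C).upper i i le_rfl
    rw [h0, lieChar, adLie_diag _ hB, adLie_diag _ hB, adLie_diag _ hB, hd, hd, hd]
    simp
  | hadd u v hu hv => rw [hadd, coeffDeriv_add, hu, hv, mul_add, hadd]
  | hsmul c u hu =>
    rw [Algebra.smul_def, hsmul, coeffDeriv_C_mul, hu, ← mul_assoc, ← Algebra.commutes, mul_assoc,
      hsmul]
    simp
  | hι W u hu =>
    have hc : UniversalEnvelopingAlgebra.ι ℤ Z * (UniversalEnvelopingAlgebra.ι ℤ W * u)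
        = UniversalEnvelopingAlgebra.ι ℤ ⁅Z, W⁆ * u
          + UniversalEnvelopingAlgebra.ι ℤ W * (UniversalEnvelopingAlgebra.ι ℤ Z * u) := by
      rw [LieHom.map_lie, LieRing.of_associative_ring_bracket, sub_mul, mul_assoc, mul_assoc]
      abel
    rw [hc, hadd, hι, hι W (UniversalEnvelopingAlgebra.ι ℤ Z * u), hι, ← hu]
    refine coeffDeriv_op _ μ fun i j => ?_
    have h := derivative_conj (Z := Z.1) (W := W.1) hZ.sq i j
    rw [← Matrix.map_mul, ← Matrix.map_mul, ← Matrix.map_sub _ (map_sub _)] at h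
    exact h.symm

/-- A vector of `Ver_B(μ)` over `ℤ` that is killed by `Z` is fixed by the root subgroup of `Z`, over
every ring: its orbit over `ℤ[t]` has derivative zero, so it is constant as `ℤ` is torsion free. -/
theorem act_adUg_rootElt {A : Type} [CommRing A] {μ : Weight} {q : Pol ℤ} (hq : op μ Z q = 0)
    (a : A) :
    act μ (adUg (rootElt (hZ.map (Int.castRingHom A)) a) (pbw (map (Int.castRingHom A) q))) 1
      = map (Int.castRingHom A) q := by
  have hd : coeffDeriv (rootOrbit hZ μ (pbw q)) = 0 := by
    have h0 : act μ (UniversalEnvelopingAlgebra.ι ℤ Z * pbw q) 1 = 0 := by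
      rw [act_ι_mul, act_pbw_one, hq]
    rw [coeffDeriv_rootOrbit, rootOrbit, ← mem_vermaIdeal_iff]
    apply adUg_mem_vermaIdeal
    rw [mem_vermaIdeal_iff]
    have := act_map Polynomial.C μ (UniversalEnvelopingAlgebra.ι ℤ Z * pbw q) 1
    rwa [h0, map_zero, map_one] at this
  have hC : ∃ r : Pol ℤ, rootOrbit hZ μ (pbw q) = map Polynomial.C r := by
    have : rootOrbit hZ μ (pbw q) ∈ Set.range (map Polynomial.C : Pol ℤ →+* _) := by
      rw [mem_range_map_iff_coeffs_subset]
      intro k hk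
      obtain ⟨s, -, rfl⟩ := mem_coeffs_iff.1 hk
      have h := congrArg (coeff s) hd
      rw [coeff_coeffDeriv, coeff_zero] at h
      exact ⟨_, (Polynomial.eq_C_of_derivative_eq_zero h).symm⟩
    obtain ⟨r, hr⟩ := this
    exact ⟨r, hr.symm⟩
  obtain ⟨r, hr⟩ := hC
  have key : ∀ (A : Type) [CommRing A] (a : A),
      act μ (adUg (rootElt (hZ.map (Int.castRingHom A)) a) (pbw (map (Int.castRingHom A) q))) 1
        = map (Int.castRingHom A) r := by
    intro A _ a
    have h := act_map (Polynomial.eval₂RingHom (Int.castRingHom A) a) μ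
      (adUg (rootElt (hZ.map Polynomial.C) Polynomial.X) (UgMap Polynomial.C (pbw q))) 1
    have hφ : (Polynomial.eval₂RingHom (Int.castRingHom A) a).comp Polynomial.C
        = Int.castRingHom A := RingHom.ext_int _ _
    have hr' := hr
    rw [rootOrbit] at hr'
    rw [hr', UgMap_adUg, UgMap_comp, hφ, map_map, hφ, UgMap_pbw, map_one] at h
    have he : rootElt (hZ.map (Int.castRingHom A)) a
        = rootElt ((hZ.map Polynomial.C).map (Polynomial.eval₂RingHom (Int.castRingHom A) a))
          (Polynomial.eval₂RingHom (Int.castRingHom A) a Polynomial.X) := by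
      apply Subtype.ext
      apply Units.ext
      change 1 + a • (lieGMap _ Z).1
        = 1 + (Polynomial.eval₂RingHom (Int.castRingHom A) a) Polynomial.X
          • (lieGMap _ (lieGMap _ Z)).1
      rw [Polynomial.coe_eval₂RingHom, Polynomial.eval₂_X]
      congr 2
      ext i j
      exact (RingHom.congr_fun hφ (Z.1 i j)).symm
    rw [he, h]
  -- The constant is the value at `t = 0`.
  have h0 := key ℤ 0
  have he : rootElt (hZ.map (Int.castRingHom ℤ)) 0 = 1 := by
    apply Subtype.ext
    apply Units.ext
    change 1 + (0 : ℤ) • _ = (1 : Matrix (Fin 4) (Fin 4) ℤ)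
    simp
  rw [he, adUg_one, act_pbw_one, show Int.castRingHom ℤ = RingHom.id ℤ from RingHom.ext_int _ _,
    map_id, map_id] at h0
  rw [key, h0]

end RootSubgroups

/-! ### The torus, and equivariance under the Borel subgroup -/

section Torus

variable {A : Type} [CommRing A]

/-- The element `diag(t₀, t₁, t₂, t₃)` of the torus of `GSp₄`, where `t₀ t₃ = t₁ t₂`. -/
def torusElt (t : Fin 4 → Aˣ) (ht : t 0 * t 3 = t 1 * t 2) : Borel A :=
  ⟨⟨Matrix.diagonal fun i => (t i : A), Matrix.diagonal fun i => ((t i)⁻¹ : Aˣ),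
    by rw [Matrix.diagonal_mul_diagonal]; simp,
    by rw [Matrix.diagonal_mul_diagonal]; simp⟩, by
    refine ⟨Matrix.blockTriangular_diagonal _, t 0 * t 3, ?_⟩
    have h := congrArg (Units.val) ht
    simp only [Units.val_mul] at h
    rw [Matrix.diagonal_transpose]
    ext i j
    rw [Matrix.mul_diagonal, Matrix.diagonal_mul, Units.val_mul, Matrix.smul_apply, smul_eq_mul]
    fin_cases i <;> fin_cases j <;> simp [J]
    · rw [h]
    · rw [h, mul_comm]
    · rw [mul_comm]⟩

theorem diagUnit_torusElt (t : Fin 4 → Aˣ) (ht : t 0 * t 3 = t 1 * t 2) (i : Fin 4) :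
    diagUnit i (torusElt t ht) = t i := by
  apply Units.ext
  change (Matrix.diagonal fun i => (t i : A)) i i = _
  rw [Matrix.diagonal_apply_eq]

theorem adLie_torusElt (t : Fin 4 → Aˣ) (ht : t 0 * t 3 = t 1 * t 2) (Z : lieG A) (i j : Fin 4) :
    (adLie (torusElt t ht) Z).1 i j = (t i * (t j)⁻¹ : Aˣ) * Z.1 i j := by
  change ((Matrix.diagonal fun i => (t i : A)) * Z.1
    * Matrix.diagonal fun i => (((t i)⁻¹ : Aˣ) : A)) i j = _
  rw [Matrix.mul_diagonal, Matrix.diagonal_mul, Units.val_mul]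
  ring

/-- On the torus the characters of the root vectors are products of those of the simple ones. -/
theorem torus_roots {t : Fin 4 → Aˣ} (ht : t 0 * t 3 = t 1 * t 2) :
    t 2 * (t 0)⁻¹ = t 2 * (t 1)⁻¹ * (t 1 * (t 0)⁻¹) ∧
    t 3 * (t 1)⁻¹ = t 2 * (t 1)⁻¹ * (t 1 * (t 0)⁻¹) ∧
    t 3 * (t 0)⁻¹ = t 2 * (t 1)⁻¹ * (t 1 * (t 0)⁻¹) ^ 2 ∧
    t 3 * (t 2)⁻¹ = t 1 * (t 0)⁻¹ := by
  have h3 : t 3 = (t 0)⁻¹ * (t 1 * t 2) := by rw [← ht, inv_mul_cancel_left]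
  rw [h3]
  refine ⟨?_, ?_, ?_, ?_⟩ <;>
  · apply Additive.ofMul.injective
    simp only [ofMul_mul, ofMul_inv, ofMul_pow]
    module

theorem adLie_torusElt_y (t : Fin 4 → Aˣ) (ht : t 0 * t 3 = t 1 * t 2) :
    adLie (torusElt t ht) yβ = ((t 2 * (t 1)⁻¹ : Aˣ) : A) • yβ ∧
    adLie (torusElt t ht) yαβ = ((t 2 * (t 1)⁻¹ * (t 1 * (t 0)⁻¹) : Aˣ) : A) • yαβ ∧
    adLie (torusElt t ht) yααβ = ((t 2 * (t 1)⁻¹ * (t 1 * (t 0)⁻¹) ^ 2 : Aˣ) : A) • yααβ ∧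
    adLie (torusElt t ht) yα = ((t 1 * (t 0)⁻¹ : Aˣ) : A) • yα := by
  obtain ⟨r1, r2, r3, r4⟩ := torus_roots ht
  refine ⟨?_, ?_, ?_, ?_⟩ <;>
  · apply Subtype.ext
    ext i j
    rw [adLie_torusElt, coe_smul, Matrix.smul_apply, smul_eq_mul]
    fin_cases i <;> fin_cases j <;> simp only [yα, yβ, yαβ, yααβ] <;> simp [-Units.val_mul]
    all_goals first | rw [r2, r1] | rw [r3] | rw [r4]

theorem adUg_torusElt_pbwMonomial (t : Fin 4 → Aˣ) (ht : t 0 * t 3 = t 1 * t 2)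
    (s : Fin 4 →₀ ℕ) :
    adUg (torusElt t ht) (pbwMonomial s)
      = (((t 2 * (t 1)⁻¹) ^ (s 0 + s 1 + s 2) * (t 1 * (t 0)⁻¹) ^ (s 1 + 2 * s 2 + s 3) : Aˣ) : A)
        • pbwMonomial s := by
  obtain ⟨r1, r2, r3, r4⟩ := adLie_torusElt_y t ht
  simp only [pbwMonomial, map_mul, map_pow, adUg_ι, r1, r2, r3, r4, map_smul, smul_pow,
    smul_mul_smul_comm]
  congr 1
  simp only [← Units.val_pow_eq_pow_val, ← Units.val_mul]
  congr 1
  generalize t 2 * (t 1)⁻¹ = x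
  generalize t 1 * (t 0)⁻¹ = y
  apply Units.ext
  push_cast
  ring

theorem adUg_torusElt_pbw (t : Fin 4 → Aˣ) (ht : t 0 * t 3 = t 1 * t 2) {K B : ℕ} {q : Pol A}
    (hq : HasWeight K B q) :
    adUg (torusElt t ht) (pbw q)
      = (((t 2 * (t 1)⁻¹) ^ B * (t 1 * (t 0)⁻¹) ^ K : Aˣ) : A) • pbw q := by
  have hs : q = ∑ s ∈ q.support, monomial s (coeff s q) := q.support_sum_monomial_coeff.symm
  rw [hs, map_sum, map_sum, Finset.smul_sum]
  refine Finset.sum_congr rfl fun s hsup => ?_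
  have h := hq (s 0) (s 1) (s 2) (s 3)
  rw [coef, ← eq_expo] at h
  obtain ⟨h1, h2⟩ := h (mem_support_iff.1 hsup)
  rw [pbw_monomial, map_smul, adUg_torusElt_pbwMonomial, h1, h2, smul_comm]

theorem borelChar_torusElt (μ : Weight) (K B : ℕ) (t : Fin 4 → Aˣ) (ht : t 0 * t 3 = t 1 * t 2) :
    borelChar (μ - (K : ℤ) • PosRoot.α.wt - (B : ℤ) • PosRoot.β.wt) (torusElt t ht)
      = borelChar μ (torusElt t ht) * ((t 2 * (t 1)⁻¹) ^ B * (t 1 * (t 0)⁻¹) ^ K) := by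
  obtain ⟨⟨a, b, c⟩, h⟩ := μ
  simp only [borelChar, diagUnit_torusElt, PosRoot.wt]
  simp only [AddSubgroup.coe_sub, AddSubgroup.coe_zsmul, Prod.fst_sub, Prod.snd_sub, Prod.smul_fst,
    Prod.smul_snd, smul_eq_mul]
  rw [show (c - K * 0 - B * 0 - (a - K * 1 - B * 0) - (b - K * -1 - B * 2)) / 2
    = (c - a - b) / 2 + B by omega,
    show a - K * 1 - B * 0 = a - (K : ℤ) by ring,
    show b - K * -1 - B * 2 = b + (K : ℤ) - 2 * B by ring]
  rw [ht]
  apply Additive.ofMul.injective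
  simp only [ofMul_mul, ofMul_inv, ofMul_pow, ofMul_zpow]
  module

theorem isEigen_torusElt {μ : Weight} {K B : ℕ} {q : Pol A}
    (hq : HasWeight K B q)
    (t : Fin 4 → Aˣ) (ht : t 0 * t 3 = t 1 * t 2) :
    IsEigen μ (μ - (K : ℤ) • PosRoot.α.wt - (B : ℤ) • PosRoot.β.wt) (pbw q) (torusElt t ht) := by
  rw [IsEigen, borelAct_mk, adUg_torusElt_pbw t ht hq, Verma.mk_smul, smul_smul,
    borelChar_torusElt, ← Units.val_mul]

theorem isEigen_rootElt {Z : lieG ℤ} (hZ : IsRootVector Z) {μ : Weight} {q : Pol ℤ}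
    (hq : op μ Z q = 0) (wt : Weight) (a : A) :
    IsEigen μ wt (pbw (map (Int.castRingHom A) q)) (rootElt (hZ.map (Int.castRingHom A)) a) := by
  have hd : ∀ i, diagUnit i (rootElt (hZ.map (Int.castRingHom A)) a) = 1 := by
    intro i
    apply Units.ext
    change (1 + a • (lieGMap (Int.castRingHom A) Z).1) i i = 1
    simp [(hZ.map (Int.castRingHom A)).upper i i le_rfl]
  have hχ : ∀ wt, borelChar wt (rootElt (hZ.map (Int.castRingHom A)) a) = 1 := by
    intro wt; simp [borelChar, hd]
  rw [IsEigen, borelAct_mk, hχ, hχ, Units.val_one, one_smul, one_smul, Verma.mk_eq_mk_iff,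
    act_adUg_rootElt hZ hq, act_pbw_one]

theorem lieGMap_xα (φ : ℤ →+* A) :
    (lieGMap φ xα).1 = !![0, -1, 0, 0; 0, 0, 0, 0; 0, 0, 0, 1; 0, 0, 0, 0] := by
  ext i j; fin_cases i <;> fin_cases j <;> simp [lieGMap, xα]

theorem lieGMap_xβ (φ : ℤ →+* A) :
    (lieGMap φ xβ).1 = !![0, 0, 0, 0; 0, 0, 1, 0; 0, 0, 0, 0; 0, 0, 0, 0] := by
  ext i j; fin_cases i <;> fin_cases j <;> simp [lieGMap, xβ]

theorem lieGMap_xαβ (φ : ℤ →+* A) :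
    (lieGMap φ xαβ).1 = !![0, 0, 1, 0; 0, 0, 0, 1; 0, 0, 0, 0; 0, 0, 0, 0] := by
  ext i j; fin_cases i <;> fin_cases j <;> simp [lieGMap, xαβ]

theorem lieGMap_xααβ (φ : ℤ →+* A) :
    (lieGMap φ xααβ).1 = !![0, 0, 0, 1; 0, 0, 0, 0; 0, 0, 0, 0; 0, 0, 0, 0] := by
  ext i j; fin_cases i <;> fin_cases j <;> simp [lieGMap, xααβ]

/-- `B` is generated by the torus and the four positive root subgroups. -/
theorem exists_borel_decomp (g : Borel A) :
    ∃ (t : Fin 4 → Aˣ) (ht : t 0 * t 3 = t 1 * t 2) (a b c d : A),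
      g = torusElt t ht * (rootElt (isRootVector_xα.map (Int.castRingHom A)) a
        * (rootElt (isRootVector_xβ.map (Int.castRingHom A)) b
        * (rootElt (isRootVector_xαβ.map (Int.castRingHom A)) c
        * rootElt (isRootVector_xααβ.map (Int.castRingHom A)) d))) := by
  obtain ⟨v, hv⟩ := g.2.2
  have h : ∀ i j, _ := fun i j => congrFun (congrFun hv i) j
  have h03 := h 0 3
  have h12 := h 1 2
  have h13 := h 1 3
  have h23 := h 2 3
  have u : ∀ i j : Fin 4, j < i → (g : GL (Fin 4) A).1 i j = 0 := fun i j hij => g.2.1 hij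
  have u10 := u 1 0 (by decide)
  have u20 := u 2 0 (by decide)
  have u30 := u 3 0 (by decide)
  have u21 := u 2 1 (by decide)
  have u31 := u 3 1 (by decide)
  have u32 := u 3 2 (by decide)
  simp only [Matrix.smul_apply, Matrix.mul_apply, Fin.sum_univ_four,
    Matrix.transpose_apply] at h03 h12 h13 h23
  simp [J, u10, u20, u30, u21, u31, u32] at h03 h12 h13 h23
  let t : Fin 4 → Aˣ := fun i => diagUnit i g
  have hval : ∀ i, (g : GL (Fin 4) A).1 i i = t i := fun i => rfl
  rw [hval, hval] at h03 h12
  rw [hval, hval] at h13 h23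
  have ht : t 0 * t 3 = t 1 * t 2 := by
    apply Units.ext
    rw [Units.val_mul, Units.val_mul, h03, h12]
  have htA : (t 0 : A) * t 3 = t 1 * t 2 := by rw [h03, h12]
  have i0 : (t 0 : A) * ((t 0)⁻¹ : Aˣ) = 1 := Units.mul_inv _
  have i1 : (t 1 : A) * ((t 1)⁻¹ : Aˣ) = 1 := Units.mul_inv _
  have i3 : (t 3 : A) * ((t 3)⁻¹ : Aˣ) = 1 := Units.mul_inv _
  generalize hy0 : (((t 0)⁻¹ : Aˣ) : A) = y0 at i0
  generalize hy1 : (((t 1)⁻¹ : Aˣ) : A) = y1 at i1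
  generalize hy3 : (((t 3)⁻¹ : Aˣ) : A) = y3 at i3
  generalize hG : (g : GL (Fin 4) A).1 = G at *
  refine ⟨t, ht, -(y0 * G 0 1), y1 * G 1 2, y1 * G 1 3, y0 * G 0 3 - y0 * G 0 1 * (y1 * G 1 3), ?_⟩
  apply Subtype.ext
  apply Units.ext
  change (g : GL (Fin 4) A).1 = (Matrix.diagonal fun i => (t i : A)) * ((1 + _ • _) * ((1 + _ • _)
    * ((1 + _ • _) * (1 + _ • _))))
  rw [lieGMap_xα, lieGMap_xβ, lieGMap_xαβ, lieGMap_xααβ, hG]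
  have hy : (t 2 : A) * y0 = y1 * t 3 := by
    linear_combination (y1 * t 3) * i0 - (t 2 * y0) * i1 - (y0 * y1) * htA
  have e23 : G 2 3 = -(y1 * G 0 1 * t 3) := by
    linear_combination (-G 2 3) * i1 + y1 * h13
  have e02 : G 0 2 = t 0 * (y1 * G 1 3) + G 0 1 * (y1 * G 1 2) := by
    have hy2 : y3 * t 2 = t 0 * y1 := by
      linear_combination (t 0 * y1) * i3 - (y3 * t 2) * i1 - (y1 * y3) * htA
    linear_combination (-G 0 2) * i3 + y3 * h23 - y3 * G 1 2 * e23
      + (y1 * G 0 1 * G 1 2) * i3 + G 1 3 * hy2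
  ext i j
  rw [Matrix.diagonal_mul]
  simp only [Matrix.mul_apply, Fin.sum_univ_four]
  fin_cases i <;> fin_cases j <;> simp [u10, u20, u30, u21, u31, u32, hval]
  · linear_combination (-G 0 1) * i0
  · linear_combination e02 - (G 0 1 * (y1 * G 1 2)) * i0
  · linear_combination (-G 0 3) * i0
  · linear_combination (-G 1 2) * i1
  · linear_combination (-G 1 3) * i1
  · linear_combination e23 + G 0 1 * hy

/-- Over every ring, `B` acts on the image of a singular vector through a character. -/
theorem IsSingular.isEigen {μ : Weight} {K B : ℕ} {q : Pol ℤ} (h : IsSingular μ K B q)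
    (g : Borel A) :
    IsEigen μ (μ - (K : ℤ) • PosRoot.α.wt - (B : ℤ) • PosRoot.β.wt)
      (pbw (MvPolynomial.map (Int.castRingHom A) q)) g := by
  obtain ⟨t, ht, a, b, c, d, rfl⟩ := exists_borel_decomp g
  refine (isEigen_torusElt h.map_weight t ht).mul ((isEigen_rootElt isRootVector_xα ?_ _ a).mul
    ((isEigen_rootElt isRootVector_xβ ?_ _ b).mul ((isEigen_rootElt isRootVector_xαβ ?_ _ c).mul
      (isEigen_rootElt isRootVector_xααβ ?_ _ d))))
  · rw [op_xα, h.opα_eq]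
  · rw [op_xβ, h.opβ_eq]
  · rw [op_xαβ, opαβ_eq_zero h.opα_eq h.opβ_eq]
  · rw [op_xααβ, opααβ_eq_zero h.opα_eq h.opβ_eq]

end Torus

/-! ### Maps of Verma modules -/

section Homs

variable {A : Type} [CommRing A]

theorem Verma.ind {μ : Weight} {P : Verma A μ → Prop} (h : ∀ u, P (Verma.mk μ u)) (v : Verma A μ) :
    P v := by
  obtain ⟨u, rfl⟩ := Submodule.Quotient.mk_surjective _ v
  exact h u

theorem Verma.smul_mk (μ : Weight) (u v : Ug A) : u • Verma.mk μ v = Verma.mk μ (u * v) := rfl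

theorem vermaMap_mk {R : Type} [CommRing R] (φ : R →+* A) (μ : Weight) (u : Ug R) :
    vermaMap φ μ (Verma.mk μ u) = Verma.mk μ (UgMap φ u) := rfl

theorem hom_apply_mk {x y : Weight} (Φ : Verma A x →ₗ[Ug A] Verma A y) (u : Ug A) :
    Φ (Verma.mk x u) = u • Φ (Verma.mk x 1) := by
  rw [← map_smul, Verma.smul_mk, mul_one]

/-- A vector of `Ver_B(y)` on which `𝔟` acts through `x` defines a map `Ver_B(x) → Ver_B(y)`. -/
theorem exists_hom {x y : Weight} {f : Ug A}
    (hf : ∀ Z : lieG A, MemLieB Z →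
      UniversalEnvelopingAlgebra.ι A Z * f - algebraMap A (Ug A) (lieChar x Z) * f
        ∈ vermaIdeal A y) :
    ∃ Φ : Verma A x →ₗ[Ug A] Verma A y, ∀ u, Φ (Verma.mk x u) = Verma.mk y (u * f) := by
  refine ⟨Submodule.liftQ (vermaIdeal A x)
    (LinearMap.toSpanSingleton (Ug A) (Verma A y) (Verma.mk y f)) ?_, fun u => rfl⟩
  refine Submodule.span_le.2 ?_
  rintro _ ⟨Z, hZ, rfl⟩
  change Verma.mk y ((UniversalEnvelopingAlgebra.ι A Z - algebraMap A (Ug A) (lieChar x Z)) * f) = 0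
  rw [sub_mul]
  exact (Submodule.Quotient.mk_eq_zero _).2 (hf Z hZ)

theorem lieChar_add (x y : Weight) (Z : lieG A) :
    lieChar (x + y) Z = lieChar x Z + lieChar y Z := by
  obtain ⟨⟨a, b, c⟩, h⟩ := x
  obtain ⟨⟨a', b', c'⟩, h'⟩ := y
  have h1 : a + b ≡ c [ZMOD 2] := h
  have h2 : a' + b' ≡ c' [ZMOD 2] := h'
  have e : (c + c' - (a + a') - (b + b')) / 2 = (c - a - b) / 2 + (c' - a' - b') / 2 := by
    unfold Int.ModEq at h1 h2; omega
  simp only [lieChar, AddSubgroup.coe_add, Prod.fst_add, Prod.snd_add, e]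
  push_cast
  ring

theorem borelChar_add (x y : Weight) (g : Borel A) :
    borelChar (x + y) g = borelChar x g * borelChar y g := by
  obtain ⟨⟨a, b, c⟩, h⟩ := x
  obtain ⟨⟨a', b', c'⟩, h'⟩ := y
  have h1 : a + b ≡ c [ZMOD 2] := h
  have h2 : a' + b' ≡ c' [ZMOD 2] := h'
  have e : (c + c' - (a + a') - (b + b')) / 2 = (c - a - b) / 2 + (c' - a' - b') / 2 := by
    unfold Int.ModEq at h1 h2; omega
  simp only [borelChar, AddSubgroup.coe_add, Prod.fst_add, Prod.snd_add, e, zpow_add]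
  apply Units.ext
  simp only [Units.val_mul]
  ring

theorem lieChar_zsmul (k : ℤ) (x : Weight) (Z : lieG A) : lieChar (k • x) Z = k * lieChar x Z := by
  let F : Weight →+ A := AddMonoidHom.mk' (fun x => lieChar x Z) fun x y => lieChar_add x y Z
  have h : F (k • x) = k • F x := map_zsmul F k x
  rw [zsmul_eq_mul] at h
  exact h

theorem isEigen_iff (μ wt : Weight) (u : Ug A) (g : Borel A) :
    IsEigen μ wt u g ↔ adUg g u - ((borelChar wt g * (borelChar μ g)⁻¹ : Aˣ) : A) • u
      ∈ vermaIdeal A μ := by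
  rw [IsEigen, borelAct_mk, mem_vermaIdeal_iff, map_sub, LinearMap.sub_apply, sub_eq_zero,
    ← Verma.mk_eq_mk_iff, Verma.mk_smul, Units.val_mul, mul_comm, ← smul_smul]
  rw [← Units.smul_def (borelChar μ g), ← Units.smul_def (borelChar μ g)⁻¹, smul_eq_iff_eq_inv_smul]

theorem vermaIdeal_congr {y y' : Weight} (h : ∀ Z : lieG A, lieChar y Z = lieChar y' Z) :
    vermaIdeal A y = vermaIdeal A y' := by
  unfold vermaIdeal
  simp only [h]

/-- A singular vector over `ℤ` gives a `(U𝔤, B)`-equivariant map over every ring `R`. The weight of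
the Verma module may be changed as long as its differential over `R` stays the same. -/
theorem exists_mem_homUgB {R : Type} [CommRing R] {x y y' : Weight} {K B : ℕ} {q : Pol ℤ}
    (h : IsSingular y' K B q) (hx : x = y - (K : ℤ) • PosRoot.α.wt - (B : ℤ) • PosRoot.β.wt)
    (hy : ∀ (A : Type) [CommRing A] (_ : R →+* A) (Z : lieG A), lieChar y Z = lieChar y' Z) :
    ∃ Φ ∈ homUgB R x y, ∀ u,
      Φ (Verma.mk x u) = Verma.mk y (u * pbw (map (Int.castRingHom R) q)) := by
  have hex : ∀ (A : Type) [CommRing A] (_ : R →+* A), ∃ Φ : Verma A x →ₗ[Ug A] Verma A y,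
      ∀ u, Φ (Verma.mk x u) = Verma.mk y (u * pbw (map (Int.castRingHom A) q)) := by
    intro A _ φ
    apply exists_hom
    intro Z hZ
    have hχ : lieChar x Z
        = lieChar (y' - (K : ℤ) • PosRoot.α.wt - (B : ℤ) • PosRoot.β.wt) Z := by
      rw [hx, lieChar_sub, lieChar_sub, hy A φ]
    rw [vermaIdeal_congr (hy A φ), mem_vermaIdeal_iff, map_sub, LinearMap.sub_apply, act_ι_mul,
      act_pbw_one, ← Algebra.smul_def, map_smul, LinearMap.smul_apply, act_pbw_one, h.op_map hZ,
      hχ, smul_eq_C_mul, sub_self]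
  obtain ⟨Φ, hΦ⟩ := hex R (RingHom.id R)
  refine ⟨Φ, ?_, hΦ⟩
  intro A _ φ
  obtain ⟨ΦA, hΦA⟩ := hex A φ
  refine ⟨ΦA, fun v => ?_, fun g v => ?_⟩
  · induction v using Verma.ind with
    | h u =>
      have hc : φ.comp (Int.castRingHom R) = Int.castRingHom A := RingHom.ext_int _ _
      rw [vermaMap_mk, hΦA, hΦ, vermaMap_mk, map_mul, UgMap_pbw, map_map, hc]
  · induction v using Verma.ind with
    | h u =>
      have he := (isEigen_iff _ _ _ _).1 (h.isEigen g)
      have hd : borelChar (y' - (K : ℤ) • PosRoot.α.wt - (B : ℤ) • PosRoot.β.wt) g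
          * (borelChar y' g)⁻¹ = borelChar x g * (borelChar y g)⁻¹ := by
        have e1 : y' = (y' - (K : ℤ) • PosRoot.α.wt - (B : ℤ) • PosRoot.β.wt)
          + ((K : ℤ) • PosRoot.α.wt + (B : ℤ) • PosRoot.β.wt) := by abel
        have e2 : y = x + ((K : ℤ) • PosRoot.α.wt + (B : ℤ) • PosRoot.β.wt) := by rw [hx]; abel
        have f1 := borelChar_add (y' - (K : ℤ) • PosRoot.α.wt - (B : ℤ) • PosRoot.β.wt)
          ((K : ℤ) • PosRoot.α.wt + (B : ℤ) • PosRoot.β.wt) g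
        have f2 := borelChar_add x ((K : ℤ) • PosRoot.α.wt + (B : ℤ) • PosRoot.β.wt) g
        rw [← e1] at f1
        rw [← e2] at f2
        rw [f1, f2, mul_inv, mul_inv, mul_inv_cancel_left, mul_inv_cancel_left]
      rw [hd, ← vermaIdeal_congr (hy A φ)] at he
      have he' := (isEigen_iff y x _ g).2 he
      rw [IsEigen, borelAct_mk, ← Verma.mk_smul, ← Verma.mk_smul] at he'
      rw [borelAct_mk, ← Verma.mk_smul, hΦA, hΦA, borelAct_mk, map_mul, ← Verma.mk_smul,
        smul_mul_assoc, ← mul_smul_comm, ← mul_smul_comm, ← Verma.smul_mk, ← Verma.smul_mk, he']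

theorem id_mem_homUgB {R : Type} [CommRing R] (x : Weight) : LinearMap.id ∈ homUgB R x x :=
  fun _ _ _ => ⟨LinearMap.id, fun _ => rfl, fun _ _ => rfl⟩

theorem comp_mem_homUgB {R : Type} [CommRing R] {x y z : Weight}
    {f : Verma R x →ₗ[Ug R] Verma R y} {g : Verma R y →ₗ[Ug R] Verma R z}
    (hf : f ∈ homUgB R x y) (hg : g ∈ homUgB R y z) : g ∘ₗ f ∈ homUgB R x z := by
  intro A _ φ
  obtain ⟨fA, h1, h2⟩ := hf A φ
  obtain ⟨gA, h3, h4⟩ := hg A φ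
  exact ⟨gA ∘ₗ fA, fun v => by simp [h1, h3], fun b v => by simp [h2, h4]⟩

/-- A map `Ver_B(x) → Ver_B(y)` sends `1 ⊗ x` to a vector on which `𝔟` acts through `x`. -/
theorem op_of_hom {x y : Weight} (Φ : Verma A x →ₗ[Ug A] Verma A y) {q : Pol A}
    (hΦ : Φ (Verma.mk x 1) = Verma.mk y (pbw q)) {Z : lieG A} (hZ : MemLieB Z) :
    op y Z q = C (lieChar x Z) * q := by
  have h0 : Verma.mk x (UniversalEnvelopingAlgebra.ι A Z - algebraMap A (Ug A) (lieChar x Z)) = 0 :=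
    (Submodule.Quotient.mk_eq_zero _).2 (Submodule.subset_span ⟨Z, hZ, rfl⟩)
  have h1 := hom_apply_mk Φ (UniversalEnvelopingAlgebra.ι A Z - algebraMap A (Ug A) (lieChar x Z))
  rw [h0, map_zero, hΦ, Verma.smul_mk] at h1
  have h2 := (mem_vermaIdeal_iff y _).1 ((Submodule.Quotient.mk_eq_zero _).1 h1.symm)
  rw [sub_mul, map_sub, LinearMap.sub_apply, act_ι_mul, act_pbw_one, ← Algebra.smul_def, map_smul,
    LinearMap.smul_apply, act_pbw_one, smul_eq_C_mul] at h2
  exact sub_eq_zero.1 h2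

end Homs

/-! ### Composites of nonzero maps -/

section Domain

variable {A : Type} [CommRing A]

/-- All monomials of `q` have degree less than `m`. -/
def DegLT (m : ℕ) (q : Pol A) : Prop := ∀ a b c d, coef q a b c d ≠ 0 → a + b + c + d < m

theorem DegLT.mono {m n : ℕ} {q : Pol A} (h : DegLT m q) (hmn : m ≤ n) : DegLT n q :=
  fun a b c d hne => (h a b c d hne).trans_le hmn

theorem DegLT.add {m : ℕ} {q r : Pol A} (hq : DegLT m q) (hr : DegLT m r) : DegLT m (q + r) := by
  intro a b c d hne
  rw [coef_add] at hne
  by_cases h : coef q a b c d = 0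
  · rw [h, zero_add] at hne; exact hr _ _ _ _ hne
  · exact hq _ _ _ _ h

theorem DegLT.C_mul {m : ℕ} {q : Pol A} (hq : DegLT m q) (k : A) : DegLT m (C k * q) := by
  intro a b c d hne
  rw [coef_C_mul] at hne
  exact hq _ _ _ _ (right_ne_zero_of_mul hne)

theorem DegLT.X_mul {m : ℕ} {q : Pol A} (hq : DegLT m q) (i : Fin 4) : DegLT (m + 1) (X i * q) := by
  intro a b c d hne
  fin_cases i
  · cases a with
    | zero => exact absurd (coef_X0_zero q b c d) hne
    | succ a =>
      have := hq a b c d (by rwa [← coef_X0_succ])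
      omega
  · cases b with
    | zero => exact absurd (coef_X1_zero q a c d) hne
    | succ b =>
      have := hq a b c d (by rwa [← coef_X1_succ])
      omega
  · cases c with
    | zero => exact absurd (coef_X2_zero q a b d) hne
    | succ c =>
      have := hq a b c d (by rwa [← coef_X2_succ])
      omega
  · cases d with
    | zero => exact absurd (coef_X3_zero q a b c) hne
    | succ d =>
      have := hq a b c d (by rwa [← coef_X3_succ])
      omega

theorem DegLT.X_mul_pderiv_zero {m : ℕ} {q : Pol A} (hq : DegLT m q) :
    DegLT m (X 1 * pderiv 0 q) := by
  intro a b c d hne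
  cases b with
  | zero => exact absurd (coef_X1_zero _ a c d) hne
  | succ b =>
    rw [coef_X1_succ, coef_pderiv0] at hne
    have := hq _ _ _ _ (right_ne_zero_of_mul hne)
    omega

theorem DegLT.X_mul_pderiv_one {m : ℕ} {q : Pol A} (hq : DegLT m q) :
    DegLT m (X 2 * pderiv 1 q) := by
  intro a b c d hne
  cases c with
  | zero => exact absurd (coef_X2_zero _ a b d) hne
  | succ c =>
    rw [coef_X2_succ, coef_pderiv1] at hne
    have := hq _ _ _ _ (right_ne_zero_of_mul hne)
    omega

theorem degLT_sum {m : ℕ} {ι : Type} (s : Finset ι) {f : ι → Pol A} (h : ∀ i ∈ s, DegLT m (f i)) :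
    DegLT m (∑ i ∈ s, f i) := by
  classical
  induction s using Finset.induction_on with
  | empty => intro a b c d hne; exact absurd rfl hne
  | insert i s hi ih =>
    rw [Finset.sum_insert hi]
    exact (h i (Finset.mem_insert_self _ _)).add
      (ih fun j hj => h j (Finset.mem_insert_of_mem hj))

theorem act_ι_pow_X {V : lieG A} {μ : Weight} {i : Fin 4} (hV : ∀ q, op μ V q = X i * q) (n : ℕ)
    (q : Pol A) : act μ (UniversalEnvelopingAlgebra.ι A V ^ n) q = X i ^ n * q := by
  induction n with
  | zero => simp
  | succ n ih => rw [pow_succ', act_ι_mul, ih, hV, pow_succ', mul_assoc]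

/-- To leading order `y_α` acts by multiplication by `X₃`; the other negative root vectors do so
exactly. -/
theorem degLT_act_y_pow_sub (μ : Weight) {m : ℕ} {q : Pol A} (hq : DegLT (m + 1) q) (n : ℕ) :
    DegLT (m + n) (act μ (UniversalEnvelopingAlgebra.ι A yα ^ n) q - X 3 ^ n * q) ∧
      DegLT (m + 1 + n) (act μ (UniversalEnvelopingAlgebra.ι A yα ^ n) q) := by
  induction n with
  | zero =>
    refine ⟨?_, by simpa using hq⟩
    simp only [pow_zero, map_one, Module.End.one_apply, one_mul, sub_self]
    intro a b c d hne; exact absurd rfl hne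
  | succ n ih =>
    obtain ⟨h1, h2⟩ := ih
    rw [pow_succ', act_ι_mul, op_yα, opY]
    set r := act μ (UniversalEnvelopingAlgebra.ι A yα ^ n) q
    have h3 : DegLT (m + 1 + n) (X 1 * pderiv 0 r + 2 * (X 2 * pderiv 1 r)) := by
      refine h2.X_mul_pderiv_zero.add ?_
      have := h2.X_mul_pderiv_one.C_mul 2
      rwa [map_ofNat] at this
    constructor
    · have e : X 3 * r + X 1 * pderiv 0 r + 2 * (X 2 * pderiv 1 r) - X 3 ^ (n + 1) * q
          = X 3 * (r - X 3 ^ n * q) + (X 1 * pderiv 0 r + 2 * (X 2 * pderiv 1 r)) := by ring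
      rw [e]
      exact ((h1.X_mul 3).mono (by omega)).add (h3.mono (by omega))
    · rw [add_assoc (X 3 * r)]
      exact DegLT.add (h2.X_mul 3) (h3.mono (by omega))

theorem DegLT.X_pow_mul {m : ℕ} {q : Pol A} (hq : DegLT m q) (i : Fin 4) (n : ℕ) :
    DegLT (m + n) (X i ^ n * q) := by
  induction n with
  | zero => simpa using hq
  | succ n ih => rw [pow_succ', mul_assoc]; exact (ih.X_mul i)

/-- To leading order, `U𝔲⁻` acts on the model by multiplication. -/
theorem degLT_act_pbw_sub (μ : Weight) {m n : ℕ} {q r : Pol A} (hq : DegLT (m + 1) q)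
    (hr : DegLT (n + 1) r) : DegLT (n + m) (act μ (pbw r) q - r * q) := by
  have hs : r = ∑ s ∈ r.support, monomial s (coeff s r) := r.support_sum_monomial_coeff.symm
  have e : act μ (pbw r) q - r * q = ∑ s ∈ r.support,
      C (coeff s r) * (X 0 ^ s 0 * (X 1 ^ s 1 * (X 2 ^ s 2
        * (act μ (UniversalEnvelopingAlgebra.ι A yα ^ s 3) q - X 3 ^ s 3 * q)))) := by
    conv_lhs => rw [hs]
    rw [map_sum, map_sum, LinearMap.sum_apply, Finset.sum_mul, ← Finset.sum_sub_distrib]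
    refine Finset.sum_congr rfl fun s _ => ?_
    rw [pbw_monomial, map_smul, LinearMap.smul_apply, pbwMonomial, map_mul, map_mul, map_mul,
      Module.End.mul_apply, Module.End.mul_apply, Module.End.mul_apply, act_ι_pow_X (op_yβ μ),
      act_ι_pow_X (op_yαβ μ), act_ι_pow_X (op_yααβ μ), smul_eq_C_mul, monomial_eq,
      Finsupp.prod_fintype _ _ (by simp), Fin.prod_univ_four]
    ring
  rw [e]
  refine degLT_sum _ fun s hsup => DegLT.C_mul ?_ _
  have h1 : s 0 + s 1 + s 2 + s 3 < n + 1 := hr _ _ _ _ (by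
    rw [coef, ← eq_expo]; exact mem_support_iff.1 hsup)
  refine DegLT.mono (?_ : DegLT (m + s 3 + s 2 + s 1 + s 0) _) (by omega)
  exact (((degLT_act_y_pow_sub μ hq (s 3)).1.X_pow_mul 2 (s 2)).X_pow_mul 1 (s 1)).X_pow_mul 0 (s 0)

theorem expo_sum (s : Fin 4 →₀ ℕ) : (s.sum fun _ e => e) = s 0 + s 1 + s 2 + s 3 := by
  rw [Finsupp.sum_fintype _ _ (by simp), Fin.sum_univ_four]

theorem degLT_totalDegree (q : Pol A) : DegLT (q.totalDegree + 1) q := by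
  intro a b c d hne
  have h := le_totalDegree (mem_support_iff.2 hne)
  rw [expo_sum] at h
  exact Nat.lt_succ_of_le h

theorem act_pbw_ne_zero [IsDomain A] (μ : Weight) {q r : Pol A} (hq : q ≠ 0) (hr : r ≠ 0) :
    act μ (pbw r) q ≠ 0 := by
  intro h0
  have h := degLT_act_pbw_sub μ (degLT_totalDegree q) (degLT_totalDegree r)
  rw [h0, zero_sub] at h
  have hrq : r * q ≠ 0 := mul_ne_zero hr hq
  obtain ⟨s, hs, hs'⟩ := Finset.exists_mem_eq_sup (r * q).support (support_nonempty.2 hrq)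
    fun s => s.sum fun _ e => e
  have hd : (r * q).totalDegree = s 0 + s 1 + s 2 + s 3 := by rw [← expo_sum]; exact hs'
  rw [totalDegree_mul_of_isDomain hr hq] at hd
  have h2 := h (s 0) (s 1) (s 2) (s 3) (by
    rw [coef_neg, neg_ne_zero, coef, ← eq_expo]; exact mem_support_iff.1 hs)
  omega

theorem hom_eq_mk_pbw {x y : Weight} (Φ : Verma A x →ₗ[Ug A] Verma A y) :
    ∃ q : Pol A, Φ (Verma.mk x 1) = Verma.mk y (pbw q) := by
  obtain ⟨u, hu⟩ := Submodule.Quotient.mk_surjective _ (Φ (Verma.mk x 1))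
  refine ⟨act y u 1, ?_⟩
  rw [← hu]
  exact (Verma.mk_eq_mk_iff y u _).2 (by rw [act_pbw_one])

theorem hom_ne_zero_iff {x y : Weight} (Φ : Verma A x →ₗ[Ug A] Verma A y) {q : Pol A}
    (hΦ : Φ (Verma.mk x 1) = Verma.mk y (pbw q)) : Φ ≠ 0 ↔ q ≠ 0 := by
  rw [not_iff_not]
  have h0 : Verma.mk y (pbw q) = 0 ↔ q = 0 := by
    have h := Verma.mk_eq_mk_iff y (pbw q) 0
    rwa [act_pbw_one, map_zero, LinearMap.zero_apply] at h
  rw [← h0, ← hΦ]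
  constructor
  · rintro rfl; rfl
  · intro h
    refine LinearMap.ext fun v => ?_
    induction v using Verma.ind with
    | h u => rw [hom_apply_mk, h, smul_zero]; rfl

/-- A composite of nonzero maps of Verma modules over a domain is nonzero: its highest degree part
is the product of those of the two maps, by `degLT_act_pbw_sub`. -/
theorem comp_ne_zero [IsDomain A] {x y z : Weight} {f : Verma A x →ₗ[Ug A] Verma A y}
    {g : Verma A y →ₗ[Ug A] Verma A z} (hf : f ≠ 0) (hg : g ≠ 0) : g ∘ₗ f ≠ 0 := by
  obtain ⟨q, hq⟩ := hom_eq_mk_pbw f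
  obtain ⟨r, hr⟩ := hom_eq_mk_pbw g
  have e : (g ∘ₗ f) (Verma.mk x 1) = Verma.mk z (pbw (act z (pbw q) r)) := by
    rw [LinearMap.comp_apply, hq, hom_apply_mk, hr, Verma.smul_mk, Verma.mk_eq_mk_iff, act_pbw_one,
      map_mul, Module.End.mul_apply, act_pbw_one]
  rw [hom_ne_zero_iff _ e]
  exact act_pbw_ne_zero z ((hom_ne_zero_iff g hr).1 hg) ((hom_ne_zero_iff f hq).1 hf)

end Domain

/-! ### Weights and reflections -/

section Weights

theorem pairing_add (x y : Weight) (γ : PosRoot) :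
    pairing (x + y) γ = pairing x γ + pairing y γ := by
  cases γ <;> simp only [pairing, AddSubgroup.coe_add, Prod.fst_add, Prod.snd_add] <;> ring

theorem pairing_zsmul (k : ℤ) (x : Weight) (γ : PosRoot) :
    pairing (k • x) γ = k * pairing x γ := by
  cases γ <;> simp only [pairing, AddSubgroup.coe_zsmul, Prod.smul_fst, Prod.smul_snd, smul_eq_mul]
    <;> ring

theorem pairing_wt_self (γ : PosRoot) : pairing γ.wt γ = 2 := by cases γ <;> rfl

/-- The coefficient of `α` in a positive root. -/
def PosRoot.coeffα : PosRoot → ℕ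
  | .α => 1
  | .β => 0
  | .αβ => 1
  | .ααβ => 2

/-- The coefficient of `β` in a positive root. -/
def PosRoot.coeffβ : PosRoot → ℕ
  | .α => 0
  | .β => 1
  | .αβ => 1
  | .ααβ => 1

theorem PosRoot.wt_eq (γ : PosRoot) :
    γ.wt = (γ.coeffα : ℤ) • PosRoot.α.wt + (γ.coeffβ : ℤ) • PosRoot.β.wt := by
  cases γ <;> rfl

theorem PosRoot.coeffβ_le_one (γ : PosRoot) : γ.coeffβ ≤ 1 := by cases γ <;> decide

/-- The functional `(a, b, c) ↦ 2 a + b` is positive on the positive roots. -/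
theorem two_mul_add_nonneg_of_mem_closure {z : Weight}
    (hz : z ∈ AddSubmonoid.closure (Set.range PosRoot.wt)) : 0 ≤ 2 * z.1.1 + z.1.2.1 := by
  induction hz using AddSubmonoid.closure_induction with
  | mem z hz =>
    obtain ⟨γ, rfl⟩ := hz
    cases γ <;> decide
  | zero => decide
  | add z w _ _ hz hw =>
    simp only [AddSubgroup.coe_add, Prod.fst_add, Prod.snd_add]
    linarith

/-- Along the line `x + ℤ γ` the order of weights is that of the coefficients of `γ`. -/
theorem weightLE_reflect_iff (p : ℕ) (γ : PosRoot) (m : ℤ) (x : Weight) :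
    WeightLE x (reflect p γ m x) ↔ 0 ≤ p * m - pairing (x + ρ) γ := by
  rw [WeightLE, reflect, add_sub_cancel_left]
  generalize p * m - pairing (x + ρ) γ = k
  constructor
  · intro h
    have h1 := two_mul_add_nonneg_of_mem_closure h
    cases γ <;>
      simp only [PosRoot.wt, AddSubgroup.coe_zsmul, Prod.smul_fst, Prod.smul_snd,
        smul_eq_mul] at h1 <;>
      linarith
  · intro h
    lift k to ℕ using h
    rw [natCast_zsmul]
    exact nsmul_mem (AddSubmonoid.subset_closure (Set.mem_range_self γ)) _

/-- A step `x ↑_γ y` adds `N γ` with `0 ≤ N < p`. -/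
theorem UpAt.exists_nat {p : ℕ} {γ : PosRoot} {n : ℤ} {x y : Weight}
    (h : UpAt p γ n x y) :
    ∃ N : ℕ, N < p ∧ p * n - pairing (x + ρ) γ = N ∧ y = x + (N : ℤ) • γ.wt := by
  obtain ⟨hy, hmem, hleast⟩ := h
  have h0 := (weightLE_reflect_iff p γ n x).1 hmem
  have h1 : ¬ WeightLE x (reflect p γ (n - 1) x) := fun hle => by
    have := hleast hle; linarith
  rw [weightLE_reflect_iff, not_le] at h1
  obtain ⟨N, hN⟩ := Int.eq_ofNat_of_zero_le h0
  refine ⟨N, ?_, hN, ?_⟩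
  · have : (N : ℤ) < p := by rw [← hN]; linarith
    exact_mod_cast this
  · rw [hy, reflect, hN]

theorem exists_pairing_eq_one (γ : PosRoot) : ∃ ν : Weight, pairing ν γ = 1 := by
  cases γ
  · exact ⟨⟨(1, 0, 1), (by decide : _ ≡ _ [ZMOD 2])⟩, rfl⟩
  · exact ⟨⟨(1, 1, 0), (by decide : _ ≡ _ [ZMOD 2])⟩, rfl⟩
  · exact ⟨⟨(1, 0, 1), (by decide : _ ≡ _ [ZMOD 2])⟩, rfl⟩
  · exact ⟨⟨(1, 0, 1), (by decide : _ ≡ _ [ZMOD 2])⟩, rfl⟩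

end Weights

/-! ### The singular vector of a reflection -/

section RootSing

/-- The parameter `P` of the singular vector of weight `y - N γ`. The values here and in
`PosRoot.paramR` solve the equations of `opα_singVec` and `opβ_singVec` if `⟨y + ρ, γ^∨⟩ = N`. -/
def PosRoot.paramP (γ : PosRoot) (N : ℕ) (y : Weight) : ℤ :=
  match γ with
  | .α => N
  | .β => 0
  | .αβ => N
  | .ααβ => 2 * N - (y.1.1 - y.1.2.1) - 1

/-- The parameter `R` of the singular vector of weight `y - N γ`. -/
def PosRoot.paramR (γ : PosRoot) (N : ℕ) (y : Weight) : ℤ :=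
  match γ with
  | .α => 0
  | .β => 0
  | .αβ => y.1.2.1 + 1
  | .ααβ => N

/-- The vector of weight `y - N γ` in the model of `Ver_B(y)` that is singular if
`⟨y + ρ, γ^∨⟩ = N`. For a simple root it is `y_γ ^ N`. -/
def rootSing (γ : PosRoot) (N : ℕ) (y : Weight) : Pol ℤ :=
  singVec (γ.coeffα * N) (γ.coeffβ * N) (γ.paramP N y) (γ.paramR N y)

theorem singCoeff_eq_zero_of_lt_add_two_mul {N : ℕ} (R : ℤ) {b c : ℕ} (h : N < b + 2 * c) :
    singCoeff N R b c = 0 := by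
  rw [singCoeff, descPochhammer_eval_coe_nat_of_lt h, zero_mul]

theorem singCoeff_eq_zero_of_lt_add {N : ℕ} (P : ℤ) {b c : ℕ} (h : N < b + c) :
    singCoeff P N b c = 0 := by
  rw [singCoeff, Ring.choose_natCast, Nat.choose_eq_zero_of_lt h]
  simp

theorem isSingular_rootSing {γ : PosRoot} {N : ℕ} {y : Weight} (h : pairing (y + ρ) γ = N) :
    IsSingular y (γ.coeffα * N) (γ.coeffβ * N) (rootSing γ N y) := by
  have hz : ∀ P : ℤ, ∀ b c : ℕ, b + c ≠ 0 → singCoeff P 0 b c = 0 := fun P b c hbc =>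
    singCoeff_eq_zero_of_lt_add (N := 0) P (by omega)
  obtain ⟨⟨u, v, w⟩, hy⟩ := y
  have hw : HasWeight (γ.coeffα * N) (γ.coeffβ * N) (rootSing γ N ⟨(u, v, w), hy⟩) := by
    intro a b c d hne
    rw [rootSing, coef_singVec] at hne
    by_contra hc
    exact hne (if_neg hc)
  cases γ
  · have h' : u - v + 1 = (N : ℤ) := by
      simp only [pairing, ρ, AddSubgroup.coe_add, Prod.fst_add, Prod.snd_add] at h; linarith
    refine ⟨opα_singVec ?_ ?_, opβ_singVec ?_ ?_, hw⟩
    · intro b c hbc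
      exact hz _ _ _ (by simp only [PosRoot.coeffβ] at hbc; omega)
    · intro b c
      by_cases hbc : b + c = 0
      · obtain ⟨rfl, rfl⟩ : b = 0 ∧ c = 0 := by omega
        simp only [PosRoot.coeffα, PosRoot.paramR]; push_cast
        linear_combination (singCoeff _ 0 0 0 * N) * h'
      · exact mul_eq_zero_of_left (hz _ _ _ hbc) _
    · intro b c hbc
      exact hz _ _ _ (by omega)
    · intro b c
      by_cases hbc : b + c = 0
      · obtain ⟨rfl, rfl⟩ : b = 0 ∧ c = 0 := by omega
        simp [PosRoot.coeffβ, PosRoot.paramR]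
      · exact mul_eq_zero_of_left (hz _ _ _ hbc) _
  · have h' : v + 1 = (N : ℤ) := by
      simp only [pairing, ρ, AddSubgroup.coe_add, Prod.fst_add, Prod.snd_add] at h; linarith
    refine ⟨opα_singVec ?_ ?_, opβ_singVec ?_ ?_, hw⟩
    · intro b c hbc
      exact hz _ _ _ (by omega)
    · intro b c
      by_cases hbc : b + c = 0
      · obtain ⟨rfl, rfl⟩ : b = 0 ∧ c = 0 := by omega
        simp [PosRoot.coeffα, PosRoot.paramP]
      · exact mul_eq_zero_of_left (hz _ _ _ hbc) _
    · intro b c hbc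
      exact hz _ _ _ (by simp only [PosRoot.coeffα] at hbc; omega)
    · intro b c
      by_cases hbc : b + c = 0
      · obtain ⟨rfl, rfl⟩ : b = 0 ∧ c = 0 := by omega
        simp only [PosRoot.coeffα, PosRoot.coeffβ, PosRoot.paramR, PosRoot.paramP]; push_cast
        linear_combination (singCoeff 0 0 0 0 * N) * h'
      · exact mul_eq_zero_of_left (hz _ _ _ hbc) _
  · have h' : u + v + 3 = (N : ℤ) := by
      simp only [pairing, ρ, AddSubgroup.coe_add, Prod.fst_add, Prod.snd_add] at h; linarith
    refine ⟨opα_singVec ?_ ?_, opβ_singVec ?_ ?_, hw⟩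
    · intro b c hbc
      exact singCoeff_eq_zero_of_lt_add_two_mul _ (by simp only [PosRoot.coeffβ] at hbc; omega)
    · intro b c
      simp only [PosRoot.coeffα, PosRoot.paramR, PosRoot.paramP]; push_cast
      linear_combination (singCoeff N (v + 1) b c * (N - (b + 2 * c))) * h'
    · intro b c hbc
      exact singCoeff_eq_zero_of_lt_add_two_mul _ (by simp only [PosRoot.coeffα] at hbc; omega)
    · intro b c
      simp only [PosRoot.coeffα, PosRoot.coeffβ, PosRoot.paramR, PosRoot.paramP]; push_cast
      ring
  · have h' : u + 2 = (N : ℤ) := by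
      simp only [pairing, ρ, AddSubgroup.coe_add, Prod.fst_add] at h; linarith
    refine ⟨opα_singVec ?_ ?_, opβ_singVec ?_ ?_, hw⟩
    · intro b c hbc
      exact singCoeff_eq_zero_of_lt_add _ (by simp only [PosRoot.coeffβ] at hbc; omega)
    · intro b c
      simp only [PosRoot.coeffα, PosRoot.paramR, PosRoot.paramP]; push_cast
      ring
    · intro b c hbc
      exact singCoeff_eq_zero_of_lt_add _ (by simp only [PosRoot.coeffα] at hbc; omega)
    · intro b c
      simp only [PosRoot.coeffα, PosRoot.coeffβ, PosRoot.paramR, PosRoot.paramP]; push_cast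
      linear_combination (singCoeff (2 * N - (u - v) - 1) N b c * (N - (b + c))) * h'

theorem coef_rootSing_lead (γ : PosRoot) (N : ℕ) (y : Weight) :
    coef (rootSing γ N y) (γ.coeffβ * N) 0 0 (γ.coeffα * N) = 1 := by
  rw [rootSing, coef_singVec, if_pos (by simp), singCoeff_zero_zero]

variable {p : ℕ} [Fact p.Prime]

theorem cast_descPochhammer_congr {P P' : ℤ} (h : (P : ZMod p) = P') (n : ℕ) :
    (((descPochhammer ℤ n).eval P : ℤ) : ZMod p) = ((descPochhammer ℤ n).eval P' : ℤ) := by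
  rw [descPochhammer_eval_cast, descPochhammer_eval_cast, h]

/-- The bound on `b + c` makes the factorial in the denominator of the binomial coefficient
invertible modulo `p`. -/
theorem cast_singCoeff_congr {P P' R R' : ℤ} (hP : (P : ZMod p) = P') (hR : (R : ZMod p) = R')
    {b c : ℕ} (h : b + c < p) : (singCoeff P R b c : ZMod p) = singCoeff P' R' b c := by
  have key : ∀ Q : ℤ, ((b + c).factorial : ZMod p) * ((Ring.choose Q (b + c) : ℤ) : ZMod p)
      = ((descPochhammer ℤ (b + c)).eval Q : ℤ) := by
    intro Q
    have e := Ring.descPochhammer_eq_factorial_smul_choose Q (b + c)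
    rw [← Polynomial.eval_eq_smeval, nsmul_eq_mul] at e
    rw [e]; push_cast; rfl
  have hne : ((b + c).factorial : ZMod p) ≠ 0 := by
    rw [Ne, ZMod.natCast_eq_zero_iff, (Fact.out : p.Prime).dvd_factorial]
    omega
  have hch : ((Ring.choose R (b + c) : ℤ) : ZMod p) = (Ring.choose R' (b + c) : ℤ) := by
    apply mul_left_cancel₀ hne
    rw [key, key, cast_descPochhammer_congr hR]
  rw [singCoeff, singCoeff]
  push_cast
  rw [hch, hP]

/-- Modulo `p` the singular vector depends only on the class of `y` modulo `p`; this is why the line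
`L` does not depend on `ν`. -/
theorem map_rootSing_congr (γ : PosRoot) {N : ℕ} (hN : N < p) (y ν : Weight) (k : ℤ) :
    map (Int.castRingHom (ZMod p)) (rootSing γ N (y - (p * k) • ν))
      = map (Int.castRingHom (ZMod p)) (rootSing γ N y) := by
  apply pol_ext
  intro a b c d
  rw [coef_map, coef_map, rootSing, rootSing, coef_singVec, coef_singVec]
  split_ifs with h
  · have hle : γ.coeffβ * N ≤ N := by nlinarith [γ.coeffβ_le_one]
    refine cast_singCoeff_congr ?_ ?_ (by omega)
    all_goals
      cases γ <;>
      simp only [PosRoot.paramP, PosRoot.paramR, AddSubgroup.coe_sub, AddSubgroup.coe_zsmul,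
        Prod.fst_sub, Prod.snd_sub, Prod.smul_fst, Prod.smul_snd, smul_eq_mul] <;>
      push_cast <;> simp
  · rfl

end RootSing

/-! ### Uniqueness of singular vectors in characteristic zero -/

section UniqueHom

variable {A : Type} [CommRing A]

theorem memLieB_xα : MemLieB (xα : lieG A) := by
  intro i j h
  revert h
  fin_cases i <;> fin_cases j <;> simp [xα]

theorem memLieB_xβ : MemLieB (xβ : lieG A) := by
  intro i j h
  revert h
  fin_cases i <;> fin_cases j <;> simp [xβ]

/-- The diagonal matrix `diag(r, s, -s, -r)`. -/
def diagElt (r s : A) : lieG A := ⟨!![r, 0, 0, 0; 0, s, 0, 0; 0, 0, -s, 0; 0, 0, 0, -r], 0, by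
  ext i j; fin_cases i <;> fin_cases j <;> simp [J, Matrix.mul_apply, Fin.sum_univ_four]⟩

theorem memLieB_diagElt (r s : A) : MemLieB (diagElt r s) := by
  intro i j h
  revert h
  fin_cases i <;> fin_cases j <;> simp [diagElt]

/-- The weight equation at `diag(r, s, -s, -r)` for the image of the highest weight vector. -/
theorem coef_of_hom {x y : Weight} {K B : ℕ}
    (hx : x = y - (K : ℤ) • PosRoot.α.wt - (B : ℤ) • PosRoot.β.wt)
    (Φ : Verma A x →ₗ[Ug A] Verma A y) {q : Pol A}
    (hΦ : Φ (Verma.mk x 1) = Verma.mk y (pbw q)) (r s : A) (a b c d : ℕ) :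
    (-(2 * s) * a + (-s - r) * b - 2 * r * c + (s - r) * d) * coef q a b c d
      = (-(2 * s) * B + (s - r) * K) * coef q a b c d := by
  have h := congrArg (fun t => coef t a b c d) (op_of_hom Φ hΦ (memLieB_diagElt r s))
  simp only [op_of_memLieB y (memLieB_diagElt r s)] at h
  have e00 : (diagElt r s).1 0 0 = r := rfl
  have e11 : (diagElt r s).1 1 1 = s := rfl
  have e22 : (diagElt r s).1 2 2 = -s := rfl
  have e33 : (diagElt r s).1 3 3 = -r := rfl
  have e01 : (diagElt r s).1 0 1 = 0 := rfl
  have e12 : (diagElt r s).1 1 2 = 0 := rfl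
  have e02 : (diagElt r s).1 0 2 = 0 := rfl
  have e03 : (diagElt r s).1 0 3 = 0 := rfl
  rw [hx, lieChar_sub, e00, e11, e22, e33, e01, e12, e02, e03] at h
  simp only [map_zero, zero_mul, sub_zero, add_zero] at h
  rw [coef_opDiag, coef_C_mul] at h
  push_cast at h
  linear_combination h

/-- In characteristic zero every map `Ver_B(x) → Ver_B(y)` is a multiple of the one given by a
singular vector with leading coefficient `1`. -/
theorem eq_C_mul_of_hom [IsDomain A] [CharZero A] {x y : Weight} {K B : ℕ}
    (hx : x = y - (K : ℤ) • PosRoot.α.wt - (B : ℤ) • PosRoot.β.wt) {F : Pol ℤ}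
    (hF : IsSingular y K B F) (hlead : coef F B 0 0 K = 1) (Φ : Verma A x →ₗ[Ug A] Verma A y)
    {q : Pol A} (hΦ : Φ (Verma.mk x 1) = Verma.mk y (pbw q)) :
    q = C (coef q B 0 0 K) * map (Int.castRingHom A) F := by
  have hwt : HasWeight K B q := by
    intro a b c d hne
    -- The Cartan elements `diag(1, 0, 0, -1)` and `diag(0, 1, -1, 0)` detect the weight.
    have h1 := mul_right_cancel₀ hne (coef_of_hom hx Φ hΦ 1 0 a b c d)
    have h2 := mul_right_cancel₀ hne (coef_of_hom hx Φ hΦ 0 1 a b c d)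
    have h3 : ((b + 2 * c + d : ℕ) : A) = (K : ℕ) := by push_cast; linear_combination -h1
    have h4 : ((2 * a + b + K : ℕ) : A) = (2 * B + d : ℕ) := by push_cast; linear_combination -h2
    have h5 := Nat.cast_injective h3
    have h6 := Nat.cast_injective h4
    omega
  have h0 : ∀ Z : lieG A, lieChar x Z = 0 → MemLieB Z → op y Z q = 0 := fun Z hZ hB => by
    rw [op_of_hom Φ hΦ hB, hZ, map_zero, zero_mul]
  have hα : opα y q = 0 := by
    rw [← op_xα]; exact h0 _ (by simp [lieChar, xα]) memLieB_xα
  have hβ : opβ y q = 0 := by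
    rw [← op_xβ]; exact h0 _ (by simp [lieChar, xβ]) memLieB_xβ
  have hFα : opα y (map (Int.castRingHom A) F) = 0 := by
    rw [← op_xα, hF.op_map memLieB_xα]; simp [lieChar, xα]
  have hFβ : opβ y (map (Int.castRingHom A) F) = 0 := by
    rw [← op_xβ, hF.op_map memLieB_xβ]; simp [lieChar, xβ]
  rw [← sub_eq_zero]
  refine singular_eq_zero (μ := y) (K := K) (B := B) ?_ ?_ ?_ ?_
  · rw [← op_xα, map_sub, ← smul_eq_C_mul, map_smul, op_xα, op_xα, hα, hFα, smul_zero, sub_zero]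
  · rw [← op_xβ, map_sub, ← smul_eq_C_mul, map_smul, op_xβ, op_xβ, hβ, hFβ, smul_zero, sub_zero]
  · intro a b c d hne
    rw [coef_sub, coef_C_mul] at hne
    by_contra hc
    have e1 : coef q a b c d = 0 := by
      by_contra h; exact hc (hwt _ _ _ _ h)
    have e2 : coef (map (Int.castRingHom A) F) a b c d = 0 := by
      by_contra h; exact hc (hF.map_weight _ _ _ _ h)
    rw [e1, e2, mul_zero, sub_zero] at hne
    exact hne rfl
  · rw [coef_sub, coef_C_mul, coef_map, hlead, map_one, mul_one, sub_self]

end UniqueHom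

/-! ### Maps attached to a linkage -/

section Linkage

variable {p : ℕ} {γ : PosRoot} {n : ℤ} {N : ℕ} {x y : Weight}

theorem reflect_zero_sub (hN : p * n - pairing (x + ρ) γ = N) (hy : y = x + (N : ℤ) • γ.wt)
    {ν : Weight} (hν : pairing ν γ = 1) :
    reflect p γ 0 (x - (p * n) • ν) = y - (p * n) • ν := by
  have e : x - (p * n) • ν + ρ = (x + ρ) + (-(p * n)) • ν := by rw [neg_smul]; abel
  rw [reflect, e, pairing_add, pairing_zsmul, hν, hy]
  have e2 : (p * 0 - (pairing (x + ρ) γ + -(p * n) * 1) : ℤ) = N := by rw [← hN]; ring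
  rw [e2]
  abel

theorem pairing_sub_add_rho (hN : p * n - pairing (x + ρ) γ = N)
    (hy : y = x + (N : ℤ) • γ.wt) {ν : Weight} (hν : pairing ν γ = 1) :
    pairing (y - (p * n) • ν + ρ) γ = N := by
  have e : y - (p * n) • ν + ρ = (x + ρ) + ((N : ℤ) • γ.wt + (-(p * n)) • ν) := by
    rw [neg_smul, hy]; abel
  rw [e, pairing_add (x + ρ), pairing_add (_ • _), pairing_zsmul, pairing_zsmul,
    pairing_wt_self, hν]
  linarith

theorem eq_sub_simple (γ : PosRoot) (N : ℕ) (hy : y = x + (N : ℤ) • γ.wt) :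
    x = y - ((γ.coeffα * N : ℕ) : ℤ) • PosRoot.α.wt - ((γ.coeffβ * N : ℕ) : ℤ) • PosRoot.β.wt := by
  rw [hy, γ.wt_eq, smul_add, smul_smul, smul_smul]
  push_cast
  rw [mul_comm (N : ℤ), mul_comm (N : ℤ)]
  abel

variable [Fact p.Prime]

/-- The reduction of the integral singular vector is a singular vector for the weights `x` and `y`
themselves, as `p n ν` has differential zero in characteristic `p`. -/
theorem exists_hom_rootSing (hNp : N < p) (hN : p * n - pairing (x + ρ) γ = N)
    (hy : y = x + (N : ℤ) • γ.wt) :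
    ∃ Φ ∈ homUgB (ZMod p) x y, Φ (Verma.mk x 1)
      = Verma.mk y (pbw (map (Int.castRingHom (ZMod p)) (rootSing γ N y))) := by
  obtain ⟨ν, hν⟩ := exists_pairing_eq_one γ
  obtain ⟨Φ, hΦ, h⟩ := exists_mem_homUgB (R := ZMod p) (x := x) (y := y)
    (isSingular_rootSing (pairing_sub_add_rho hN hy hν)) (eq_sub_simple γ N hy) (by
      intro A _ φ Z
      have hp : (p : A) = 0 := by rw [← map_natCast φ p, CharP.cast_eq_zero, map_zero]
      have e : y = (y - (p * n) • ν) + (p * n) • ν := by abel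
      have hz : lieChar ((p * n : ℤ) • ν) Z = 0 := by
        rw [lieChar_zsmul]; push_cast; rw [hp]; ring
      conv_lhs => rw [e]
      rw [lieChar_add, hz, add_zero])
  refine ⟨Φ, hΦ, ?_⟩
  rw [h, one_mul, map_rootSing_congr γ hNp]

theorem map_rootSing_ne_zero {A : Type} [CommRing A] [Nontrivial A] (γ : PosRoot) (N : ℕ)
    (y : Weight) : map (Int.castRingHom A) (rootSing γ N y) ≠ 0 := by
  intro h
  have h1 := congrArg (fun q => coef q (γ.coeffβ * N) 0 0 (γ.coeffα * N)) h
  simp only [coef_map, coef_rootSing_lead, map_one, coef_zero] at h1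
  exact one_ne_zero h1

theorem pbw_ne_zero {A : Type} [CommRing A] {q : Pol A} (hq : q ≠ 0) : pbw q ≠ 0 := by
  intro h
  apply hq
  rw [← act_pbw_one 0 q, h, map_zero, LinearMap.zero_apply]

theorem isIntegralVermaMap_rootSing (hy : y = x + (N : ℤ) • γ.wt) (h : pairing (y + ρ) γ = N) :
    IsIntegralVermaMap p x y (pbw (map (Int.castRingHom ℤ_[p]) (rootSing γ N y))) := by
  refine ⟨pbw_mem_UuMinus _, ?_, ?_⟩
  · have hc : (PadicInt.toZMod (p := p)).comp (Int.castRingHom ℤ_[p])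
      = Int.castRingHom (ZMod p) := RingHom.ext_int _ _
    rw [UgMap_pbw, map_map, hc]
    exact pbw_ne_zero (map_rootSing_ne_zero γ N y)
  · obtain ⟨ψ, hψ, e⟩ := exists_mem_homUgB (R := ℚ_[p]) (isSingular_rootSing h)
      (eq_sub_simple γ N hy) (fun _ _ _ _ => rfl)
    have hc : (PadicInt.Coe.ringHom (p := p)).comp (Int.castRingHom ℤ_[p])
      = Int.castRingHom ℚ_[p] := RingHom.ext_int _ _
    exact ⟨ψ, hψ, by rw [e, one_mul, UgMap_pbw, map_map, hc]⟩

/-- The vector `f` is a multiple of the integral singular vector by uniqueness over `ℚ_p`, and the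
scalar is integral because the singular vector has leading coefficient `1`. -/
theorem IsIntegralVermaMap.toZMod_eq (hy : y = x + (N : ℤ) • γ.wt) (h : pairing (y + ρ) γ = N)
    {f : Ug ℤ_[p]} (hf : IsIntegralVermaMap p x y f) :
    ∃ c : ZMod p, c ≠ 0 ∧ UgMap PadicInt.toZMod f
      = c • pbw (map (Int.castRingHom (ZMod p)) (rootSing γ N y)) := by
  obtain ⟨hu, hne, ψ, -, hψ⟩ := hf
  obtain ⟨q, rfl⟩ : ∃ q, pbw q = f := ⟨_, UuMinus_eq_pbw 0 hu⟩
  rw [UgMap_pbw] at hψ hne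
  have hq := eq_C_mul_of_hom (eq_sub_simple γ N hy) (isSingular_rootSing h)
    (coef_rootSing_lead γ N y) ψ hψ
  set c : ℤ_[p] := coef q (γ.coeffβ * N) 0 0 (γ.coeffα * N) with hc
  have hinj : Function.Injective (PadicInt.Coe.ringHom (p := p)) := Subtype.val_injective
  have hc1 : (PadicInt.Coe.ringHom (p := p)).comp (Int.castRingHom ℤ_[p])
      = Int.castRingHom ℚ_[p] := RingHom.ext_int _ _
  have hc2 : (PadicInt.toZMod (p := p)).comp (Int.castRingHom ℤ_[p])
      = Int.castRingHom (ZMod p) := RingHom.ext_int _ _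
  have hq' : q = C c * map (Int.castRingHom ℤ_[p]) (rootSing γ N y) := by
    apply map_injective _ hinj
    rw [hq, coef_map, ← hc, map_mul, map_C, map_map, hc1]
  have e : map PadicInt.toZMod q
      = PadicInt.toZMod c • map (Int.castRingHom (ZMod p)) (rootSing γ N y) := by
    rw [hq', map_mul, map_C, map_map, hc2, smul_eq_C_mul]
  refine ⟨PadicInt.toZMod c, ?_, ?_⟩
  · intro h0
    apply hne
    rw [e, h0, zero_smul, map_zero]
  · rw [UgMap_pbw, e, map_smul]

end Linkage

theorem homUgB_ne_bot_of_up (p : ℕ) [Fact p.Prime] {x y : Weight} (h : Up p x y) :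
    homUgB (ZMod p) x y ≠ ⊥ := by
  suffices H : ∃ Φ ∈ homUgB (ZMod p) x y, Φ ≠ 0 from (Submodule.ne_bot_iff _).2 H
  induction h with
  | refl =>
    refine ⟨_, id_mem_homUgB x, (hom_ne_zero_iff (q := 1) _ ?_).2 one_ne_zero⟩
    rw [pbw_one]; rfl
  | @tail y z _ hstep ih =>
    obtain ⟨γ, n, hup⟩ := hstep
    obtain ⟨Φ, hΦ, hne⟩ := ih
    obtain ⟨N, hNp, hN, hz⟩ := hup.exists_nat
    obtain ⟨Ψ, hΨ, hΨ1⟩ := exists_hom_rootSing hNp hN hz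
    exact ⟨_, comp_mem_homUgB hΦ hΨ,
      comp_ne_zero hne ((hom_ne_zero_iff Ψ hΨ1).2 (map_rootSing_ne_zero γ N z))⟩

end GSp4

end

open GSp4 in
theorem mainTheorem8 (p : ℕ) [Fact p.Prime] :
    (∀ (γ : PosRoot) (n : ℤ) (x y : Weight), UpAt p γ n x y →
      ∃ L : Submodule (ZMod p) (Verma (ZMod p) x →ₗ[Ug (ZMod p)] Verma (ZMod p) y),
        L ≤ homUgB (ZMod p) x y ∧ Module.finrank (ZMod p) L = 1 ∧
        ∀ ν : Weight, pairing ν γ = 1 →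
          (∃ f : Ug ℤ_[p], IsIntegralVermaMap p (x - (p * n) • ν)
            (reflect p γ 0 (x - (p * n) • ν)) f) ∧
          ∀ f : Ug ℤ_[p], IsIntegralVermaMap p (x - (p * n) • ν)
              (reflect p γ 0 (x - (p * n) • ν)) f →
            ∃ Φ : Verma (ZMod p) x →ₗ[Ug (ZMod p)] Verma (ZMod p) y,
              Φ (Verma.mk x 1) = Verma.mk y (UgMap PadicInt.toZMod f) ∧
              L = Submodule.span (ZMod p) {Φ}) ∧
    (∀ x y : Weight, Up p x y → homUgB (ZMod p) x y ≠ ⊥) := by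
  refine ⟨fun γ n x y h => ?_, fun _ _ h => homUgB_ne_bot_of_up p h⟩
  obtain ⟨N, hNp, hN, hy⟩ := h.exists_nat
  obtain ⟨Φ, hΦ, hΦ1⟩ := exists_hom_rootSing hNp hN hy
  have hne : Φ ≠ 0 := (hom_ne_zero_iff Φ hΦ1).2 (map_rootSing_ne_zero γ N y)
  refine ⟨Submodule.span (ZMod p) {Φ}, (Submodule.span_singleton_le_iff_mem _ _).2 hΦ,
    finrank_span_singleton hne, fun ν hν => ?_⟩
  rw [reflect_zero_sub hN hy hν]
  have hy' : y - (p * n) • ν = x - (p * n) • ν + (N : ℤ) • γ.wt := by rw [hy]; abel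
  have hp := pairing_sub_add_rho hN hy hν
  refine ⟨⟨_, isIntegralVermaMap_rootSing hy' hp⟩, fun f hf => ?_⟩
  obtain ⟨c, hc, e⟩ := hf.toZMod_eq hy' hp
  refine ⟨c • Φ, ?_, (Submodule.span_singleton_smul_eq (IsUnit.mk0 c hc) Φ).symm⟩
  rw [LinearMap.smul_apply, hΦ1, e, map_rootSing_congr γ hNp, Verma.mk_smul]
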